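/- **Setting.** A quantum state is a density operator on the space $(\mathbb{C}^2)^{\otimes n}$ of $n$ qubits, for some $n\in\mathbb{N}$. A *deterministic-control quantum Turing machine* (dcq-TM) is a pair $(Q,\delta)$ of a finite set $Q$ of control states, containing two distinct states $q_s$ (start) and $q_h$ (halt), and a transition function $$\delta: Q\times\{0,1,\square\}\to \mathbb{U}\times\{L,N,R\}\times\{0,1,\square\}\times\{L,N,R\}\times Q,\qquad \mathbb{U}=\{\mathrm{Id},\ H,\ S=\mathrm{diag}(1,i),\ T=\mathrm{diag}(1,e^{i\pi/4}),\ \mathrm{SWAP},\ \mathrm{CNOT}\}.$$ It has a classical tape and a quantum tape, both infinite in both directions with cells indexed by $\mathbb{Z}$; each cell of the quantum tape is a qubit. When the control state is $q\neq q_h$ and the scanned classical symbol is $a$, and $\delta(q,a)=(U,d,a',d',q')$, the machine applies $U$ at the quantum head (a one-qubit gate to the scanned cell; a two-qubit gate to the scanned cell and its right neighbour, in this order, the first being the control of $\mathrm{CNOT}$), moves the quantum head by $d$, writes $a'$, moves the classical head by $d'$ and enters $q'$. It halts when it reaches $q_h$. Natural numbers are written as binary strings (least significant digit first, $0$ being the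 empty string). On input $(x;\rho)$, with $x$ a binary string and $\rho$ a state of $n$ qubits, the machine starts in $q_s$ with both heads on cell $0$, with $x\,\square\,n$ written on the classical tape from cell $1$ on (blanks elsewhere), and with $\rho$ in the cells $1,\dots,n$ of the quantum tape (all other cells in state $|0\rangle$). When it has halted, its output is $(y;\sigma)$, where $y$ is the string between cell $0$ and the first blank to its right on the classical tape, $m$ is the number denoted by the string between the first and the second blank to the right of cell $0$, and $\sigma$ is the reduced state of the cells $1,\dots,m$ of the quantum tape. One writes $\mathsf{T}(x;\rho)=(y;\sigma)$; the empty string is denoted by $\square$ and the empty ($0$-qubit) state by $\epsilon$. A state $\sigma$ is *directly dcq-computable* if $\mathsf{T}(\square;\epsilon)=(\square;\sigma)$ for some dcq-TM $\mathsf{T}$. A state $\rho$ of $n$ qubits is *dcq-computable*, $\rho\in\mathsf{COMP_q}$, if there are a dcq-TM $\mathsf{T}$ and a sequence $(\sigma_k)_{k\ge 1}$ of directly dcq-computable $n$-qubit states such that for all $k\geq 1$: $\mathsf{T}(k;\epsilon)=(\square;\sigma_k)$ and $D(\rho,\sigma_k)\le 1/k$, where $D(\rho,\sigma)=\tfrac12\|\rho-\sigma\|_1$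 is the trace distance. A real number $r$ is *computable* if there is a computable function that maps every integer $k\ge1$ to a rational number $q_k$ with $|r-q_k|\le 1/k$. Let $\mathsf{COMP_c}$ be the set of quantum states such that all entries of the density matrix in the computational basis have computable real and imaginary parts. **Theorem.** $\mathsf{COMP_q}=\mathsf{COMP_c}$. -/

import Mathlib

open scoped ComplexOrder

namespace DCQ

noncomputable section

/-! ### Quantum states of finitely many qubits -/

/-- A state of `n` qubits, given by its density matrix in the computational basis; the basis kets
are indexed by the bit strings of length `n`. -/
@[ext]
structure QState (n : ℕ) where
  mat : Matrix (Fin n → Fin 2) (Fin n → Fin 2) ℂ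
  posSemidef : mat.PosSemidef
  trace_eq_one : mat.trace = 1

/-- The empty quantum input: the unique state of zero qubits. -/
def emptyState : QState 0 where
  mat := 1
  posSemidef := Matrix.PosSemidef.one
  trace_eq_one := by simp

theorem QState.sub_isHermitian {n : ℕ} (ρ σ : QState n) : (ρ.mat - σ.mat).IsHermitian :=
  ρ.posSemidef.isHermitian.sub σ.posSemidef.isHermitian

/-- The trace distance `D(ρ, σ) = ½ ‖ρ - σ‖₁`; since `ρ - σ` is Hermitian, its trace norm is the
sum of the absolute values of its eigenvalues, counted with multiplicity. -/
def traceDist {n : ℕ} (ρ σ : QState n) : ℝ :=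
  (1 / 2) * ∑ i, |(ρ.sub_isHermitian σ).eigenvalues i|

/-! ### The gate set -/

/-- The six gates: identity, Hadamard, phase, `π/8`, swap and controlled-not. -/
inductive Gate
  | idle
  | hadamard
  | phase
  | piEighth
  | swap
  | cnot

/-- The matrix of a gate on an ordered pair of qubits. The one-qubit gates act on the first qubit
of the pair; for the controlled-not the first qubit is the control. -/
def Gate.matrix : Gate → Matrix (Fin 2 × Fin 2) (Fin 2 × Fin 2) ℂ
  | .idle => 1
  | .hadamard =>
      Matrix.kronecker ((1 / (Real.sqrt 2 : ℂ)) • !![1, 1; 1, -1]) (1 : Matrix (Fin 2) (Fin 2) ℂ)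
  | .phase =>
      Matrix.kronecker !![1, 0; 0, Complex.I] (1 : Matrix (Fin 2) (Fin 2) ℂ)
  | .piEighth =>
      Matrix.kronecker !![1, 0; 0, Complex.exp (Complex.I * (Real.pi / 4))]
        (1 : Matrix (Fin 2) (Fin 2) ℂ)
  | .swap => Matrix.of fun p q => if p = (q.2, q.1) then 1 else 0
  | .cnot => Matrix.of fun p q => if p = (q.1, q.1 + q.2) then 1 else 0

/-! ### The quantum tape -/

/-- The label of a computational basis ket of the two-sided infinite quantum tape: one bit for
each cell. -/
abbrev Label := ℤ → Fin 2

/-- The state of the quantum tape, as a density matrix in the computational basis. In every tape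
that occurs in a computation only finitely many entries are nonzero, all of them at labels which
are `0` on all but finitely many cells. -/
abbrev QTape := Label → Label → ℂ

/-- The bits of a label in the cells `1, …, n`. -/
def window (n : ℕ) (e : Label) : Fin n → Fin 2 := fun i => e ((i : ℤ) + 1)

open Classical in
/-- The tape with the state `ρ` in the cells `1, …, n` and all other cells in the state `|0⟩`. -/
def initQTape {n : ℕ} (ρ : QState n) : QTape := fun e e' =>
  if ∀ j : ℤ, ¬ (1 ≤ j ∧ j ≤ n) → e j = 0 ∧ e' j = 0 then ρ.mat (window n e) (window n e') else 0

/-- The bits of a label in the cells `h` and `h + 1`. -/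
def pairAt (h : ℤ) (e : Label) : Fin 2 × Fin 2 := (e h, e (h + 1))

/-- The label `e` with the bits in the cells `h` and `h + 1` replaced by `p`. -/
def setPair (h : ℤ) (e : Label) (p : Fin 2 × Fin 2) : Label :=
  Function.update (Function.update e h p.1) (h + 1) p.2

/-- The tape `U ρ U†`, where `U` is the gate `g` acting on the cells `h` and `h + 1`. -/
def applyGate (g : Gate) (h : ℤ) (ρ : QTape) : QTape := fun e e' =>
  ∑ p : Fin 2 × Fin 2, ∑ p' : Fin 2 × Fin 2,
    g.matrix (pairAt h e) p * ρ (setPair h e p) (setPair h e' p') *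
      star (g.matrix (pairAt h e') p')

/-- The label `e` with the bits in the cells `1, …, n` replaced by `b`. -/
def overwrite (n : ℕ) (b : Fin n → Fin 2) (e : Label) : Label := fun j =>
  if hj : 1 ≤ j ∧ j ≤ n then b ⟨(j - 1).toNat, by omega⟩ else e j

/-- The reduced density matrix of the cells `1, …, n`: the partial trace over all other cells. The
entry at `(a, b)` sums over all labels `e` with bits `a` in these cells. -/
def reduced (n : ℕ) (ρ : QTape) : Matrix (Fin n → Fin 2) (Fin n → Fin 2) ℂ :=
  Matrix.of fun a b => ∑ᶠ e : {e : Label // window n e = a}, ρ e.1 (overwrite n b e.1)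

/-! ### The machine -/

/-- The alphabet `{0, 1, □}` of the classical tape; `none` is the blank. -/
abbrev Sym := Option Bool

/-- Head displacements: left, none, right. -/
inductive Disp
  | left
  | stay
  | right

/-- The displacement as a number of cells. -/
def Disp.toInt : Disp → ℤ
  | .left => -1
  | .stay => 0
  | .right => 1

/-- A deterministic-control quantum Turing machine. A transition reads the control state and the
scanned symbol of the classical tape, and determines the gate to apply, the move of the quantum
head, the symbol to write, the move of the classical head, and the next control state. -/
structure DcqTM where
  Q : Type
  fintypeQ : Fintype Q
  start : Q
  halt : Q
  start_ne_halt : start ≠ halt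
  δ : Q → Sym → Gate × Disp × Sym × Disp × Q

/-- A configuration: control state, classical tape, classical head, quantum tape, quantum head. -/
@[ext]
structure Config (M : DcqTM) where
  state : M.Q
  ctape : ℤ → Sym
  chead : ℤ
  qtape : QTape
  qhead : ℤ

/-- The natural number `k` as a string: its binary digits, least significant first (so that `0` is
the empty string). -/
def natString (k : ℕ) : List Bool := Nat.bits k

/-- The natural number with a given string of binary digits, least significant first. -/
def stringNat (s : List Bool) : ℕ := s.foldr Nat.bit 0

/-- The classical tape with the word `w` in the cells `1, …, |w|` and blanks elsewhere. -/
def tapeOfWord (w : List Sym) : ℤ → Sym := fun j =>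
  if 1 ≤ j then w.getD (j - 1).toNat none else none

/-- The word `w` stands in consecutive cells from cell `p` on, and is followed by a blank. -/
def ReadsAt (tape : ℤ → Sym) (p : ℤ) (w : List Bool) : Prop :=
  (∀ (i : ℕ) (hi : i < w.length), tape (p + i) = some w[i]) ∧ tape (p + w.length) = none

namespace DcqTM

/-- The starting configuration on input `(x; ρ)`: both heads are on the anchor cells (cell `0`),
the classical tape holds `x □ n` and the quantum tape holds `ρ`, both from cell `1` on. -/
def init (M : DcqTM) (x : List Bool) {n : ℕ} (ρ : QState n) : Config M where
  state := M.start
  ctape := tapeOfWord (x.map some ++ none :: (natString n).map some)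
  chead := 0
  qtape := initQTape ρ
  qhead := 0

open Classical in
/-- One step of the computation; a machine in the halting state stays as it is. -/
def step (M : DcqTM) (c : Config M) : Config M :=
  if c.state = M.halt then c
  else
    match M.δ c.state (c.ctape c.chead) with
    | (g, dq, a, dc, q) =>
      { state := q
        ctape := Function.update c.ctape c.chead a
        chead := c.chead + dc.toInt
        qtape := applyGate g c.qhead c.qtape
        qhead := c.qhead + dq.toInt }

/-- `M(x; ρ) = (y; σ)`: on input `(x; ρ)` the machine `M` halts; then `y` is the string between the
anchor and the first blank after it, the string between the first and the second blank after the
anchor specifies the number `m` of output qubits, and `σ` is the state of the cells `1, …, m` of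
the quantum tape. -/
def Outputs (M : DcqTM) (x : List Bool) {n : ℕ} (ρ : QState n) (y : List Bool) {m : ℕ}
    (σ : QState m) : Prop :=
  ∃ t : ℕ, ∃ c : Config M, M.step^[t] (M.init x ρ) = c ∧ c.state = M.halt ∧
    ReadsAt c.ctape 1 y ∧
    (∃ s : List Bool, ReadsAt c.ctape ((y.length : ℤ) + 2) s ∧ stringNat s = m) ∧
    reduced m c.qtape = σ.mat

end DcqTM

/-! ### Computable states -/

/-- The directly dcq-computable states: those output by some machine without auxiliary input. -/
def DCOMPq : Set (Σ n, QState n) :=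
  {ρ | ∃ M : DcqTM, M.Outputs [] emptyState [] ρ.2}

/-- The dcq-computable states. -/
def COMPq : Set (Σ n, QState n) :=
  {ρ | ∃ (M : DcqTM) (σ : ℕ → QState ρ.1), ∀ k : ℕ, 1 ≤ k →
    (⟨ρ.1, σ k⟩ : Σ n, QState n) ∈ DCOMPq ∧
    M.Outputs (natString k) emptyState [] (σ k) ∧
    traceDist ρ.2 (σ k) ≤ 1 / (k : ℝ)}

/-- The rational number with a given sign (`true` for negative), numerator and denominator. -/
def ratOfTriple (p : Bool × ℕ × ℕ) : ℚ :=
  (if p.1 then -1 else 1) * (p.2.1 : ℚ) / (p.2.2 : ℚ)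

/-- `r` is a computable real number: some computable function takes each positive integer `k` to
(the sign, numerator and denominator of) a rational number at distance at most `1 / k` from `r`. -/
def IsComputableReal (r : ℝ) : Prop :=
  ∃ f : ℕ → Bool × ℕ × ℕ, Computable f ∧ ∀ k : ℕ, 1 ≤ k →
    (f k).2.2 ≠ 0 ∧ |r - (ratOfTriple (f k) : ℝ)| ≤ 1 / (k : ℝ)

/-- The states whose density matrix in the computational basis has computable entries. -/
def COMPc : Set (Σ n, QState n) :=
  {ρ | ∀ a b, IsComputableReal (ρ.2.mat a b).re ∧ IsComputableReal (ρ.2.mat a b).im}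

end

end DCQ

/-! Both inclusions pass through words: finite sequences of letters, each a gate together with a
displacement of the quantum head. The control is classical, so the quantum tape of a machine started
on `emptyState` is always in the pure state that some word prepares from the vacuum (`runWord`), and
the output is its restriction to the first cells (`wordState`).

`COMPq ⊆ COMPc`: the classical part of a machine is simulated while the word is recorded, and the
halting time is found by search (`exists_computable_word`). The amplitudes after a word are sums of
eighth roots of unity over a power of √2, so the entries of its state have rational approximations
that are primitive recursive in the word and the precision (`abs_entry_sub_entryApprox`,
`primrec_entryApprox`). Trace distance controls entries (`norm_sub_apply_le_traceDist`), so the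
entries of the limit are computable.

`COMPc ⊆ COMPq`: given rational approximations of the entries of ρ, one searches for a word whose
state has nearby entries. The search ends because the states of words are dense
(`exists_word_near`); closeness of entries bounds the trace distance (`traceDist_le`); and machines
carry out every computable sequence of words (`exists_machine_of_computable`) as well as every
single word (`wordState_mem_DCOMPq`).

Density is obtained from a maximum argument instead of a generation theorem for the unitary group.
The closure of the states prepared by circuits on m cells is compact and invariant under circuits.
For a vector Ψ without zero amplitudes, let φ in this closure have maximal overlap |⟨Ψ,φ⟩|. The
circuit THTH is, up to a phase, a rotation through an angle incommensurable with π, and its powers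
give a first-order condition at φ in the direction of its generator. The directions with this
property form a real vector space stable under conjugation by circuits; it therefore contains Pauli
Z on the first cell and, by means of swap and cnot, a projector that acts on the window as the one
onto |0…0⟩. The resulting condition (`IsMaxOverlap.im_eq_zero`) says that conj⟨Ψ,φ⟩ · ⟨ψ,φ⟩ · ⟨Ψ,ψ⟩
is real for each ψ prepared by a circuit. Taking |x⟩, |x⟩+|y⟩ and |x⟩+i|y⟩ for neighbouring x, y
shows that φ is proportional to Ψ (`exists_closure_prepared_proportional`). Mixed states follow by
purification, vanishing amplitudes by perturbation.

The machines come from Mathlib's stack machine for partial recursive functions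
(`Turing.PartrecToTM2`), which computes a number encoding the word. Its four stacks are interleaved
as bits on the nonpositive half of the classical tape, with the input on the positive half; the word
is then applied letter by letter. -/

namespace DCQ

/-! ### States prepared by words of gates; trace distance versus matrix entries -/

noncomputable section

/-! ### Pure states of the quantum tape -/

/-- The tape in the pure state with amplitudes `ψ`. -/
def pureTape (ψ : Label → ℂ) : QTape := fun e e' => ψ e * star (ψ e')

/-- The action of a gate on the cells `h`, `h + 1` on amplitudes. -/
def gateOp (g : Gate) (h : ℤ) : (Label → ℂ) →ₗ[ℂ] (Label → ℂ) where
  toFun ψ e := ∑ p : Fin 2 × Fin 2, g.matrix (pairAt h e) p * ψ (setPair h e p)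
  map_add' ψ φ := by
    funext e; simp [mul_add, Finset.sum_add_distrib]
  map_smul' c ψ := by
    funext e; simp only [Pi.smul_apply, smul_eq_mul, RingHom.id_apply, Finset.mul_sum]
    exact Finset.sum_congr rfl fun p _ => by ring

theorem gateOp_apply (g : Gate) (h : ℤ) (ψ : Label → ℂ) (e : Label) :
    gateOp g h ψ e = ∑ p : Fin 2 × Fin 2, g.matrix (pairAt h e) p * ψ (setPair h e p) := rfl

/-- Gates keep a pure tape pure, so amplitudes can replace density matrices for the whole
computation. -/
theorem applyGate_pureTape (g : Gate) (h : ℤ) (ψ : Label → ℂ) :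
    applyGate g h (pureTape ψ) = pureTape (gateOp g h ψ) := by
  funext e e'
  simp only [applyGate, pureTape, gateOp_apply, star_sum, Finset.sum_mul_sum, star_mul']
  refine Finset.sum_congr rfl fun p _ => Finset.sum_congr rfl fun p' _ => ?_
  ring

open Classical in
/-- The amplitudes of a computational basis ket. -/
def ket (x : Label) : Label → ℂ := fun e => if e = x then 1 else 0

/-- The amplitudes of the tape with all cells in the state `|0⟩`. -/
def vacuum : Label → ℂ := ket 0

theorem initQTape_emptyState : initQTape emptyState = pureTape vacuum := by
  funext e e'
  have hiff : (∀ j : ℤ, ¬ (1 ≤ j ∧ j ≤ ((0 : ℕ) : ℤ)) → e j = 0 ∧ e' j = 0) ↔ (e = 0 ∧ e' = 0) := by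
    constructor
    · intro H
      exact ⟨funext fun j => (H j (by simp; omega)).1, funext fun j => (H j (by simp; omega)).2⟩
    · rintro ⟨rfl, rfl⟩ j _
      exact ⟨rfl, rfl⟩
  have hw : window 0 e = window 0 e' := Subsingleton.elim _ _
  classical
  simp only [initQTape, pureTape, vacuum, ket, hw, emptyState, Matrix.one_apply_eq]
  rw [if_congr hiff rfl rfl]
  by_cases h1 : e = 0 <;> by_cases h2 : e' = 0 <;> simp [h1, h2]

/-! ### Labels as pairs of a block and its environment -/

@[simp] theorem pairAt_setPair (h : ℤ) (e : Label) (p : Fin 2 × Fin 2) :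
    pairAt h (setPair h e p) = p := by
  simp [pairAt, setPair, Function.update]

@[simp] theorem setPair_setPair (h : ℤ) (e : Label) (p q : Fin 2 × Fin 2) :
    setPair h (setPair h e p) q = setPair h e q := by
  funext j
  simp only [setPair, Function.update_apply]
  split_ifs <;> rfl

@[simp] theorem setPair_pairAt (h : ℤ) (e : Label) : setPair h e (pairAt h e) = e := by
  funext j
  simp only [setPair, pairAt, Function.update_apply]
  split_ifs <;> simp_all

theorem setPair_apply_of_ne {h j : ℤ} (e : Label) (p : Fin 2 × Fin 2) (h1 : j ≠ h)
    (h2 : j ≠ h + 1) : setPair h e p j = e j := by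
  simp [setPair, h1, h2]

/-- A label is a pair of bits in the cells `h`, `h + 1` together with the other bits. -/
def pairEquiv (h : ℤ) : Label ≃ {r : Label // pairAt h r = 0} × (Fin 2 × Fin 2) where
  toFun e := (⟨setPair h e 0, by simp⟩, pairAt h e)
  invFun x := setPair h x.1.1 x.2
  left_inv e := by simp
  right_inv x := by
    obtain ⟨⟨r, hr⟩, p⟩ := x
    simp only [setPair_setPair, pairAt_setPair, Prod.mk.injEq, and_true, Subtype.mk.injEq]
    conv_rhs => rw [← setPair_pairAt h r, hr]

@[simp] theorem window_overwrite (n : ℕ) (b : Fin n → Fin 2) (e : Label) :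
    window n (overwrite n b e) = b := by
  funext i
  have : (1 : ℤ) ≤ (i : ℤ) + 1 ∧ (i : ℤ) + 1 ≤ n := by omega
  simp [window, overwrite, this]

@[simp] theorem overwrite_overwrite (n : ℕ) (b c : Fin n → Fin 2) (e : Label) :
    overwrite n b (overwrite n c e) = overwrite n b e := by
  funext j
  simp only [overwrite]
  split_ifs <;> rfl

@[simp] theorem overwrite_window (n : ℕ) (e : Label) : overwrite n (window n e) e = e := by
  funext j
  simp only [overwrite, window]
  split_ifs with hj
  · congr 1; simp; omega
  · rfl

/-- A label is a string of bits in the cells `1, …, n` together with the other bits. -/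
def windowEquiv (n : ℕ) : Label ≃ {r : Label // window n r = 0} × (Fin n → Fin 2) where
  toFun e := (⟨overwrite n 0 e, by simp⟩, window n e)
  invFun x := overwrite n x.2 x.1.1
  left_inv e := by simp
  right_inv x := by
    obtain ⟨⟨r, hr⟩, p⟩ := x
    simp only [overwrite_overwrite, window_overwrite, Prod.mk.injEq, and_true, Subtype.mk.injEq]
    conv_rhs => rw [← overwrite_window n r, hr]

/-- The definition sums over labels that depend on `a`. Clearing the window yields one index set,
the environments, for all entries, which exhibits the matrix as a sum of rank-one matrices. -/
theorem reduced_pureTape (n : ℕ) (ψ : Label → ℂ) (a b : Fin n → Fin 2) :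
    reduced n (pureTape ψ) a b =
      ∑ᶠ r : {r : Label // window n r = 0}, ψ (overwrite n a r) * star (ψ (overwrite n b r)) := by
  let E : {r : Label // window n r = 0} ≃ {e : Label // window n e = a} :=
    { toFun r := ⟨overwrite n a r.1, by simp⟩
      invFun e := ⟨overwrite n 0 e.1, by simp⟩
      left_inv r := by
        ext1; simp only [overwrite_overwrite]
        conv_rhs => rw [← overwrite_window n r.1, r.2]
      right_inv e := by
        ext1; simp only [overwrite_overwrite]
        conv_rhs => rw [← overwrite_window n e.1, e.2] }
  simp only [reduced, Matrix.of_apply]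
  rw [← finsum_comp_equiv E]
  simp [E, pureTape]

/-! ### Normalized states -/

theorem Gate.matrix_conjTranspose_mul (g : Gate) : g.matrix.conjTranspose * g.matrix = 1 := by
  have key : ∀ A : Matrix (Fin 2) (Fin 2) ℂ, A.conjTranspose * A = 1 →
      (Matrix.kronecker A (1 : Matrix (Fin 2) (Fin 2) ℂ)).conjTranspose *
        Matrix.kronecker A (1 : Matrix (Fin 2) (Fin 2) ℂ) = 1 := by
    intro A hA
    simp only [Matrix.kronecker]
    rw [Matrix.conjTranspose_kronecker, ← Matrix.mul_kronecker_mul, hA]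
    simp
  have h2 : ((Real.sqrt 2 : ℝ) : ℂ) * ((Real.sqrt 2 : ℝ) : ℂ) = 2 := by
    rw [← Complex.ofReal_mul, Real.mul_self_sqrt (by norm_num)]; norm_num
  have h20 : ((Real.sqrt 2 : ℝ) : ℂ) ≠ 0 := by
    intro h0; rw [h0] at h2; norm_num at h2
  cases g with
  | idle => simp [Gate.matrix]
  | hadamard =>
    apply key
    ext i j
    fin_cases i <;> fin_cases j <;>
      simp [Matrix.mul_apply, Fin.sum_univ_two, Matrix.conjTranspose_apply] <;>
      field_simp <;> norm_num [pow_two, h2]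
  | phase =>
    apply key
    ext i j
    fin_cases i <;> fin_cases j <;>
      simp [Matrix.mul_apply, Fin.sum_univ_two, Matrix.conjTranspose_apply]
  | piEighth =>
    apply key
    ext i j
    fin_cases i <;> fin_cases j <;>
      simp [Matrix.mul_apply, Fin.sum_univ_two, Matrix.conjTranspose_apply, ← Complex.exp_conj,
        ← Complex.exp_add, Complex.conj_ofNat]
  | swap =>
    ext i j
    obtain ⟨i1, i2⟩ := i
    obtain ⟨j1, j2⟩ := j
    fin_cases i1 <;> fin_cases i2 <;> fin_cases j1 <;> fin_cases j2 <;>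
      simp [Gate.matrix, Matrix.mul_apply, Matrix.conjTranspose_apply]
  | cnot =>
    ext i j
    obtain ⟨i1, i2⟩ := i
    obtain ⟨j1, j2⟩ := j
    fin_cases i1 <;> fin_cases i2 <;> fin_cases j1 <;> fin_cases j2 <;>
      simp [Gate.matrix, Matrix.mul_apply, Matrix.conjTranspose_apply]

/-- Amplitudes of a normalized pure state with finitely many nonzero amplitudes. -/
def IsNormalized (ψ : Label → ℂ) : Prop :=
  (Function.support ψ).Finite ∧ ∑ᶠ e, ψ e * star (ψ e) = 1

theorem isNormalized_vacuum : IsNormalized vacuum := by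
  constructor
  · refine (Set.finite_singleton (0 : Label)).subset fun e he => ?_
    by_contra h
    exact he (by simp [vacuum, ket, show e ≠ 0 from h])
  · rw [finsum_eq_single _ (0 : Label)]
    · simp [vacuum, ket]
    · intro e he; simp [vacuum, ket, he]

theorem support_mul_star (ψ : Label → ℂ) :
    (Function.support fun e => ψ e * star (ψ e)) = Function.support ψ := by
  ext e; simp

theorem gateOp_setPair (g : Gate) (h : ℤ) (ψ : Label → ℂ) (e : Label) (p : Fin 2 × Fin 2) :
    gateOp g h ψ (setPair h e p) = g.matrix.mulVec (fun q => ψ (setPair h e q)) p := by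
  simp [gateOp_apply, Matrix.mulVec, dotProduct]

theorem support_gateOp (g : Gate) (h : ℤ) {ψ : Label → ℂ} (hψ : (Function.support ψ).Finite) :
    (Function.support (gateOp g h ψ)).Finite := by
  have hfin : (⋃ p : Fin 2 × Fin 2, (fun e => setPair h e p) '' Function.support ψ).Finite :=
    Set.finite_iUnion fun p => hψ.image _
  refine hfin.subset fun e he => ?_
  by_contra hne
  apply he
  rw [gateOp_apply]
  refine Finset.sum_eq_zero fun p _ => ?_
  by_cases h0 : ψ (setPair h e p) = 0
  · simp [h0]
  · exact absurd (Set.mem_iUnion.2 ⟨pairAt h e,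
      (⟨setPair h e p, h0, by simp⟩ : e ∈ (fun x => setPair h x (pairAt h e)) '' _)⟩) hne

theorem finsum_label_eq {F : Label → ℂ} (hF : (Function.support F).Finite) (h : ℤ) :
    ∑ᶠ e, F e = ∑ᶠ r : {r : Label // pairAt h r = 0}, ∑ p : Fin 2 × Fin 2, F (setPair h r.1 p) := by
  rw [← finsum_comp_equiv (pairEquiv h).symm, finsum_curry]
  · refine finsum_congr fun r => ?_
    rw [finsum_eq_sum_of_fintype]; rfl
  · exact hF.preimage ((pairEquiv h).symm.injective.injOn)

/-- The labels split into classes of four that differ only in the cells `h` and `h + 1`; on each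
class the gate acts by its unitary matrix. -/
theorem IsNormalized.gateOp {ψ : Label → ℂ} (hψ : IsNormalized ψ) (g : Gate) (h : ℤ) :
    IsNormalized (gateOp g h ψ) := by
  refine ⟨support_gateOp g h hψ.1, ?_⟩
  rw [← hψ.2, finsum_label_eq (h := h) (by rw [support_mul_star]; exact support_gateOp g h hψ.1),
    finsum_label_eq (F := fun e => ψ e * star (ψ e)) (h := h)
      (by rw [support_mul_star]; exact hψ.1)]
  refine finsum_congr fun r => ?_
  simp only [gateOp_setPair]
  set v : Fin 2 × Fin 2 → ℂ := fun q => ψ (setPair h r.1 q)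
  have : (g.matrix.mulVec v) ⬝ᵥ star (g.matrix.mulVec v) = v ⬝ᵥ star v := by
    rw [Matrix.star_mulVec, dotProduct_comm, ← Matrix.dotProduct_mulVec, Matrix.mulVec_mulVec,
      g.matrix_conjTranspose_mul, Matrix.one_mulVec, dotProduct_comm]
  simpa [dotProduct] using this

theorem finite_support_env {n : ℕ} {ψ : Label → ℂ} (hψ : (Function.support ψ).Finite)
    (a b : Fin n → Fin 2) : (Function.support fun r : {r : Label // window n r = 0} =>
      ψ (overwrite n a r) * star (ψ (overwrite n b r))).Finite := by
  have hinj : Function.Injective fun r : {r : Label // window n r = 0} => overwrite n a r.1 := by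
    intro r r' h
    have := (windowEquiv n).symm.injective (a₁ := (r, a)) (a₂ := (r', a)) h
    exact (Prod.mk.inj this).1
  refine (hψ.preimage hinj.injOn).subset fun r hr => ?_
  simp only [Function.mem_support, ne_eq, mul_eq_zero, not_or] at hr
  exact hr.1

/-- Each environment contributes a matrix of the form v v†, and finite support leaves finitely many
of them. -/
theorem posSemidef_reduced_pureTape (n : ℕ) {ψ : Label → ℂ} (hψ : (Function.support ψ).Finite) :
    (reduced n (pureTape ψ)).PosSemidef := by
  classical
  have hfin := Set.finite_iUnion fun a : Fin n → Fin 2 => finite_support_env hψ a a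
  set S := hfin.toFinset
  have hred : reduced n (pureTape ψ) = ∑ r ∈ S, Matrix.vecMulVec
      (fun a : Fin n → Fin 2 => ψ (overwrite n a r.1))
      (star fun a : Fin n → Fin 2 => ψ (overwrite n a r.1)) := by
    ext a b
    rw [reduced_pureTape, finsum_eq_sum_of_support_subset (s := S), Matrix.sum_apply]
    · rfl
    · intro r hr
      simp only [Function.mem_support, ne_eq, mul_eq_zero, not_or] at hr
      simp only [S, Set.Finite.coe_toFinset, Set.mem_iUnion]
      exact ⟨a, by simp [hr.1]⟩
  rw [hred]
  exact Matrix.posSemidef_sum _ fun r _ => Matrix.posSemidef_vecMulVec_self_star _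

theorem IsNormalized.trace_reduced {ψ : Label → ℂ} (hψ : IsNormalized ψ) (n : ℕ) :
    (reduced n (pureTape ψ)).trace = 1 := by
  rw [← hψ.2, ← finsum_comp_equiv (windowEquiv n).symm, finsum_curry]
  · simp only [Matrix.trace, Matrix.diag_apply, reduced_pureTape]
    rw [← finsum_sum_comm]
    · refine finsum_congr fun r => ?_
      rw [finsum_eq_sum_of_fintype]
      rfl
    · exact fun a _ => finite_support_env hψ.1 a a
  · have : (Function.support fun e => ψ e * star (ψ e)).Finite := by
      rw [support_mul_star]; exact hψ.1
    exact this.preimage ((windowEquiv n).symm.injective.injOn)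

/-- The state of the cells `1, …, n` of a tape in a normalized pure state. -/
def reducedState (n : ℕ) (ψ : Label → ℂ) (hψ : IsNormalized ψ) : QState n where
  mat := reduced n (pureTape ψ)
  posSemidef := posSemidef_reduced_pureTape n hψ.1
  trace_eq_one := hψ.trace_reduced n

/-! ### Words of gates -/

/-- A letter stands for a gate and a displacement of the quantum head. -/
def letterGate (i : ℕ) : Gate :=
  match i % 6 with
  | 0 => .idle
  | 1 => .hadamard
  | 2 => .phase
  | 3 => .piEighth
  | 4 => .swap
  | _ => .cnot

/-- The displacement of the quantum head in a letter. -/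
def letterDisp (i : ℕ) : Disp :=
  match i / 6 % 3 with
  | 0 => .stay
  | 1 => .right
  | _ => .left

/-- The letter of a gate and a displacement. -/
def letter (g : Gate) (d : Disp) : ℕ :=
  (match g with
    | .idle => 0
    | .hadamard => 1
    | .phase => 2
    | .piEighth => 3
    | .swap => 4
    | .cnot => 5) +
  6 * (match d with
    | .stay => 0
    | .right => 1
    | .left => 2)

@[simp] theorem letterGate_letter (g : Gate) (d : Disp) : letterGate (letter g d) = g := by
  cases g <;> cases d <;> rfl

@[simp] theorem letterDisp_letter (g : Gate) (d : Disp) : letterDisp (letter g d) = d := by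
  cases g <;> cases d <;> rfl

/-- There are 6 · 3 = 18 pairs of gate and displacement. Periodicity turns functions of letters into
finite tables, and later lets finitely many control states count up to a letter. -/
theorem letterGate_mod (i : ℕ) : letterGate (i % 18) = letterGate i := by
  have : i % 18 % 6 = i % 6 := by omega
  simp only [letterGate, this]

theorem letterDisp_mod (i : ℕ) : letterDisp (i % 18) = letterDisp i := by
  have : i % 18 / 6 % 3 = i / 6 % 3 := by omega
  simp only [letterDisp, this]

/-- The effect of one letter on amplitudes and head position. -/
def letterStep (s : (Label → ℂ) × ℤ) (i : ℕ) : (Label → ℂ) × ℤ :=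
  (gateOp (letterGate i) s.2 s.1, s.2 + (letterDisp i).toInt)

/-- The amplitudes and the head position after a word, from the empty tape. -/
def runWord (w : List ℕ) : (Label → ℂ) × ℤ := w.foldl letterStep (vacuum, 0)

theorem isNormalized_foldl (w : List ℕ) (s : (Label → ℂ) × ℤ) (hs : IsNormalized s.1) :
    IsNormalized (w.foldl letterStep s).1 := by
  induction w generalizing s with
  | nil => exact hs
  | cons i w ih => exact ih _ (hs.gateOp _ _)

theorem isNormalized_runWord (w : List ℕ) : IsNormalized (runWord w).1 :=
  isNormalized_foldl w _ isNormalized_vacuum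

/-- The state of `n` qubits prepared by a word. -/
def wordState (n : ℕ) (w : List ℕ) : QState n :=
  reducedState n (runWord w).1 (isNormalized_runWord w)

/-! ### Trace distance and matrix entries -/

/-- In the spectral decomposition of ρ − σ the entries of the unitary have modulus at most one, so
every entry is bounded by the sum of the moduli of the eigenvalues. -/
theorem norm_sub_apply_le_traceDist {n : ℕ} (ρ σ : QState n) (a b : Fin n → Fin 2) :
    ‖ρ.mat a b - σ.mat a b‖ ≤ 2 * traceDist ρ σ := by
  set hA := ρ.sub_isHermitian σ
  have hspec := hA.spectral_theorem
  set U : Matrix (Fin n → Fin 2) (Fin n → Fin 2) ℂ := hA.eigenvectorUnitary.1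
  have hU : ∀ i j, ‖U i j‖ ≤ 1 := fun i j =>
    entry_norm_bound_of_unitary hA.eigenvectorUnitary.2 i j
  have hab : ρ.mat a b - σ.mat a b = ∑ i, U a i * (hA.eigenvalues i : ℂ) * star (U b i) := by
    have := congrFun (congrFun hspec a) b
    rw [Matrix.sub_apply] at this
    rw [this]
    simp [Unitary.conjStarAlgAut_apply, Matrix.mul_apply, Matrix.diagonal_apply, U,
      Matrix.star_apply]
  rw [hab, traceDist]
  calc _ ≤ ∑ i, ‖U a i * (hA.eigenvalues i : ℂ) * star (U b i)‖ := norm_sum_le _ _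
    _ ≤ ∑ i, |hA.eigenvalues i| := by
        refine Finset.sum_le_sum fun i _ => ?_
        rw [norm_mul, norm_mul, norm_star, Complex.norm_real, Real.norm_eq_abs]
        have h1 := hU a i
        have h2 := hU b i
        have h3 := abs_nonneg (hA.eigenvalues i)
        calc _ ≤ 1 * |hA.eigenvalues i| * 1 := by gcongr
          _ = _ := by ring
    _ = _ := by ring

/-- Read the eigenvector equation at a coordinate where the eigenvector has largest modulus. -/
theorem abs_eigenvalues_le {ι : Type*} [Fintype ι] [DecidableEq ι] {A : Matrix ι ι ℂ}
    (hA : A.IsHermitian) {ε : ℝ} (h : ∀ a b, ‖A a b‖ ≤ ε) (i : ι) :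
    |hA.eigenvalues i| ≤ Fintype.card ι * ε := by
  have : Nonempty ι := ⟨i⟩
  set v : ι → ℂ := ⇑(hA.eigenvectorBasis i)
  have hv : A.mulVec v = hA.eigenvalues i • v := hA.mulVec_eigenvectorBasis i
  have hv0 : v ≠ 0 := by
    intro h0
    have h1 : ‖hA.eigenvectorBasis i‖ = 1 := hA.eigenvectorBasis.orthonormal.1 i
    have : hA.eigenvectorBasis i = 0 := by ext j; exact congrFun h0 j
    rw [this] at h1; simp at h1
  obtain ⟨k, -, hk⟩ := Finset.exists_max_image Finset.univ (fun j => ‖v j‖) ⟨i, Finset.mem_univ i⟩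
  have hk0 : 0 < ‖v k‖ := by
    obtain ⟨j, hj⟩ := Function.ne_iff.1 hv0
    exact lt_of_lt_of_le (norm_pos_iff.2 hj) (hk j (Finset.mem_univ j))
  have hrow := congrFun hv k
  simp only [Matrix.mulVec, dotProduct, Pi.smul_apply] at hrow
  have hnorm : |hA.eigenvalues i| * ‖v k‖ ≤ Fintype.card ι * ε * ‖v k‖ := by
    calc |hA.eigenvalues i| * ‖v k‖ = ‖∑ j, A k j * v j‖ := by
          rw [hrow, norm_smul, Real.norm_eq_abs]
      _ ≤ ∑ j, ‖A k j * v j‖ := norm_sum_le _ _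
      _ ≤ ∑ _j : ι, ε * ‖v k‖ := by
          refine Finset.sum_le_sum fun j _ => ?_
          rw [norm_mul]
          exact mul_le_mul (h k j) (hk j (Finset.mem_univ j)) (norm_nonneg _)
            ((norm_nonneg _).trans (h k j))
      _ = _ := by simp [mul_assoc]
  exact le_of_mul_le_mul_right hnorm hk0

/-- There are `2 ^ n` eigenvalues, each at most `2 ^ n * ε`; the factor one half is given away. A
crude constant suffices because `n` is fixed in the search for words. -/
theorem traceDist_le {n : ℕ} (ρ σ : QState n) {ε : ℝ} (h : ∀ a b, ‖ρ.mat a b - σ.mat a b‖ ≤ ε) :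
    traceDist ρ σ ≤ 4 ^ n * ε := by
  have hcard : (Fintype.card (Fin n → Fin 2) : ℝ) = 2 ^ n := by simp
  have h0 : 0 ≤ ε := (norm_nonneg _).trans (h 0 0)
  have hle : ∑ i, |(ρ.sub_isHermitian σ).eigenvalues i| ≤ ∑ _i : Fin n → Fin 2, 2 ^ n * ε := by
    refine Finset.sum_le_sum fun i _ => ?_
    have := abs_eigenvalues_le (ρ.sub_isHermitian σ) (ε := ε) h i
    rwa [hcard] at this
  rw [Finset.sum_const, nsmul_eq_mul, Finset.card_univ, hcard] at hle
  have h4 : (4 : ℝ) ^ n = 2 ^ n * 2 ^ n := by rw [← mul_pow]; norm_num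
  have : 0 ≤ (2 : ℝ) ^ n * (2 ^ n * ε) := by positivity
  rw [traceDist, h4]
  linarith

end

/-! ### Effective approximation of the entries of prepared states -/

noncomputable section

/-! ### Path sums: amplitudes as lists of phases -/

/-- The primitive eighth root of unity `exp (iπ/4)`. -/
def eighthRoot : ℂ := Complex.exp (Complex.I * (Real.pi / 4))

theorem eighthRoot_sq : eighthRoot ^ 2 = Complex.I := by
  rw [eighthRoot, ← Complex.exp_nat_mul]
  have : ((2 : ℕ) : ℂ) * (Complex.I * (Real.pi / 4)) = Real.pi / 2 * Complex.I := by
    push_cast; ring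
  rw [this, Complex.exp_pi_div_two_mul_I]

theorem eighthRoot_pow_four : eighthRoot ^ 4 = -1 := by
  rw [show 4 = 2 * 2 from rfl, pow_mul, eighthRoot_sq, Complex.I_sq]

theorem eighthRoot_pow_eight : eighthRoot ^ 8 = 1 := by
  rw [show 8 = 4 * 2 from rfl, pow_mul, eighthRoot_pow_four]; norm_num

theorem star_eighthRoot : star eighthRoot = eighthRoot ^ 7 := by
  have h1 : star eighthRoot * eighthRoot = 1 := by
    simp [eighthRoot, ← Complex.exp_conj, ← Complex.exp_add, Complex.conj_ofNat]
  have h2 : eighthRoot ^ 7 * eighthRoot = 1 := by rw [← pow_succ, eighthRoot_pow_eight]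
  have h0 : eighthRoot ≠ 0 := Complex.exp_ne_zero _
  exact mul_right_cancel₀ h0 (h1.trans h2.symm)

theorem eighthRoot_eq : eighthRoot = (Real.sqrt 2 / 2 : ℝ) + (Real.sqrt 2 / 2 : ℝ) * Complex.I := by
  rw [eighthRoot, mul_comm, Complex.exp_mul_I]
  have : (Real.pi / 4 : ℂ) = ((Real.pi / 4 : ℝ) : ℂ) := by push_cast; rfl
  rw [this, ← Complex.ofReal_cos, ← Complex.ofReal_sin, Real.cos_pi_div_four, Real.sin_pi_div_four]

/-- The inverse square root of two. -/
def invSqrtTwo : ℂ := 1 / (Real.sqrt 2 : ℂ)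

/-- The image of a basis ket of two qubits under a gate, up to normalization, as a list of basis
kets with powers of `eighthRoot` as coefficients. -/
def Gate.branch : Gate → Fin 2 × Fin 2 → List ((Fin 2 × Fin 2) × ℕ)
  | .idle, p => [(p, 0)]
  | .hadamard, p => [((0, p.2), 0), ((1, p.2), 4 * p.1)]
  | .phase, p => [(p, 2 * p.1)]
  | .piEighth, p => [(p, p.1)]
  | .swap, p => [((p.2, p.1), 0)]
  | .cnot, p => [((p.1, p.1 + p.2), 0)]

/-- The number of factors `invSqrtTwo` in the matrix entries of a gate. -/
def Gate.rootCount : Gate → ℕ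
  | .hadamard => 1
  | _ => 0

/-- Each entry is 0 or an eighth root of unity, up to one common power of 1/√2. Amplitudes can
therefore be stored exactly, as labels with integer exponents. -/
theorem Gate.matrix_apply (g : Gate) (p' p : Fin 2 × Fin 2) :
    g.matrix p' p = invSqrtTwo ^ g.rootCount *
      ((g.branch p).map fun r => if p' = r.1 then eighthRoot ^ r.2 else 0).sum := by
  obtain ⟨a, b⟩ := p
  obtain ⟨a', b'⟩ := p'
  have h4 := eighthRoot_pow_four
  have h2 := eighthRoot_sq
  cases g <;> fin_cases a <;> fin_cases b <;> fin_cases a' <;> fin_cases b' <;>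
    simp [Gate.matrix, Gate.branch, Gate.rootCount, invSqrtTwo, h4, h2] <;> rfl

theorem gateOp_ket (g : Gate) (h : ℤ) (x : Label) :
    gateOp g h (ket x) = ∑ p, g.matrix p (pairAt h x) • ket (setPair h x p) := by
  funext e
  simp only [gateOp_apply, Finset.sum_apply, Pi.smul_apply, smul_eq_mul, ket, mul_ite, mul_one,
    mul_zero]
  by_cases hx : setPair h e (pairAt h x) = x
  · rw [Finset.sum_eq_single (pairAt h x), Finset.sum_eq_single (pairAt h e)]
    · have : e = setPair h x (pairAt h e) := by rw [← hx]; simp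
      rw [if_pos hx, if_pos this]
    · intro p _ hp
      rw [if_neg]
      rintro rfl
      simp at hp
    · simp
    · intro p _ hp
      rw [if_neg]
      rintro rfl
      simp at hp
    · simp
  · rw [Finset.sum_eq_zero, Finset.sum_eq_zero]
    · intro p _
      rw [if_neg]
      rintro rfl
      simp at hx
    · intro p _
      rw [if_neg]
      rintro rfl
      simp at hx

theorem gateOp_ket_eq_branch (g : Gate) (h : ℤ) (x : Label) :
    gateOp g h (ket x) = invSqrtTwo ^ g.rootCount •
      ((g.branch (pairAt h x)).map fun r => eighthRoot ^ r.2 • ket (setPair h x r.1)).sum := by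
  rw [gateOp_ket]
  simp only [Gate.matrix_apply, mul_smul, ← Finset.smul_sum]
  congr 1
  generalize g.branch (pairAt h x) = R
  induction R with
  | nil => simp
  | cons r R ih =>
    simp only [List.map_cons, List.sum_cons, add_smul, Finset.sum_add_distrib, ih, ite_smul,
      zero_smul]
    simp

/-- The label whose bit in the cell `j` is the binary digit `j + N` of `l`. -/
def maskLabel (N l : ℕ) : Label := fun j =>
  if 0 ≤ j + N ∧ l.testBit (j + N).toNat then 1 else 0

/-- Replace the `len` binary digits of `l` from position `pos` on by those of `v`. -/
def splice (l pos len v : ℕ) : ℕ := 2 ^ pos * (2 ^ len * (l / 2 ^ (pos + len)) + v) + l % 2 ^ pos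

theorem testBit_splice {l pos len v : ℕ} (hv : v < 2 ^ len) (i : ℕ) :
    (splice l pos len v).testBit i =
      if i < pos then l.testBit i else if i < pos + len then v.testBit (i - pos)
        else l.testBit i := by
  rw [splice, Nat.testBit_two_pow_mul_add _ (Nat.mod_lt _ (by positivity)),
    Nat.testBit_two_pow_mul_add _ hv, Nat.testBit_mod_two_pow]
  by_cases h1 : i < pos
  · simp [h1]
  · by_cases h2 : i < pos + len
    · have : i - pos < len := by omega
      simp [h1, h2, this]
    · have : ¬ i - pos < len := by omega
      simp only [h1, h2, this, if_false, Nat.testBit_div_two_pow]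
      congr 1
      omega

theorem maskLabel_injective (N : ℕ) : Function.Injective (maskLabel N) := by
  intro l l' h
  refine Nat.eq_of_testBit_eq fun i => ?_
  have := congrFun h ((i : ℤ) - N)
  simp only [maskLabel, sub_add_cancel, Nat.cast_nonneg, Int.toNat_natCast, true_and] at this
  cases h1 : l.testBit i <;> cases h2 : l'.testBit i <;> simp [h1, h2] at this ⊢

/-- The binary digit of a bit. -/
def pairCode (p : Fin 2 × Fin 2) : ℕ := p.1 + 2 * p.2

/-- The pair of bits of a number. -/
def codePair (v : ℕ) : Fin 2 × Fin 2 := (if v.testBit 0 then 1 else 0, if v.testBit 1 then 1 else 0)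

theorem pairAt_maskLabel (N l pos : ℕ) :
    pairAt ((pos : ℤ) - N) (maskLabel N l) = codePair (l / 2 ^ pos % 4) := by
  have h1 : ((pos : ℤ) - N + 1 + N).toNat = pos + 1 := by omega
  have h2 : 0 ≤ (pos : ℤ) - N + 1 + N := by omega
  have h4 : 4 = 2 ^ 2 := rfl
  simp only [pairAt, maskLabel, codePair, sub_add_cancel, Nat.cast_nonneg, Int.toNat_natCast,
    true_and, h1, h2]
  rw [h4, Nat.testBit_mod_two_pow, Nat.testBit_mod_two_pow, Nat.testBit_div_two_pow,
    Nat.testBit_div_two_pow]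
  simp [add_comm]

theorem setPair_maskLabel (N l pos : ℕ) (p : Fin 2 × Fin 2) :
    setPair ((pos : ℤ) - N) (maskLabel N l) p = maskLabel N (splice l pos 2 (pairCode p)) := by
  have hp : pairCode p < 2 ^ 2 := by unfold pairCode; omega
  have hb0 : (pairCode p).testBit 0 = decide (p.1 = 1) := by
    obtain ⟨a, b⟩ := p; fin_cases a <;> fin_cases b <;> rfl
  have hb1 : (pairCode p).testBit 1 = decide (p.2 = 1) := by
    obtain ⟨a, b⟩ := p; fin_cases a <;> fin_cases b <;> rfl
  funext j
  by_cases h1 : j = pos - N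
  · subst h1
    have : ((pos : ℤ) - N) ≠ (pos : ℤ) - N + 1 := by omega
    simp only [setPair, Function.update_apply, maskLabel, testBit_splice hp, if_neg this]
    have : p.1 = 0 ∨ p.1 = 1 := by omega
    rcases this with h | h <;> simp [hb0, h]
  by_cases h2 : j = pos - N + 1
  · subst h2
    have h1 : ((pos : ℤ) - N + 1 + N).toNat = pos + 1 := by omega
    have h2 : 0 ≤ (pos : ℤ) - N + 1 + N := by omega
    simp only [setPair, Function.update_apply, maskLabel, testBit_splice hp, h1, h2]
    have : p.2 = 0 ∨ p.2 = 1 := by omega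
    rcases this with h | h <;> simp [hb1, h]
  · rw [setPair_apply_of_ne _ _ h1 h2]
    simp only [maskLabel, testBit_splice hp]
    by_cases h3 : 0 ≤ j + N
    · by_cases h4 : (j + N).toNat < pos
      · simp [h4]
      · have : ¬ (j + N).toNat < pos + 2 := by omega
        simp [h4, this]
    · simp [h3]

/-- The number with the given binary digits. -/
def stringMask {n : ℕ} (a : Fin n → Fin 2) : ℕ := Nat.ofBits fun i => decide (a i = 1)

theorem stringMask_lt {n : ℕ} (a : Fin n → Fin 2) : stringMask a < 2 ^ n := Nat.ofBits_lt_two_pow _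

/-- Together with `overwrite_maskLabel` and `maskLabel_injective`, this turns the conditions on
labels in a partial trace into equations between natural numbers. -/
theorem window_maskLabel_eq_iff {n N l : ℕ} (a : Fin n → Fin 2) :
    window n (maskLabel N l) = a ↔ l / 2 ^ (N + 1) % 2 ^ n = stringMask a := by
  have hw : ∀ i : Fin n, window n (maskLabel N l) i =
      if (l / 2 ^ (N + 1) % 2 ^ n).testBit i then 1 else 0 := by
    intro i
    have h1 : ((i : ℤ) + 1 + N).toNat = N + 1 + i := by omega
    have h2 : 0 ≤ (i : ℤ) + 1 + N := by omega
    simp only [window, maskLabel, h1, h2, Nat.testBit_mod_two_pow, Nat.testBit_div_two_pow]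
    simp [add_comm]
  constructor
  · rintro rfl
    refine Nat.eq_of_testBit_eq fun i => ?_
    by_cases hi : i < n
    · rw [stringMask, Nat.testBit_ofBits_lt _ _ hi, hw]
      simp
    · rw [stringMask, Nat.testBit_ofBits_ge _ _ (by omega), Nat.testBit_mod_two_pow]
      simp [hi]
  · intro h
    funext i
    rw [hw, h, stringMask, Nat.testBit_ofBits_lt _ _ i.2]
    have : a i = 0 ∨ a i = 1 := by omega
    rcases this with h | h <;> simp [h]

theorem overwrite_maskLabel {n : ℕ} (N l : ℕ) (b : Fin n → Fin 2) :
    overwrite n b (maskLabel N l) = maskLabel N (splice l (N + 1) n (stringMask b)) := by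
  funext j
  by_cases hj : 1 ≤ j ∧ j ≤ n
  · have h0 : 0 ≤ j + N := by omega
    have h1 : ¬ (j + N).toNat < N + 1 := by omega
    have h2 : (j + N).toNat < N + 1 + n := by omega
    have h3 : (j + N).toNat - (N + 1) < n := by omega
    simp only [overwrite, hj, maskLabel, testBit_splice (stringMask_lt b), h0, h1, h2]
    simp only [and_self, dite_true, if_false, if_true, true_and, stringMask,
      Nat.testBit_ofBits_lt _ _ h3]
    have hidx : (⟨(j + N).toNat - (N + 1), h3⟩ : Fin n) = ⟨(j - 1).toNat, by omega⟩ := by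
      ext; simp; omega
    rw [hidx]
    generalize b ⟨(j - 1).toNat, by omega⟩ = c
    have : c = 0 ∨ c = 1 := by omega
    rcases this with h | h <;> simp [h]
  · simp only [overwrite, hj, maskLabel, testBit_splice (stringMask_lt b)]
    by_cases h0 : 0 ≤ j + N
    · by_cases h1 : (j + N).toNat < N + 1
      · simp [h1]
      · have : ¬ (j + N).toNat < N + 1 + n := by omega
        simp [h1, this]
    · simp [h0]

/-! ### Simulation of words on path sums -/

/-- The branches of a letter on the pair of bits with code `v`. -/
def branchTable (i v : ℕ) : List (ℕ × ℕ) :=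
  ((letterGate i).branch (codePair v)).map fun r => (pairCode r.1, r.2)

/-- One letter on a path sum: the head position, the number of factors `invSqrtTwo`, and the list
of labels with exponents of `eighthRoot`. -/
def pathStep (s : ℕ × ℕ × List (ℕ × ℕ)) (i : ℕ) : ℕ × ℕ × List (ℕ × ℕ) :=
  (((s.1 : ℤ) + (letterDisp i).toInt).toNat, s.2.1 + (letterGate i).rootCount,
    s.2.2.flatMap fun t => (branchTable i (t.1 / 2 ^ s.1 % 4)).map fun r =>
      (splice t.1 s.1 2 r.1, t.2 + r.2))

/-- The amplitudes of a path sum. -/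
def pathVec (N : ℕ) (s : ℕ × ℕ × List (ℕ × ℕ)) : Label → ℂ :=
  invSqrtTwo ^ s.2.1 • (s.2.2.map fun t => eighthRoot ^ t.2 • ket (maskLabel N t.1)).sum

theorem gateOp_pathVec (N i : ℕ) (s : ℕ × ℕ × List (ℕ × ℕ)) :
    gateOp (letterGate i) ((s.1 : ℤ) - N) (pathVec N s) = pathVec N (pathStep s i) := by
  obtain ⟨h, q, T⟩ := s
  simp only [pathVec, pathStep, map_smul, pow_add, mul_smul]
  congr 1
  induction T with
  | nil => simp
  | cons t T ih =>
    simp only [List.map_cons, List.sum_cons, map_add, ih, List.flatMap_cons, List.map_append,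
      List.sum_append, smul_add]
    congr 1
    rw [map_smul, gateOp_ket_eq_branch, smul_comm]
    congr 1
    simp only [pairAt_maskLabel, branchTable, setPair_maskLabel, List.map_map, List.smul_sum,
      Function.comp_def, pow_add, mul_smul]

/-- Only the cells from `-N` on are represented, and `pathStep` truncates the head position at 0. A
letter moves the head left by at most one cell, so the bound `hw` on the remaining word keeps the
truncation exact. -/
theorem foldl_letterStep_eq (N : ℕ) (w : List ℕ) (s : (Label → ℂ) × ℤ)
    (d : ℕ × ℕ × List (ℕ × ℕ)) (hv : s.1 = pathVec N d) (hh : s.2 = (d.1 : ℤ) - N)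
    (hw : w.length ≤ d.1) :
    (w.foldl letterStep s).1 = pathVec N (w.foldl pathStep d) := by
  induction w generalizing s d with
  | nil => exact hv
  | cons i w ih =>
    simp only [List.length_cons] at hw
    have hd : -1 ≤ (letterDisp i).toInt := by cases letterDisp i <;> simp [Disp.toInt]
    refine ih _ _ ?_ ?_ ?_
    · rw [letterStep, hv, hh, gateOp_pathVec]
    · simp only [letterStep, pathStep, hh]
      omega
    · simp only [pathStep]
      omega

/-- The path sum of a word. -/
def pathSum (w : List ℕ) : ℕ × ℕ × List (ℕ × ℕ) := w.foldl pathStep (w.length, 0, [(0, 0)])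

theorem runWord_eq_pathVec (w : List ℕ) : (runWord w).1 = pathVec w.length (pathSum w) := by
  refine foldl_letterStep_eq w.length w _ _ ?_ (by simp) le_rfl
  have : maskLabel w.length 0 = 0 := by funext j; simp [maskLabel]
  simp [pathVec, vacuum, this]

theorem env_eq {n : ℕ} {a : Fin n → Fin 2} (r : {r : Label // window n r = 0}) {x : Label}
    (h : overwrite n a r.1 = x) : r = ⟨overwrite n 0 x, by simp⟩ := by
  ext1
  rw [← h]
  simp only [overwrite_overwrite]
  conv_lhs => rw [← overwrite_window n r.1, r.2]

-- Only the environment of `x i` can contribute to the pair `(i, j)`. The sum over all environments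
-- collapses to a finite double sum whose conditions concern the two labels alone.
open Classical in
theorem reduced_sum_ket {ι : Type*} [Fintype ι] (n : ℕ) (c : ι → ℂ) (x : ι → Label)
    (a b : Fin n → Fin 2) :
    reduced n (pureTape (∑ i, c i • ket (x i))) a b = ∑ i, ∑ j,
      if window n (x i) = a ∧ x j = overwrite n b (x i) then c i * star (c j) else 0 := by
  rw [reduced_pureTape]
  have hterm : ∀ r : {r : Label // window n r = 0},
      (∑ i, c i • ket (x i)) (overwrite n a r) * star ((∑ i, c i • ket (x i)) (overwrite n b r)) =
      ∑ i, ∑ j, if overwrite n a r = x i ∧ overwrite n b r = x j then c i * star (c j) else 0 := by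
    intro r
    simp only [Finset.sum_apply, Pi.smul_apply, smul_eq_mul, star_sum, Finset.sum_mul_sum]
    refine Finset.sum_congr rfl fun i _ => Finset.sum_congr rfl fun j _ => ?_
    by_cases h1 : overwrite n a r = x i <;> by_cases h2 : overwrite n b r = x j <;>
      simp [ket, h1, h2]
  have hfin : ∀ i j, (Function.support fun r : {r : Label // window n r = 0} =>
      if overwrite n a r.1 = x i ∧ overwrite n b r.1 = x j then c i * star (c j)
        else 0).Finite := by
    intro i j
    refine (Set.finite_singleton (⟨overwrite n 0 (x i), by simp⟩ :
      {r : Label // window n r = 0})).subset fun r hr => ?_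
    have h1 : overwrite n a r.1 = x i := by
      by_contra h; exact hr (by simp [h])
    exact env_eq r h1
  simp only [hterm]
  rw [finsum_sum_comm]
  · refine Finset.sum_congr rfl fun i _ => ?_
    rw [finsum_sum_comm]
    · refine Finset.sum_congr rfl fun j _ => ?_
      rw [finsum_eq_single _ (⟨overwrite n 0 (x i), by simp⟩ : {r : Label // window n r = 0})]
      · have : overwrite n a (x i) = x i ↔ window n (x i) = a := by
          constructor
          · intro h; rw [← h]; simp
          · rintro rfl; simp
        simp only [overwrite_overwrite, this, eq_comm (a := x j)]
      · intro r hr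
        rw [if_neg]
        rintro ⟨h1, -⟩
        exact hr (env_eq r h1)
    · exact fun j _ => hfin i j
  · intro i _
    refine (Set.finite_iUnion fun j => hfin i j).subset fun r hr => ?_
    by_contra h
    simp only [Set.mem_iUnion, not_exists] at h
    apply hr
    exact Finset.sum_eq_zero fun j _ => by_contra fun h' => h j h'

/-! ### Rational approximations of matrix entries -/

/-- Approximation of the positive part of `cos (mπ/4)` at scale `u`, where `c` approximates
`u / √2`. -/
def cosTable (u c m : ℕ) : ℕ :=
  if m % 8 = 0 then u else if m % 8 = 1 ∨ m % 8 = 7 then c else 0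

/-- The contributions of the pairs of paths to the entry with row code `A` and column code `B`. -/
def pairSum (n A B sh u c N : ℕ) (T : List (ℕ × ℕ)) : ℕ :=
  (T.flatMap fun t => T.map fun t' =>
    if t.1 / 2 ^ (N + 1) % 2 ^ n = A ∧ t'.1 = splice t.1 (N + 1) n B then
      cosTable u c (t.2 + 7 * t'.2 + sh) else 0).sum

/-- A fraction `(p - q) / d`, as a real number. -/
def fracVal (x : ℕ × ℕ × ℕ) : ℝ := ((x.1 : ℝ) - x.2.1) / x.2.2

/-- A rational approximation to within `1 / K` of the real part of `eighthRoot ^ sh` times the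
entry at row code `A` and column code `B` of the state prepared by a word. -/
def entryApprox (n A B sh : ℕ) (x : List ℕ × ℕ) : ℕ × ℕ × ℕ :=
  let s := pathSum x.1
  let d := (x.2 + 1) * (s.2.2.length ^ 2 + 1)
  let c := Nat.sqrt (2 * d ^ 2)
  (pairSum n A B sh (2 * d) c x.1.length s.2.2, pairSum n A B (sh + 4) (2 * d) c x.1.length s.2.2,
    2 * d * 2 ^ s.2.1)

theorem eighthRoot_pow_mod (m : ℕ) : eighthRoot ^ m = eighthRoot ^ (m % 8) := by
  conv_lhs => rw [← Nat.div_add_mod m 8, pow_add, pow_mul, eighthRoot_pow_eight, one_pow, one_mul]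

/-- The negative part of the cosine at `m` is its positive part at `m + 4`. For even `m` the table
is exact; for odd `m` the value is ±2d · √2/2 = ±√2 d, which `c` approximates. -/
theorem abs_cosTable_sub (d c m : ℕ) (hc : |(c : ℝ) - Real.sqrt 2 * d| ≤ 1) :
    |(cosTable (2 * d) c m : ℝ) - cosTable (2 * d) c (m + 4) -
      2 * d * (eighthRoot ^ m).re| ≤ 1 := by
  have hlt : m % 8 < 8 := Nat.mod_lt _ (by norm_num)
  have hm4 : (m + 4) % 8 = (m % 8 + 4) % 8 := by omega
  rw [eighthRoot_pow_mod]
  unfold cosTable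
  rw [hm4]
  generalize m % 8 = r at hlt
  have hre : eighthRoot.re = Real.sqrt 2 / 2 := by rw [eighthRoot_eq]; simp
  have him : eighthRoot.im = Real.sqrt 2 / 2 := by rw [eighthRoot_eq]; simp
  have h2 := eighthRoot_sq
  have h3 : eighthRoot ^ 3 = Complex.I * eighthRoot := by rw [pow_succ, h2]
  have h4 := eighthRoot_pow_four
  have h5 : eighthRoot ^ 5 = -eighthRoot := by rw [pow_succ, h4]; ring
  have h6 : eighthRoot ^ 6 = -Complex.I := by
    rw [show 6 = 4 + 2 from rfl, pow_add, h4, h2]; ring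
  have h7 : eighthRoot ^ 7 = -(Complex.I * eighthRoot) := by
    rw [show 7 = 4 + 3 from rfl, pow_add, h4, h3]; ring
  rw [abs_le] at hc ⊢
  interval_cases r <;> simp [h2, h3, h4, h5, h6, h7, hre, him] <;> constructor <;> linarith

theorem abs_sqrt_sub (d : ℕ) : |(Nat.sqrt (2 * d ^ 2) : ℝ) - Real.sqrt 2 * d| ≤ 1 := by
  have h : Real.sqrt 2 * d = Real.sqrt ((2 * d ^ 2 : ℕ) : ℝ) := by
    push_cast
    rw [Real.sqrt_mul (by norm_num), Real.sqrt_sq (by positivity)]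
  rw [h, abs_le]
  have h1 := Real.nat_sqrt_le_real_sqrt (a := 2 * d ^ 2)
  have h2 := Real.real_sqrt_le_nat_sqrt_succ (a := 2 * d ^ 2)
  constructor <;> linarith

theorem List.sum_flatMap_map {α M : Type*} [AddCommMonoid M] (T : List α) (f : α → α → M) :
    (T.flatMap fun t => T.map fun t' => f t t').sum =
      ∑ i : Fin T.length, ∑ j : Fin T.length, f T[i] T[j] := by
  have h1 : ∀ g : α → M, (T.map g).sum = ∑ i : Fin T.length, g T[i] := by
    intro g
    rw [← List.sum_ofFn]
    congr 1
    exact (List.ofFn_getElem_eq_map T g).symm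
  rw [← h1 fun t => ∑ j : Fin T.length, f t T[j]]
  simp only [← h1, List.flatMap_def, List.sum_flatten, List.map_map, Function.comp_def]

theorem entryApprox_den_pos (n A B sh : ℕ) (x : List ℕ × ℕ) : 0 < (entryApprox n A B sh x).2.2 := by
  simp only [entryApprox]; positivity

/-- The normalization enters squared, as the rational number 1/2 ^ q. The only error is the rounding
of √2 d, at most 1 for each pair of paths; for T paths these are T² pairs, against the denominator
2d · 2 ^ q with d = (K + 1)(T² + 1). -/
theorem abs_entry_sub_entryApprox (n : ℕ) (a b : Fin n → Fin 2) (sh : ℕ) (w : List ℕ) (K : ℕ) :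
    |(eighthRoot ^ sh * (wordState n w).mat a b).re -
      fracVal (entryApprox n (stringMask a) (stringMask b) sh (w, K))| ≤ 1 / ((K : ℝ) + 1) := by
  classical
  set N := w.length
  obtain ⟨h, q, T, hs⟩ : ∃ h q T, pathSum w = (h, q, T) := ⟨_, _, _, rfl⟩
  set d : ℕ := (K + 1) * (T.length ^ 2 + 1)
  set c := Nat.sqrt (2 * d ^ 2)
  have hd : (0 : ℝ) < d := by simp only [d]; positivity
  have hc := abs_sqrt_sub d
  have hsq : invSqrtTwo * invSqrtTwo = 1 / 2 := by
    rw [invSqrtTwo, div_mul_div_comm, ← Complex.ofReal_mul, Real.mul_self_sqrt (by norm_num)]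
    norm_num
  have hstar : star invSqrtTwo = invSqrtTwo := by simp [invSqrtTwo]
  let C : Fin T.length → Fin T.length → Prop := fun i j =>
    T[i].1 / 2 ^ (N + 1) % 2 ^ n = stringMask a ∧ T[j].1 = splice T[i].1 (N + 1) n (stringMask b)
  have hent : eighthRoot ^ sh * (wordState n w).mat a b = (1 / 2) ^ q * ∑ i : Fin T.length,
      ∑ j : Fin T.length, if C i j then eighthRoot ^ (T[i].2 + 7 * T[j].2 + sh) else 0 := by
    have hvec : (runWord w).1 = ∑ i : Fin T.length,
        (invSqrtTwo ^ q * eighthRoot ^ T[i].2) • ket (maskLabel N T[i].1) := by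
      rw [runWord_eq_pathVec, hs]
      simp only [pathVec, mul_smul, ← Finset.smul_sum]
      congr 1
      rw [← List.sum_ofFn]
      congr 1
      exact (List.ofFn_getElem_eq_map T fun t => eighthRoot ^ t.2 • ket (maskLabel N t.1)).symm
    simp only [wordState, reducedState]
    rw [hvec, reduced_sum_ket, Finset.mul_sum, Finset.mul_sum]
    refine Finset.sum_congr rfl fun i _ => ?_
    rw [Finset.mul_sum, Finset.mul_sum]
    refine Finset.sum_congr rfl fun j _ => ?_
    have hC : (window n (maskLabel N T[i].1) = a ∧
        maskLabel N T[j].1 = overwrite n b (maskLabel N T[i].1)) ↔ C i j := by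
      rw [window_maskLabel_eq_iff, overwrite_maskLabel, (maskLabel_injective N).eq_iff]
    rw [if_congr hC rfl rfl]
    split_ifs
    -- Conjugation multiplies the exponent of an eighth root by 7, and the two normalizing factors
    -- combine to a power of 1/2.
    · rw [star_mul', star_pow, star_pow, hstar, star_eighthRoot, ← hsq, mul_pow, ← pow_mul, pow_add,
        pow_add]
      ring
    · simp
  have hden : (0 : ℝ) < 2 * d * 2 ^ q := by positivity
  have happ : fracVal (entryApprox n (stringMask a) (stringMask b) sh (w, K)) =
      (∑ i : Fin T.length, ∑ j : Fin T.length, if C i j then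
        ((cosTable (2 * d) c (T[i].2 + 7 * T[j].2 + sh) : ℝ) -
          cosTable (2 * d) c (T[i].2 + 7 * T[j].2 + sh + 4)) else 0) / (2 * d * 2 ^ q) := by
    simp only [fracVal, entryApprox, hs, pairSum, List.sum_flatMap_map]
    push_cast
    rw [← Finset.sum_sub_distrib]
    congr 1
    swap
    · simp only [d]; push_cast; ring
    refine Finset.sum_congr rfl fun i _ => ?_
    rw [← Finset.sum_sub_distrib]
    refine Finset.sum_congr rfl fun j _ => ?_
    by_cases hC : C i j
    · rw [if_pos hC, if_pos hC, if_pos hC]; rfl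
    · rw [if_neg hC, if_neg hC, if_neg hC, sub_zero]
  have hre : (eighthRoot ^ sh * (wordState n w).mat a b).re =
      (∑ i : Fin T.length, ∑ j : Fin T.length, if C i j then
        2 * d * (eighthRoot ^ (T[i].2 + 7 * T[j].2 + sh)).re else 0) / (2 * d * 2 ^ q) := by
    have h2 : ((1 / 2 : ℂ)) ^ q = (((1 / 2 : ℝ) ^ q : ℝ) : ℂ) := by push_cast; rfl
    rw [hent, h2, Complex.re_ofReal_mul, Complex.re_sum, eq_div_iff hden.ne', Finset.mul_sum,
      Finset.sum_mul]
    refine Finset.sum_congr rfl fun i _ => ?_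
    rw [Complex.re_sum, Finset.mul_sum, Finset.sum_mul]
    refine Finset.sum_congr rfl fun j _ => ?_
    split_ifs
    · rw [one_div, inv_pow]
      field_simp
    · simp
  rw [happ, hre, ← sub_div, abs_div, abs_of_pos hden, div_le_div_iff₀ hden (by positivity),
    ← Finset.sum_sub_distrib]
  have hle : |∑ i : Fin T.length, ((∑ j : Fin T.length, if C i j then
        2 * d * (eighthRoot ^ (T[i].2 + 7 * T[j].2 + sh)).re else 0) -
      ∑ j : Fin T.length, if C i j then
        ((cosTable (2 * d) c (T[i].2 + 7 * T[j].2 + sh) : ℝ) -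
          cosTable (2 * d) c (T[i].2 + 7 * T[j].2 + sh + 4)) else 0)| ≤
      ∑ i : Fin T.length, ∑ j : Fin T.length, (1 : ℝ) := by
    refine (Finset.abs_sum_le_sum_abs _ _).trans (Finset.sum_le_sum fun i _ => ?_)
    rw [← Finset.sum_sub_distrib]
    refine (Finset.abs_sum_le_sum_abs _ _).trans (Finset.sum_le_sum fun j _ => ?_)
    split_ifs
    · rw [abs_sub_comm]
      exact abs_cosTable_sub d c _ hc
    · simp
  have hcard : ∑ i : Fin T.length, ∑ j : Fin T.length, (1 : ℝ) = (T.length : ℝ) ^ 2 := by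
    simp [pow_two]
  rw [hcard] at hle
  have hpow : (1 : ℝ) ≤ 2 ^ q := one_le_pow₀ (by norm_num)
  have hdr : (d : ℝ) = (K + 1) * (T.length ^ 2 + 1) := by simp only [d]; push_cast; ring
  calc _ ≤ (T.length : ℝ) ^ 2 * (K + 1) := by gcongr
    _ ≤ d := by rw [hdr]; nlinarith [Nat.cast_nonneg (α := ℝ) K]
    _ ≤ 2 * d * 1 := by linarith
    _ ≤ 1 * (2 * d * 2 ^ q) := by rw [one_mul]; gcongr

end

/-! ### Primitive recursiveness of the approximations -/

noncomputable section

/-! ### The approximations are primitive recursive -/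

/-- A function of the residue is a table on `Fin m`, and every function on a finite type is
primitive recursive. -/
theorem primrec_of_mod {α : Type*} [Primcodable α] {f : ℕ → α} {m : ℕ} (hm : 0 < m)
    (h : ∀ i, f (i % m) = f i) : Primrec f := by
  have h1 : Primrec fun i : ℕ => (⟨i % m, Nat.mod_lt i hm⟩ : Fin m) :=
    Primrec.fin_val_iff.1 (Primrec.nat_mod.comp Primrec.id (Primrec.const m))
  have h2 : Primrec fun i : Fin m => f i := Primrec.dom_finite _
  exact (h2.comp h1).of_eq h

theorem primrec₂_of_mod {α : Type*} [Primcodable α] {f : ℕ → ℕ → α} {m k : ℕ} (hm : 0 < m)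
    (hk : 0 < k) (h : ∀ i j, f (i % m) (j % k) = f i j) : Primrec₂ f := by
  have h1 : Primrec fun i : ℕ => (⟨i % m, Nat.mod_lt i hm⟩ : Fin m) :=
    Primrec.fin_val_iff.1 (Primrec.nat_mod.comp Primrec.id (Primrec.const m))
  have h2 : Primrec fun i : ℕ => (⟨i % k, Nat.mod_lt i hk⟩ : Fin k) :=
    Primrec.fin_val_iff.1 (Primrec.nat_mod.comp Primrec.id (Primrec.const k))
  have h3 : Primrec fun i : Fin m × Fin k => f i.1 i.2 := Primrec.dom_finite _
  exact (h3.comp ((h1.comp Primrec.fst).pair (h2.comp Primrec.snd))).of_eq fun p => h p.1 p.2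

theorem primrec_two_pow : Primrec fun n : ℕ => 2 ^ n := by
  have : Primrec₂ ((· ^ ·) : ℕ → ℕ → ℕ) := Primrec₂.unpaired'.1 Nat.Primrec.pow
  exact this.comp (Primrec.const 2) Primrec.id

theorem primrec₂_branchTable : Primrec₂ branchTable := by
  refine primrec₂_of_mod (m := 18) (k := 4) (by norm_num) (by norm_num) fun i j => ?_
  have : codePair (j % 4) = codePair j := by
    have h0 : (j % 2 ^ 2).testBit 0 = j.testBit 0 := by rw [Nat.testBit_mod_two_pow]; simp
    have h1 : (j % 2 ^ 2).testBit 1 = j.testBit 1 := by rw [Nat.testBit_mod_two_pow]; simp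
    rw [codePair, codePair, show 4 = 2 ^ 2 from rfl, h0, h1]
  simp only [branchTable, letterGate_mod, this]

theorem Primrec.splice {α : Type*} [Primcodable α] {f g h k : α → ℕ} (hf : Primrec f)
    (hg : Primrec g) (hh : Primrec h) (hk : Primrec k) :
    Primrec fun x => splice (f x) (g x) (h x) (k x) := by
  have p1 := primrec_two_pow.comp hg
  have p2 := primrec_two_pow.comp hh
  have p3 := primrec_two_pow.comp (Primrec.nat_add.comp hg hh)
  exact Primrec.nat_add.comp (Primrec.nat_mul.comp p1 (Primrec.nat_add.comp
    (Primrec.nat_mul.comp p2 (Primrec.nat_div.comp hf p3)) hk)) (Primrec.nat_mod.comp hf p1)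

theorem primrec₂_pathStep : Primrec₂ pathStep := by
  have hdisp : Primrec₂ fun (i : ℕ) (h : ℕ) => ((h : ℤ) + (letterDisp i).toInt).toNat := by
    have hr : Primrec fun i : ℕ => (match letterDisp i with | .right => 1 | _ => 0 : ℕ) :=
      primrec_of_mod (m := 18) (by norm_num) fun i => by rw [letterDisp_mod]
    have hl : Primrec fun i : ℕ => (match letterDisp i with | .left => 1 | _ => 0 : ℕ) :=
      primrec_of_mod (m := 18) (by norm_num) fun i => by rw [letterDisp_mod]
    -- Adding first and subtracting last makes truncated subtraction agree with `Int.toNat`, also at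
    -- 0.
    refine Primrec₂.of_eq (Primrec.nat_sub.comp (Primrec.nat_add.comp Primrec.snd
      (hr.comp Primrec.fst)) (hl.comp Primrec.fst)).to₂ fun i h => ?_
    cases letterDisp i <;> simp only [Disp.toInt] <;> omega
  have hcount : Primrec fun i : ℕ => (letterGate i).rootCount :=
    primrec_of_mod (m := 18) (by norm_num) fun i => by rw [letterGate_mod]
  have hs : Primrec fun x : (ℕ × ℕ × List (ℕ × ℕ)) × ℕ => x.1.1 :=
    Primrec.fst.comp Primrec.fst
  refine Primrec.pair (hdisp.comp Primrec.snd hs) (Primrec.pair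
    (Primrec.nat_add.comp (Primrec.fst.comp (Primrec.snd.comp Primrec.fst))
      (hcount.comp Primrec.snd)) ?_)
  refine Primrec.list_flatMap (Primrec.snd.comp (Primrec.snd.comp Primrec.fst)) ?_
  refine Primrec.list_map (f := fun x : ((ℕ × ℕ × List (ℕ × ℕ)) × ℕ) × (ℕ × ℕ) =>
    branchTable x.1.2 (x.2.1 / 2 ^ x.1.1.1 % 4)) ?_ ?_
  · exact primrec₂_branchTable.comp (Primrec.snd.comp Primrec.fst) (Primrec.nat_mod.comp
      (Primrec.nat_div.comp (Primrec.fst.comp Primrec.snd)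
        (primrec_two_pow.comp (hs.comp Primrec.fst))) (Primrec.const 4))
  · refine Primrec.pair ?_ ?_
    · exact Primrec.splice (Primrec.fst.comp (Primrec.snd.comp Primrec.fst))
        (hs.comp (Primrec.fst.comp Primrec.fst)) (Primrec.const 2)
        (Primrec.fst.comp Primrec.snd)
    · exact Primrec.nat_add.comp (Primrec.snd.comp (Primrec.snd.comp Primrec.fst))
        (Primrec.snd.comp Primrec.snd)

theorem primrec_pathSum : Primrec pathSum := by
  refine Primrec.list_foldl (h := fun (_ : List ℕ) (p : (ℕ × ℕ × List (ℕ × ℕ)) × ℕ) =>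
    pathStep p.1 p.2) Primrec.id (Primrec.pair Primrec.list_length (Primrec.const (0, [(0, 0)]))) ?_
  exact primrec₂_pathStep.comp (Primrec.fst.comp Primrec.snd) (Primrec.snd.comp Primrec.snd)

theorem primrec_list_sum : Primrec (List.sum : List ℕ → ℕ) := by
  refine (Primrec.list_foldr (f := fun l : List ℕ => l) (g := fun _ => 0)
    (h := fun _ (p : ℕ × ℕ) => p.1 + p.2) Primrec.id (Primrec.const 0) ?_).of_eq fun l => ?_
  · exact Primrec.nat_add.comp (Primrec.fst.comp Primrec.snd) (Primrec.snd.comp Primrec.snd)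
  · rw [List.sum_eq_foldr]

theorem primrec_cosTable : Primrec fun x : ℕ × ℕ × ℕ => cosTable x.1 x.2.1 x.2.2 := by
  have hm : Primrec fun x : ℕ × ℕ × ℕ => x.2.2 % 8 :=
    Primrec.nat_mod.comp (Primrec.snd.comp Primrec.snd) (Primrec.const 8)
  exact Primrec.ite (Primrec.eq.comp hm (Primrec.const 0)) Primrec.fst
    (Primrec.ite ((Primrec.eq.comp hm (Primrec.const 1)).or (Primrec.eq.comp hm (Primrec.const 7)))
      (Primrec.fst.comp Primrec.snd) (Primrec.const 0))

theorem primrec_pairSum (n A B sh : ℕ) : Primrec fun x : (ℕ × ℕ × ℕ) × List (ℕ × ℕ) =>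
    pairSum n A B sh x.1.1 x.1.2.1 x.1.2.2 x.2 := by
  refine primrec_list_sum.comp (Primrec.list_flatMap Primrec.snd ?_)
  refine Primrec.list_map (f := fun y : ((ℕ × ℕ × ℕ) × List (ℕ × ℕ)) × (ℕ × ℕ) => y.1.2)
    (Primrec.snd.comp Primrec.fst) ?_
  have hx : Primrec fun z : (((ℕ × ℕ × ℕ) × List (ℕ × ℕ)) × (ℕ × ℕ)) × (ℕ × ℕ) => z.1.1.1 :=
    Primrec.fst.comp (Primrec.fst.comp Primrec.fst)
  have ht : Primrec fun z : (((ℕ × ℕ × ℕ) × List (ℕ × ℕ)) × (ℕ × ℕ)) × (ℕ × ℕ) => z.1.2 :=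
    Primrec.snd.comp Primrec.fst
  have ht' : Primrec fun z : (((ℕ × ℕ × ℕ) × List (ℕ × ℕ)) × (ℕ × ℕ)) × (ℕ × ℕ) => z.2 :=
    Primrec.snd
  have hN := Primrec.succ.comp (Primrec.snd.comp (Primrec.snd.comp hx))
  refine Primrec.ite (PrimrecPred.and ?_ ?_) ?_ (Primrec.const 0)
  · exact Primrec.eq.comp (Primrec.nat_mod.comp (Primrec.nat_div.comp (Primrec.fst.comp ht)
      (primrec_two_pow.comp hN)) (Primrec.const (2 ^ n))) (Primrec.const A)
  · exact Primrec.eq.comp (Primrec.fst.comp ht')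
      (Primrec.splice (Primrec.fst.comp ht) hN (Primrec.const n) (Primrec.const B))
  · have hphase : Primrec fun z : (((ℕ × ℕ × ℕ) × List (ℕ × ℕ)) × (ℕ × ℕ)) × (ℕ × ℕ) =>
        z.1.2.2 + 7 * z.2.2 + sh :=
      Primrec.nat_add.comp (Primrec.nat_add.comp (Primrec.snd.comp ht)
        (Primrec.nat_mul.comp (Primrec.const 7) (Primrec.snd.comp ht'))) (Primrec.const sh)
    have harg : Primrec fun z : (((ℕ × ℕ × ℕ) × List (ℕ × ℕ)) × (ℕ × ℕ)) × (ℕ × ℕ) =>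
        (z.1.1.1.1, z.1.1.1.2.1, z.1.2.2 + 7 * z.2.2 + sh) :=
      Primrec.pair (Primrec.fst.comp hx) (Primrec.pair
        (Primrec.fst.comp (Primrec.snd.comp hx)) hphase)
    have hcos := primrec_cosTable.comp harg
    exact hcos

theorem primrec_entryApprox (n A B sh : ℕ) : Primrec (entryApprox n A B sh) := by
  have hs : Primrec fun x : List ℕ × ℕ => pathSum x.1 := primrec_pathSum.comp Primrec.fst
  have hT := Primrec.snd.comp (Primrec.snd.comp hs)
  have hlen := Primrec.list_length.comp hT
  have hd : Primrec fun x : List ℕ × ℕ => (x.2 + 1) * ((pathSum x.1).2.2.length ^ 2 + 1) := by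
    refine Primrec.nat_mul.comp (Primrec.succ.comp Primrec.snd) (Primrec.succ.comp ?_)
    exact (Primrec.nat_mul.comp hlen hlen).of_eq fun x => (pow_two _).symm
  have hu := Primrec.nat_mul.comp (Primrec.const 2) hd
  have hc : Primrec fun x : List ℕ × ℕ =>
      Nat.sqrt (2 * ((x.2 + 1) * ((pathSum x.1).2.2.length ^ 2 + 1)) ^ 2) := by
    refine Primrec.nat_sqrt.comp (Primrec.nat_mul.comp (Primrec.const 2) ?_)
    exact (Primrec.nat_mul.comp hd hd).of_eq fun x => (pow_two _).symm
  have harg : Primrec fun x : List ℕ × ℕ =>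
      ((2 * ((x.2 + 1) * ((pathSum x.1).2.2.length ^ 2 + 1)),
        Nat.sqrt (2 * ((x.2 + 1) * ((pathSum x.1).2.2.length ^ 2 + 1)) ^ 2), x.1.length),
        (pathSum x.1).2.2) :=
    Primrec.pair (Primrec.pair hu (Primrec.pair hc (Primrec.list_length.comp Primrec.fst))) hT
  have h1 := (primrec_pairSum n A B sh).comp harg
  have h2 := (primrec_pairSum n A B (sh + 4)).comp harg
  have h3 := Primrec.nat_mul.comp hu (primrec_two_pow.comp (Primrec.fst.comp (Primrec.snd.comp hs)))
  exact (Primrec.pair h1 (Primrec.pair h2 h3)).of_eq fun x => rfl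

end

/-! ### Circuits and the compact set of states they approximate -/

noncomputable section

/-! ### Operators on amplitudes -/

/-- The operator with matrix `A` on the cells `h`, `h + 1`. -/
def matOp (A : Matrix (Fin 2 × Fin 2) (Fin 2 × Fin 2) ℂ) (h : ℤ) :
    Module.End ℂ (Label → ℂ) where
  toFun ψ e := ∑ p : Fin 2 × Fin 2, A (pairAt h e) p * ψ (setPair h e p)
  map_add' ψ φ := by
    funext e; simp [mul_add, Finset.sum_add_distrib]
  map_smul' c ψ := by
    funext e; simp only [Pi.smul_apply, smul_eq_mul, RingHom.id_apply, Finset.mul_sum]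
    exact Finset.sum_congr rfl fun p _ => by ring

theorem matOp_apply (A : Matrix (Fin 2 × Fin 2) (Fin 2 × Fin 2) ℂ) (h : ℤ) (ψ : Label → ℂ)
    (e : Label) : matOp A h ψ e = ∑ p, A (pairAt h e) p * ψ (setPair h e p) := rfl

theorem matOp_mul (A B : Matrix (Fin 2 × Fin 2) (Fin 2 × Fin 2) ℂ) (h : ℤ) :
    matOp A h * matOp B h = matOp (A * B) h := by
  refine LinearMap.ext fun ψ => funext fun e => ?_
  simp only [Module.End.mul_apply, matOp_apply, pairAt_setPair, setPair_setPair, Matrix.mul_apply,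
    Finset.mul_sum, Finset.sum_mul]
  rw [Finset.sum_comm]
  exact Finset.sum_congr rfl fun p _ => Finset.sum_congr rfl fun q _ => by ring

theorem matOp_one (h : ℤ) : matOp 1 h = 1 := by
  refine LinearMap.ext fun ψ => funext fun e => ?_
  simp [matOp_apply, Matrix.one_apply]

/-- The operator with matrix `A` on the cell `h`. -/
def cellOp (A : Matrix (Fin 2) (Fin 2) ℂ) (h : ℤ) : Module.End ℂ (Label → ℂ) :=
  matOp (Matrix.kronecker A (1 : Matrix (Fin 2) (Fin 2) ℂ)) h

theorem cellOp_apply (A : Matrix (Fin 2) (Fin 2) ℂ) (h : ℤ) (ψ : Label → ℂ) (e : Label) :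
    cellOp A h ψ e = ∑ b, A (e h) b * ψ (Function.update e h b) := by
  simp only [cellOp, matOp_apply, Fintype.sum_prod_type]
  refine Finset.sum_congr rfl fun b _ => ?_
  rw [Finset.sum_eq_single (e (h + 1))]
  · simp only [pairAt, Matrix.kronecker, Matrix.kroneckerMap_apply, Matrix.one_apply_eq, mul_one,
      setPair]
    congr 2
    funext j
    have : h ≠ h + 1 := by omega
    simp only [Function.update_apply]
    split_ifs <;> simp_all
  · intro c _ hc
    simp [pairAt, Matrix.kronecker, Matrix.kroneckerMap_apply, hc.symm]
  · simp

theorem cellOp_mul (A B : Matrix (Fin 2) (Fin 2) ℂ) (h : ℤ) :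
    cellOp A h * cellOp B h = cellOp (A * B) h := by
  have := Matrix.mul_kronecker_mul A B (1 : Matrix (Fin 2) (Fin 2) ℂ)
    (1 : Matrix (Fin 2) (Fin 2) ℂ)
  rw [mul_one] at this
  rw [cellOp, cellOp, cellOp, matOp_mul]
  exact congrArg (matOp · h) this.symm

theorem cellOp_one (h : ℤ) : cellOp 1 h = 1 := by
  have : Matrix.kronecker (1 : Matrix (Fin 2) (Fin 2) ℂ) (1 : Matrix (Fin 2) (Fin 2) ℂ) = 1 :=
    Matrix.one_kronecker_one
  rw [cellOp, this, matOp_one]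

theorem cellOp_add (A B : Matrix (Fin 2) (Fin 2) ℂ) (h : ℤ) :
    cellOp (A + B) h = cellOp A h + cellOp B h := by
  refine LinearMap.ext fun ψ => funext fun e => ?_
  simp [cellOp_apply, add_mul]
  ring

theorem cellOp_smul (c : ℂ) (A : Matrix (Fin 2) (Fin 2) ℂ) (h : ℤ) :
    cellOp (c • A) h = c • cellOp A h := by
  refine LinearMap.ext fun ψ => funext fun e => ?_
  simp [cellOp_apply]
  ring

/-- The Hadamard matrix. -/
def hadamardMatrix : Matrix (Fin 2) (Fin 2) ℂ := invSqrtTwo • !![1, 1; 1, -1]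

/-- The matrix of the phase gate. -/
def phaseMatrix : Matrix (Fin 2) (Fin 2) ℂ := !![1, 0; 0, Complex.I]

/-- The matrix of the `π/8` gate. -/
def piEighthMatrix : Matrix (Fin 2) (Fin 2) ℂ := !![1, 0; 0, eighthRoot]

theorem gateOp_hadamard (h : ℤ) : gateOp .hadamard h = cellOp hadamardMatrix h := rfl
theorem gateOp_phase (h : ℤ) : gateOp .phase h = cellOp phaseMatrix h := rfl
theorem gateOp_piEighth (h : ℤ) : gateOp .piEighth h = cellOp piEighthMatrix h := rfl
theorem gateOp_idle (h : ℤ) : gateOp .idle h = 1 := matOp_one h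

theorem gateOp_swap_apply (h : ℤ) (ψ : Label → ℂ) (e : Label) :
    gateOp .swap h ψ e = ψ (setPair h e (e (h + 1), e h)) := by
  simp only [gateOp_apply, Gate.matrix, Matrix.of_apply, pairAt]
  rw [Finset.sum_eq_single (e (h + 1), e h)]
  · simp
  · rintro ⟨a, b⟩ _ hp
    rw [if_neg, zero_mul]
    intro heq
    have h1 := congrArg Prod.fst heq
    have h2 := congrArg Prod.snd heq
    exact hp (Prod.ext h2.symm h1.symm)
  · simp

theorem gateOp_cnot_apply (h : ℤ) (ψ : Label → ℂ) (e : Label) :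
    gateOp .cnot h ψ e = ψ (setPair h e (e h, e h + e (h + 1))) := by
  have h2 : ∀ a b : Fin 2, a + (a + b) = b := by decide
  simp only [gateOp_apply, Gate.matrix, Matrix.of_apply, pairAt]
  rw [Finset.sum_eq_single (e h, e h + e (h + 1))]
  · simp [h2]
  · rintro ⟨a, b⟩ _ hp
    rw [if_neg, zero_mul]
    intro heq
    have h3 : e h = a := congrArg Prod.fst heq
    have h4 : e (h + 1) = a + b := congrArg Prod.snd heq
    refine hp (Prod.ext h3.symm ?_)
    simp only [h3, h4, h2]
  · simp

theorem invSqrtTwo_mul_self : invSqrtTwo * invSqrtTwo = 1 / 2 := by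
  rw [invSqrtTwo, div_mul_div_comm, ← Complex.ofReal_mul, Real.mul_self_sqrt (by norm_num)]
  norm_num

theorem hadamardMatrix_mul_self : hadamardMatrix * hadamardMatrix = 1 := by
  have h := invSqrtTwo_mul_self
  rw [hadamardMatrix, Matrix.smul_mul, Matrix.mul_smul, smul_smul, h]
  ext i j
  fin_cases i <;> fin_cases j <;> simp <;> norm_num

theorem phaseMatrix_pow_two : phaseMatrix * phaseMatrix = !![1, 0; 0, -1] := by
  ext i j
  fin_cases i <;> fin_cases j <;> simp [phaseMatrix, Matrix.mul_apply]

/-- The gate set lacks the inverses of S and T. A common exponent makes the seventh power of any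
gate its inverse, so that the monoid of circuits is closed under inversion. -/
theorem gateOp_pow_eight (g : Gate) (h : ℤ) : gateOp g h ^ 8 = 1 := by
  have key : ∀ A : Module.End ℂ (Label → ℂ), A * A = 1 → A ^ 8 = 1 := by
    intro A hA
    rw [show 8 = 2 * 4 from rfl, pow_mul, pow_two, hA, one_pow]
  have hphase : cellOp phaseMatrix h ^ 4 = 1 := by
    rw [show 4 = 2 * 2 from rfl, pow_mul, pow_two (cellOp phaseMatrix h), cellOp_mul,
      phaseMatrix_pow_two, pow_two, cellOp_mul]
    have : (!![1, 0; 0, -1] : Matrix (Fin 2) (Fin 2) ℂ) * !![1, 0; 0, -1] = 1 := by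
      ext i j
      fin_cases i <;> fin_cases j <;> simp [Matrix.mul_apply]
    rw [this, cellOp_one]
  cases g with
  | idle => rw [gateOp_idle, one_pow]
  | hadamard =>
    apply key
    rw [gateOp_hadamard, cellOp_mul, hadamardMatrix_mul_self, cellOp_one]
  | phase => rw [gateOp_phase, show 8 = 4 * 2 from rfl, pow_mul, hphase, one_pow]
  | piEighth =>
    rw [show 8 = 2 * 4 from rfl, pow_mul, pow_two, gateOp_piEighth, cellOp_mul]
    have h1 : piEighthMatrix * piEighthMatrix = phaseMatrix := by
      have := eighthRoot_sq
      ext i j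
      fin_cases i <;> fin_cases j <;>
        simp [piEighthMatrix, phaseMatrix, Matrix.mul_apply, ← pow_two, this]
    rw [h1, hphase]
  | swap =>
    apply key
    refine LinearMap.ext fun ψ => funext fun e => ?_
    rw [Module.End.mul_apply, gateOp_swap_apply, gateOp_swap_apply]
    have h1 := pairAt_setPair h e (e (h + 1), e h)
    simp only [pairAt, Prod.mk.injEq] at h1
    rw [h1.1, h1.2, setPair_setPair]
    exact congrArg ψ (setPair_pairAt h e)
  | cnot =>
    have h2 : ∀ a b : Fin 2, a + (a + b) = b := by decide
    apply key
    refine LinearMap.ext fun ψ => funext fun e => ?_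
    rw [Module.End.mul_apply, gateOp_cnot_apply, gateOp_cnot_apply]
    have h1 := pairAt_setPair h e (e h, e h + e (h + 1))
    simp only [pairAt, Prod.mk.injEq] at h1
    rw [h1.1, h1.2, setPair_setPair, h2]
    exact congrArg ψ (setPair_pairAt h e)

theorem continuous_matOp (A : Matrix (Fin 2 × Fin 2) (Fin 2 × Fin 2) ℂ) (h : ℤ) :
    Continuous (matOp A h : (Label → ℂ) → Label → ℂ) := by
  refine continuous_pi fun e => ?_
  simp only [matOp_apply]
  fun_prop

/-! ### Circuits on the cells `1, …, m` -/

/-- Gates that act on the cells `1, …, m` only. -/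
def InRange (m : ℕ) : Gate → ℤ → Prop
  | .swap, j => 1 ≤ j ∧ j + 1 ≤ m
  | .cnot, j => 1 ≤ j ∧ j + 1 ≤ m
  | _, j => 1 ≤ j ∧ j ≤ m

/-- The operators of circuits on the cells `1, …, m`. -/
def circuits (m : ℕ) : Submonoid (Module.End ℂ (Label → ℂ)) :=
  Submonoid.closure {U | ∃ g j, InRange m g j ∧ U = gateOp g j}

theorem gateOp_mem_circuits {m : ℕ} {g : Gate} {j : ℤ} (h : InRange m g j) :
    gateOp g j ∈ circuits m := Submonoid.subset_closure ⟨g, j, h, rfl⟩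

theorem circuits_induction {m : ℕ} {p : Module.End ℂ (Label → ℂ) → Prop} (h1 : p 1)
    (hmul : ∀ g j, InRange m g j → ∀ U ∈ circuits m, p U → p (gateOp g j * U))
    {U : Module.End ℂ (Label → ℂ)} (hU : U ∈ circuits m) : p U := by
  induction hU using Submonoid.closure_induction_left with
  | one => exact h1
  | mul_left x hx y hy ih =>
    obtain ⟨g, j, hg, rfl⟩ := hx
    exact hmul g j hg y hy ih

theorem exists_inverse {m : ℕ} {U : Module.End ℂ (Label → ℂ)} (hU : U ∈ circuits m) :
    ∃ V ∈ circuits m, U * V = 1 ∧ V * U = 1 := by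
  refine circuits_induction (p := fun U => ∃ V ∈ circuits m, U * V = 1 ∧ V * U = 1)
    ⟨1, Submonoid.one_mem _, by simp, by simp⟩ ?_ hU
  rintro g j hg U - ⟨V, hV, h1, h2⟩
  have h8 := gateOp_pow_eight g j
  refine ⟨V * gateOp g j ^ 7, Submonoid.mul_mem _ hV
    (Submonoid.pow_mem _ (gateOp_mem_circuits hg) 7), ?_, ?_⟩
  · calc gateOp g j * U * (V * gateOp g j ^ 7) = gateOp g j * (U * V) * gateOp g j ^ 7 := by
          simp only [mul_assoc]
      _ = gateOp g j ^ 8 := by rw [h1, mul_one, ← pow_succ']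
      _ = 1 := h8
  · calc V * gateOp g j ^ 7 * (gateOp g j * U) = V * (gateOp g j ^ 7 * gateOp g j) * U := by
          simp only [mul_assoc]
      _ = 1 := by rw [← pow_succ, h8, mul_one, h2]

theorem continuous_of_mem_circuits {m : ℕ} {U : Module.End ℂ (Label → ℂ)} (hU : U ∈ circuits m) :
    Continuous (U : (Label → ℂ) → Label → ℂ) := by
  refine circuits_induction (p := fun U => Continuous (U : (Label → ℂ) → Label → ℂ))
    continuous_id ?_ hU
  intro g j _ U _ hc
  exact (continuous_matOp g.matrix j).comp hc

/-- Amplitudes that vanish at all labels with a bit outside the cells `1, …, m`. -/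
def InWindow (m : ℕ) (ψ : Label → ℂ) : Prop :=
  ∀ e : Label, ∀ j : ℤ, ¬ (1 ≤ j ∧ j ≤ m) → e j ≠ 0 → ψ e = 0

theorem InWindow.cellOp {m : ℕ} {ψ : Label → ℂ} (hψ : InWindow m ψ) (A : Matrix (Fin 2) (Fin 2) ℂ)
    {j : ℤ} (hj : 1 ≤ j ∧ j ≤ m) : InWindow m (cellOp A j ψ) := by
  intro e i hi he
  rw [cellOp_apply]
  refine Finset.sum_eq_zero fun b _ => ?_
  have : i ≠ j := by rintro rfl; exact hi hj
  rw [hψ _ i hi (by rwa [Function.update_of_ne this]), mul_zero]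

/-- A one-qubit gate is formally a matrix on two cells, but by `cellOp_apply` it changes only the
cell `j` and may act on the last cell `m`. -/
theorem InWindow.gateOp {m : ℕ} {ψ : Label → ℂ} (hψ : InWindow m ψ) {g : Gate} {j : ℤ}
    (hg : InRange m g j) : InWindow m (gateOp g j ψ) := by
  have two : 1 ≤ j ∧ j + 1 ≤ m → InWindow m (DCQ.gateOp g j ψ) := by
    rintro hj e i hi he
    rw [gateOp_apply]
    refine Finset.sum_eq_zero fun p _ => ?_
    rw [hψ _ i hi (by rwa [setPair_apply_of_ne _ _ (by omega) (by omega)]), mul_zero]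
  cases g with
  | idle => rw [gateOp_idle]; exact hψ
  | hadamard => exact hψ.cellOp _ hg
  | phase => exact hψ.cellOp _ hg
  | piEighth => exact hψ.cellOp _ hg
  | swap => exact two hg
  | cnot => exact two hg

/-- The label with the bits `x` in the cells `1, …, m` and `0` elsewhere. -/
def windowLabel {m : ℕ} (x : Fin m → Fin 2) : Label := overwrite m x 0

theorem windowLabel_apply {m : ℕ} (x : Fin m → Fin 2) (i : Fin m) :
    windowLabel x ((i : ℤ) + 1) = x i :=
  congrFun (window_overwrite m x 0) i

theorem windowLabel_apply_of_not {m : ℕ} (x : Fin m → Fin 2) {j : ℤ} (hj : ¬ (1 ≤ j ∧ j ≤ m)) :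
    windowLabel x j = 0 := by
  simp [windowLabel, overwrite, hj]

theorem windowLabel_injective (m : ℕ) : Function.Injective (windowLabel (m := m)) := by
  intro x y h
  have := congrArg (window m) h
  simpa [windowLabel] using this

theorem eq_windowLabel {m : ℕ} {e : Label} (he : ∀ j : ℤ, ¬ (1 ≤ j ∧ j ≤ m) → e j = 0) :
    e = windowLabel (window m e) := by
  funext j
  by_cases hj : 1 ≤ j ∧ j ≤ m
  · conv_lhs => rw [← overwrite_window m e]
    simp [windowLabel, overwrite, hj]
  · rw [windowLabel_apply_of_not _ hj, he j hj]

theorem InWindow.eq_zero {m : ℕ} {ψ : Label → ℂ} (hψ : InWindow m ψ) {e : Label}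
    (he : ∀ x : Fin m → Fin 2, e ≠ windowLabel x) : ψ e = 0 := by
  by_contra h0
  apply he (window m e)
  refine eq_windowLabel fun j hj => ?_
  by_contra hne
  exact h0 (hψ e j hj hne)

theorem InWindow.finsum_eq {m : ℕ} {ψ : Label → ℂ} (hψ : InWindow m ψ) :
    ∑ᶠ e, ψ e * star (ψ e) = ∑ x : Fin m → Fin 2, ψ (windowLabel x) * star (ψ (windowLabel x)) := by
  classical
  rw [finsum_eq_sum_of_support_subset (s := Finset.univ.map ⟨_, windowLabel_injective m⟩),
    Finset.sum_map]
  · rfl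
  · intro e he
    by_contra hne
    apply he
    have : ψ e = 0 := by
      apply hψ.eq_zero
      rintro x rfl
      simp at hne
    simp [this]

/-- The amplitudes prepared by circuits on the cells `1, …, m`. -/
def prepared (m : ℕ) : Set (Label → ℂ) := {ψ | ∃ U ∈ circuits m, ψ = U vacuum}

theorem inWindow_and_norm_of_mem_prepared {m : ℕ} {ψ : Label → ℂ} (hψ : ψ ∈ prepared m) :
    InWindow m ψ ∧ ∑ x : Fin m → Fin 2, ψ (windowLabel x) * star (ψ (windowLabel x)) = 1 := by
  obtain ⟨U, hU, rfl⟩ := hψ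
  have : InWindow m (U vacuum) ∧ IsNormalized (U vacuum) := by
    refine circuits_induction (p := fun U => InWindow m (U vacuum) ∧ IsNormalized (U vacuum))
      ⟨?_, isNormalized_vacuum⟩ ?_ hU
    · intro e j _ he
      simp only [Module.End.one_apply, vacuum, ket]
      rw [if_neg]
      rintro rfl
      exact he rfl
    · intro g j hg U _ hp
      exact ⟨hp.1.gateOp hg, hp.2.gateOp g j⟩
  exact ⟨this.1, this.1.finsum_eq ▸ this.2.2⟩

/-- Both conditions are closed in the product topology: each involves finitely many coordinates at a
time. -/
theorem inWindow_and_norm_of_mem_closure {m : ℕ} {ψ : Label → ℂ} (hψ : ψ ∈ closure (prepared m)) :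
    InWindow m ψ ∧ ∑ x : Fin m → Fin 2, ψ (windowLabel x) * star (ψ (windowLabel x)) = 1 := by
  constructor
  · intro e j hj he
    have hcl : IsClosed {φ : Label → ℂ | φ e = 0} :=
      isClosed_eq (continuous_apply e) continuous_const
    exact closure_minimal (fun φ hφ => (inWindow_and_norm_of_mem_prepared hφ).1 e j hj he) hcl hψ
  · have hcl : IsClosed {φ : Label → ℂ |
        ∑ x : Fin m → Fin 2, φ (windowLabel x) * star (φ (windowLabel x)) = 1} := by
      refine isClosed_eq ?_ continuous_const
      fun_prop
    exact closure_minimal (fun φ hφ => (inWindow_and_norm_of_mem_prepared hφ).2) hcl hψ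

/-- Normalization bounds every amplitude by 1, and by Tychonoff's theorem the product of closed unit
discs over all labels is compact. -/
theorem isCompact_closure_prepared (m : ℕ) : IsCompact (closure (prepared m)) := by
  have hK : IsCompact (Set.univ.pi fun _ : Label => Metric.closedBall (0 : ℂ) 1) :=
    isCompact_univ_pi fun _ => isCompact_closedBall _ _
  refine hK.of_isClosed_subset isClosed_closure fun ψ hψ e _ => ?_
  obtain ⟨h1, h2⟩ := inWindow_and_norm_of_mem_closure hψ
  rw [mem_closedBall_zero_iff]
  by_cases he : ∃ x : Fin m → Fin 2, e = windowLabel x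
  · obtain ⟨x, rfl⟩ := he
    have h3 : ∑ x : Fin m → Fin 2, ‖ψ (windowLabel x)‖ ^ 2 = 1 := by
      have := congrArg Complex.re h2
      simpa [Complex.re_sum, Complex.mul_conj, Complex.normSq_eq_norm_sq, ← Complex.ofReal_pow]
        using this
    have h4 : ‖ψ (windowLabel x)‖ ^ 2 ≤ 1 := by
      rw [← h3]
      exact Finset.single_le_sum (f := fun x : Fin m → Fin 2 => ‖ψ (windowLabel x)‖ ^ 2)
        (fun _ _ => by positivity) (Finset.mem_univ x)
    nlinarith [norm_nonneg (ψ (windowLabel x))]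
  · rw [h1.eq_zero (by push Not at he; exact he)]
    simp

theorem map_mem_closure_prepared {m : ℕ} {U : Module.End ℂ (Label → ℂ)} (hU : U ∈ circuits m)
    {ψ : Label → ℂ} (hψ : ψ ∈ closure (prepared m)) : U ψ ∈ closure (prepared m) := by
  refine map_mem_closure (continuous_of_mem_circuits hU) hψ ?_
  rintro _ ⟨V, hV, rfl⟩
  exact ⟨U * V, Submonoid.mul_mem _ hU hV, rfl⟩

/-! ### Words prepare all states that circuits prepare -/

theorem runWord_append_singleton (w : List ℕ) (i : ℕ) :
    runWord (w ++ [i]) = letterStep (runWord w) i := by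
  simp [runWord]

/-- Letters with the idle gate carry the head to any cell without changing the state, so the head
position does not restrict the next gate. -/
theorem exists_runWord_move {ψ : Label → ℂ} (h : ∃ w j, runWord w = (ψ, j)) (j : ℤ) :
    ∃ w, runWord w = (ψ, j) := by
  obtain ⟨w, j₀, hw⟩ := h
  induction j using Int.inductionOn' (b := j₀) with
  | zero => exact ⟨w, hw⟩
  | succ k _ ih =>
    obtain ⟨w, hw⟩ := ih
    refine ⟨w ++ [letter .idle .right], ?_⟩
    rw [runWord_append_singleton, hw, letterStep]
    simp [gateOp_idle, Disp.toInt]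
  | pred k _ ih =>
    obtain ⟨w, hw⟩ := ih
    refine ⟨w ++ [letter .idle .left], ?_⟩
    rw [runWord_append_singleton, hw, letterStep]
    simp [gateOp_idle, Disp.toInt, sub_eq_add_neg]

theorem exists_runWord_of_mem_prepared {m : ℕ} {ψ : Label → ℂ} (hψ : ψ ∈ prepared m) :
    ∃ w, (runWord w).1 = ψ := by
  obtain ⟨U, hU, rfl⟩ := hψ
  have : ∃ w j, runWord w = (U vacuum, j) := by
    refine circuits_induction (p := fun U => ∃ w j, runWord w = (U vacuum, j))
      ⟨[], 0, rfl⟩ ?_ hU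
    intro g j _ U _ h
    obtain ⟨w, hw⟩ := exists_runWord_move h j
    refine ⟨w ++ [letter g .stay], j, ?_⟩
    rw [runWord_append_singleton, hw, letterStep]
    simp [Disp.toInt]
  obtain ⟨w, j, hw⟩ := this
  exact ⟨w, by rw [hw]⟩

end

/-! ### An irrational rotation and the first-order conditions at a maximal overlap -/

noncomputable section

/-! ### An irrational rotation generated by the Hadamard and `π/8` gates -/

/-- The cosine of the angle of the rotation `T H T H`. -/
def rotCos : ℝ := (1 + Real.sqrt 2 / 2) / 2

/-- The angle of the rotation `T H T H`. -/
def rotAngle : ℝ := Real.arccos rotCos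

theorem sqrt_two_lt : Real.sqrt 2 < 2 := by
  rw [Real.sqrt_lt' (by norm_num)]; norm_num

theorem cos_rotAngle : Real.cos rotAngle = rotCos := by
  have h1 := sqrt_two_lt
  have h2 := Real.sqrt_nonneg 2
  exact Real.cos_arccos (by unfold rotCos; linarith) (by unfold rotCos; linarith)

theorem sin_rotAngle_ne_zero : Real.sin rotAngle ≠ 0 := by
  have h1 := sqrt_two_lt
  have h2 := Real.sqrt_nonneg 2
  have h3 := Real.sin_sq_add_cos_sq rotAngle
  rw [cos_rotAngle] at h3
  intro h0
  rw [h0] at h3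
  unfold rotCos at h3
  nlinarith

theorem not_isIntegral_half : ¬ IsIntegral ℤ ((1 : ℂ) / 2) := by
  intro h
  have h1 : IsIntegral ℤ (algebraMap ℚ ℂ (1 / 2)) := by simpa using h
  rw [isIntegral_algebraMap_iff (algebraMap ℚ ℂ).injective] at h1
  obtain ⟨y, hy⟩ := IsIntegrallyClosed.isIntegral_iff.1 h1
  have h2 : (y : ℚ) * 2 = 1 := by
    have : (y : ℚ) = 1 / 2 := by simpa using hy
    rw [this]; norm_num
  have h3 : y * 2 = 1 := by exact_mod_cast h2
  omega

/-- If the angle were a rational multiple of 2π, then exp(iθ) would be a root of unity, and 2 cos θ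
− 1 = √2/2 an algebraic integer. Its square 1/2 is not one. -/
theorem irrational_rotAngle : Irrational (rotAngle / (2 * Real.pi)) := by
  rintro ⟨q, hq⟩
  have hpi : (2 * Real.pi) ≠ 0 := by positivity
  have hθ : rotAngle = q * (2 * Real.pi) := by rw [hq]; field_simp
  set z : ℂ := Complex.exp (rotAngle * Complex.I)
  have hz : z ^ q.den = 1 := by
    rw [← Complex.exp_nat_mul, Complex.exp_eq_one_iff]
    refine ⟨q.num, ?_⟩
    have hden : (q.den : ℂ) * (q : ℂ) = q.num := by
      have : (q.den : ℚ) * q = q.num := by rw [mul_comm]; exact Rat.mul_den_eq_num q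
      exact_mod_cast this
    rw [hθ]
    push_cast
    calc (q.den : ℂ) * ((q : ℂ) * (2 * Real.pi) * Complex.I)
        = (q.den * q) * (2 * Real.pi * Complex.I) := by ring
      _ = _ := by rw [hden]
  have hint : ∀ w : ℂ, w ^ q.den = 1 → IsIntegral ℤ w := fun w hw =>
    IsIntegral.of_pow q.den_pos (by rw [hw]; exact isIntegral_one)
  have hzi := hint z hz
  have hz'i := hint (starRingEnd ℂ z) (by rw [← map_pow, hz, map_one])
  have hsum : z + starRingEnd ℂ z = 1 + ((Real.sqrt 2 / 2 : ℝ) : ℂ) := by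
    rw [Complex.add_conj, Complex.exp_ofReal_mul_I_re, cos_rotAngle, rotCos]
    push_cast; ring
  have h1 : IsIntegral ℤ (((Real.sqrt 2 / 2 : ℝ) : ℂ)) := by
    have := (hzi.add hz'i).sub isIntegral_one
    rwa [hsum, add_sub_cancel_left] at this
  have h2 := h1.mul h1
  have h3 : ((Real.sqrt 2 / 2 : ℝ) : ℂ) * ((Real.sqrt 2 / 2 : ℝ) : ℂ) = 1 / 2 := by
    rw [← Complex.ofReal_mul]
    have : Real.sqrt 2 / 2 * (Real.sqrt 2 / 2) = 1 / 2 := by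
      rw [div_mul_div_comm, Real.mul_self_sqrt (by norm_num)]; norm_num
    rw [this]; norm_num
  rw [h3] at h2
  exact not_isIntegral_half h2

/-- The multiples of the angle are dense modulo 2π, so the bound holds for every real angle t. With
s = tan t it becomes a quadratic inequality s² c ≤ 2 s R for all real s, which forces R = 0. -/
theorem im_star_mul_eq_zero_of_forall_norm_le {a b : ℂ}
    (h : ∀ k : ℤ, ‖(Real.cos (k * rotAngle) : ℂ) * a +
      Complex.I * (Real.sin (k * rotAngle) : ℂ) * b‖ ≤ ‖a‖) : (star a * b).im = 0 := by
  have hall : ∀ t : ℝ, ‖(Real.cos t : ℂ) * a + Complex.I * (Real.sin t : ℂ) * b‖ ≤ ‖a‖ := by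
    have hd := dense_addSubgroupClosure_pair_iff.2 irrational_rotAngle
    have hcl : IsClosed {t : ℝ | ‖(Real.cos t : ℂ) * a + Complex.I * (Real.sin t : ℂ) * b‖ ≤ ‖a‖} :=
      isClosed_le (by fun_prop) continuous_const
    intro t
    refine closure_minimal ?_ hcl (hd t)
    intro s hs
    rw [SetLike.mem_coe, AddSubgroup.mem_closure_pair] at hs
    obtain ⟨k, l, rfl⟩ := hs
    simp only [zsmul_eq_mul, Set.mem_ofPred_eq, Real.cos_add_int_mul_two_pi,
      Real.sin_add_int_mul_two_pi]
    exact h k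
  have hsq : ∀ s : ℝ, ‖a‖ ^ 2 + s ^ 2 * ‖b‖ ^ 2 - 2 * s * (star a * b).im ≤
      (1 + s ^ 2) * ‖a‖ ^ 2 := by
    intro s
    have h1 := hall (Real.arctan s)
    have hc := Real.cos_arctan_pos s
    have hs : Real.sin (Real.arctan s) = s * Real.cos (Real.arctan s) := by
      have := Real.tan_arctan s
      rw [Real.tan_eq_sin_div_cos] at this
      field_simp at this
      linarith
    have hc2 : Real.cos (Real.arctan s) ^ 2 = 1 / (1 + s ^ 2) := Real.cos_sq_arctan s
    rw [hs] at h1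
    have h2 : (Real.cos (Real.arctan s) : ℂ) * a +
        Complex.I * ((s * Real.cos (Real.arctan s) : ℝ) : ℂ) * b =
        (Real.cos (Real.arctan s) : ℂ) * (a + Complex.I * s * b) := by push_cast; ring
    rw [h2, norm_mul, Complex.norm_real, Real.norm_eq_abs, abs_of_pos hc] at h1
    have h3 : Real.cos (Real.arctan s) ^ 2 * ‖a + Complex.I * s * b‖ ^ 2 ≤ ‖a‖ ^ 2 := by
      rw [← mul_pow]
      exact pow_le_pow_left₀ (by positivity) h1 2
    have h4 : ‖a + Complex.I * s * b‖ ^ 2 =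
        ‖a‖ ^ 2 + s ^ 2 * ‖b‖ ^ 2 - 2 * s * (star a * b).im := by
      simp only [← Complex.normSq_eq_norm_sq, Complex.normSq_apply]
      simp
      ring
    rw [h4, hc2, one_div, inv_mul_le_iff₀ (by positivity)] at h3
    exact h3
  set R := (star a * b).im
  set c := ‖b‖ ^ 2 - ‖a‖ ^ 2 with hcdef
  have hR : ∀ s : ℝ, s ^ 2 * c ≤ 2 * s * R := by
    intro s
    have := hsq s
    rw [hcdef]
    linarith
  by_contra hne
  have hc0 : 0 < |c| + 1 := by positivity
  -- At this point the inequality reads R² c ≤ −2 R² (|c| + 1), which for R ≠ 0 contradicts c ≥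
  -- −|c|.
  have h1 := hR (-R / (|c| + 1))
  have h2 : (-R / (|c| + 1)) ^ 2 * c = R ^ 2 * c / (|c| + 1) ^ 2 := by
    rw [div_pow, neg_sq]; ring
  have h3 : 2 * (-R / (|c| + 1)) * R = -(2 * R ^ 2 * (|c| + 1)) / (|c| + 1) ^ 2 := by
    field_simp
  rw [h2, h3, div_le_div_iff_of_pos_right (by positivity)] at h1
  have h4 : 0 < R ^ 2 := by positivity
  have h5 := neg_abs_le c
  nlinarith

/-- The matrix of `T H T H`, up to a phase. -/
def rotMatrix : Matrix (Fin 2) (Fin 2) ℂ :=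
  eighthRoot ^ 7 • (piEighthMatrix * hadamardMatrix * (piEighthMatrix * hadamardMatrix))

theorem rotMatrix_eq : rotMatrix = (1 / 2 : ℂ) • !![1 + eighthRoot ^ 7, eighthRoot ^ 7 - 1;
    1 - eighthRoot, 1 + eighthRoot] := by
  have h8 : eighthRoot ^ 7 * eighthRoot = 1 := by rw [← pow_succ, eighthRoot_pow_eight]
  have hs := invSqrtTwo_mul_self
  have hTH : piEighthMatrix * hadamardMatrix =
      invSqrtTwo • !![1, 1; eighthRoot, -eighthRoot] := by
    ext i j
    fin_cases i <;> fin_cases j <;> simp [piEighthMatrix, hadamardMatrix, Matrix.mul_apply] <;> ring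
  rw [rotMatrix, hTH, smul_mul_smul_comm, hs, smul_comm]
  congr 1
  generalize eighthRoot ^ 7 = y at h8 ⊢
  ext i j
  fin_cases i <;> fin_cases j <;> simp <;>
    first
    | linear_combination h8
    | linear_combination -h8
    | linear_combination (1 - eighthRoot) * h8
    | linear_combination (1 + eighthRoot) * h8

/-- The Hermitian generator of `rotMatrix`. -/
def axisMatrix : Matrix (Fin 2) (Fin 2) ℂ :=
  (-Complex.I / (Real.sin rotAngle : ℂ)) • (rotMatrix - (rotCos : ℂ) • 1)

theorem rotMatrix_eq_axis : rotMatrix = (Real.cos rotAngle : ℂ) • 1 +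
    (Complex.I * (Real.sin rotAngle : ℂ)) • axisMatrix := by
  have h0 : (Real.sin rotAngle : ℂ) ≠ 0 := by exact_mod_cast sin_rotAngle_ne_zero
  have : (Complex.I * (Real.sin rotAngle : ℂ)) * (-Complex.I / (Real.sin rotAngle : ℂ)) = 1 := by
    field_simp
    simp
  rw [axisMatrix, smul_smul, this, cos_rotAngle, one_smul]
  abel

theorem eighthRoot_add_star : eighthRoot + eighthRoot ^ 7 = (Real.sqrt 2 : ℂ) := by
  rw [← star_eighthRoot, eighthRoot_eq]
  simp
  ring

/-- `rotMatrix` has determinant 1 and trace 2 cos θ, so the square of `rotMatrix` − cos θ is −sin² θ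
by the Cayley–Hamilton theorem; here this is checked on entries. -/
theorem axisMatrix_mul_self : axisMatrix * axisMatrix = 1 := by
  have h0 : (Real.sin rotAngle : ℂ) ≠ 0 := by exact_mod_cast sin_rotAngle_ne_zero
  have hs : (Real.sin rotAngle : ℂ) ^ 2 = 1 - (rotCos : ℂ) ^ 2 := by
    have := Real.sin_sq_add_cos_sq rotAngle
    rw [cos_rotAngle] at this
    rw [← Complex.ofReal_pow, ← Complex.ofReal_pow, ← Complex.ofReal_one, ← Complex.ofReal_sub]
    congr 1
    linarith
  have h8 : eighthRoot ^ 7 * eighthRoot = 1 := by rw [← pow_succ, eighthRoot_pow_eight]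
  have hadd := eighthRoot_add_star
  have hcos : (rotCos : ℂ) = (2 + (eighthRoot + eighthRoot ^ 7)) / 4 := by
    rw [hadd, rotCos]; push_cast; ring
  have hI : (-Complex.I / (Real.sin rotAngle : ℂ)) * (-Complex.I / (Real.sin rotAngle : ℂ)) =
      -1 / (1 - (rotCos : ℂ) ^ 2) := by
    rw [← hs, div_mul_div_comm]
    simp [pow_two]
  have hne : (1 : ℂ) - (rotCos : ℂ) ^ 2 ≠ 0 := by rw [← hs]; exact pow_ne_zero 2 h0
  have hsq : (rotMatrix - (rotCos : ℂ) • 1) * (rotMatrix - (rotCos : ℂ) • 1) =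
      ((rotCos : ℂ) ^ 2 - 1) • (1 : Matrix (Fin 2) (Fin 2) ℂ) := by
    rw [rotMatrix_eq, hcos]
    generalize eighthRoot ^ 7 = y at h8 ⊢
    ext i j
    fin_cases i <;> fin_cases j <;> simp [Matrix.mul_apply] <;>
      first | ring1 | linear_combination (-1/2) * h8
  rw [axisMatrix, Matrix.smul_mul, Matrix.mul_smul, smul_smul, hI, hsq, smul_smul]
  have : -1 / (1 - (rotCos : ℂ) ^ 2) * ((rotCos : ℂ) ^ 2 - 1) = 1 := by
    field_simp
    ring
  rw [this, one_smul]

/-- The matrix of the Pauli operator `Z`. -/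
def pauliZ : Matrix (Fin 2) (Fin 2) ℂ := !![1, 0; 0, -1]

/-- Averaging with the conjugate by Z removes the off-diagonal entries, and a traceless diagonal
matrix is a multiple of Z. The multiple is real and nonzero, so Z can be recovered from it. -/
theorem axisMatrix_add_conj : axisMatrix + pauliZ * axisMatrix * pauliZ =
    ((-(Real.sqrt 2 / 2) / Real.sin rotAngle : ℝ) : ℂ) • pauliZ := by
  have h0 : (Real.sin rotAngle : ℂ) ≠ 0 := by exact_mod_cast sin_rotAngle_ne_zero
  have h7 : eighthRoot ^ 7 = (Real.sqrt 2 / 2 : ℝ) - (Real.sqrt 2 / 2 : ℝ) * Complex.I := by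
    rw [← star_eighthRoot, eighthRoot_eq]
    simp
    ring
  have hI := Complex.I_mul_I
  have hX : rotMatrix - (rotCos : ℂ) • 1 = (1 / 2 : ℂ) •
      !![-(Real.sqrt 2 / 2 : ℝ) * Complex.I, eighthRoot ^ 7 - 1;
        1 - eighthRoot, (Real.sqrt 2 / 2 : ℝ) * Complex.I] := by
    rw [rotMatrix_eq, rotCos, h7, eighthRoot_eq]
    ext i j
    fin_cases i <;> fin_cases j <;> simp <;> ring
  have hZ : ∀ a b c d : ℂ, !![a, b; c, d] + pauliZ * !![a, b; c, d] * pauliZ =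
      (2 : ℂ) • !![a, 0; 0, d] := by
    intro a b c d
    ext i j
    fin_cases i <;> fin_cases j <;> simp [pauliZ] <;> ring
  rw [axisMatrix, hX, smul_smul, Matrix.mul_smul, Matrix.smul_mul, ← smul_add, hZ, smul_smul]
  ext i j
  have hc : ((Real.sin rotAngle : ℝ) : ℂ) = Complex.sin rotAngle := Complex.ofReal_sin _
  fin_cases i <;> fin_cases j <;> simp [pauliZ] <;> rw [hc] at h0 <;> field_simp <;>
    simp

/-! ### Stationarity at an overlap maximum -/

theorem hadamard_mem_circuits {m : ℕ} {j : ℤ} (h : 1 ≤ j ∧ j ≤ m) :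
    cellOp hadamardMatrix j ∈ circuits m := gateOp_mem_circuits (g := .hadamard) h

theorem phase_mem_circuits {m : ℕ} {j : ℤ} (h : 1 ≤ j ∧ j ≤ m) :
    cellOp phaseMatrix j ∈ circuits m := gateOp_mem_circuits (g := .phase) h

theorem pauliZ_mem_circuits {m : ℕ} {j : ℤ} (h : 1 ≤ j ∧ j ≤ m) :
    cellOp pauliZ j ∈ circuits m := by
  have := Submonoid.mul_mem _ (phase_mem_circuits h) (phase_mem_circuits h)
  rwa [cellOp_mul, phaseMatrix_pow_two] at this

theorem pauliZ_mul_self : pauliZ * pauliZ = 1 := by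
  ext i j
  fin_cases i <;> fin_cases j <;> simp [pauliZ]

/-- A state at which a linear functional has maximal modulus among the limits of prepared states. -/
def IsMaxOverlap (m : ℕ) (l : (Label → ℂ) →ₗ[ℂ] ℂ) (φ : Label → ℂ) : Prop :=
  φ ∈ closure (prepared m) ∧ ∀ ψ ∈ closure (prepared m), ‖l ψ‖ ≤ ‖l φ‖

/-- The first-order condition at a maximum of `|l φ|` along the directions conjugate to `B`. -/
def Stationary (m : ℕ) (l : (Label → ℂ) →ₗ[ℂ] ℂ) (φ : Label → ℂ)
    (B : Module.End ℂ (Label → ℂ)) : Prop :=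
  ∀ U ∈ circuits m, ∀ V ∈ circuits m, U * V = 1 → V * U = 1 → (star (l φ) * l (U (B (V φ)))).im = 0

section
variable {m : ℕ} {l : (Label → ℂ) →ₗ[ℂ] ℂ} {φ : Label → ℂ}

/-- As A² = 1, a power of cos t + i sin t · A is the same expression at a multiple of t. The phase μ
does not affect the norm, so A itself need not come from a circuit. -/
theorem IsMaxOverlap.norm_le_of_mem_circuits (hφ : IsMaxOverlap m l φ)
    {A U V : Module.End ℂ (Label → ℂ)} (hA : A * A = 1) {μ : ℂ} (hμ : ‖μ‖ = 1) {t : ℝ}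
    (hW : μ • ((Real.cos t : ℂ) • (1 : Module.End ℂ (Label → ℂ)) +
      (Complex.I * (Real.sin t : ℂ)) • A) ∈ circuits m)
    (hU : U ∈ circuits m) (hV : V ∈ circuits m) (hUV : U * V = 1) (k : ℕ) :
    ‖(Real.cos (k * t) : ℂ) * l φ + Complex.I * (Real.sin (k * t) : ℂ) * l (U (A (V φ)))‖ ≤
      ‖l φ‖ := by
  have hpow : ((Real.cos t : ℂ) • (1 : Module.End ℂ (Label → ℂ)) +
      (Complex.I * (Real.sin t : ℂ)) • A) ^ k = (Real.cos (k * t) : ℂ) • 1 +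
      (Complex.I * (Real.sin (k * t) : ℂ)) • A := by
    induction k with
    | zero => simp
    | succ k ih =>
      have h1 : ((k + 1 : ℕ) : ℝ) * t = k * t + t := by push_cast; ring
      rw [pow_succ, ih, h1, Real.cos_add, Real.sin_add]
      simp only [add_mul, mul_add, smul_mul_assoc, mul_smul_comm, hA, one_mul, mul_one]
      have hI := Complex.I_mul_I
      push_cast
      match_scalars
      · linear_combination (Complex.sin (k * t) * Complex.sin t) * hI
      · ring
  have hmem := hφ.2 _ (map_mem_closure_prepared
    (Submonoid.mul_mem _ (Submonoid.mul_mem _ hU (Submonoid.pow_mem _ hW k)) hV) hφ.1)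
  have hUVφ : U (V φ) = φ := by
    rw [← Module.End.mul_apply, hUV, Module.End.one_apply]
  rw [smul_pow, hpow] at hmem
  simp only [Module.End.mul_apply, LinearMap.smul_apply, LinearMap.add_apply,
    Module.End.one_apply, map_smul, map_add, hUVφ, smul_eq_mul, norm_mul, norm_pow, hμ, one_pow,
    one_mul] at hmem
  exact hmem

/-- The powers of THTH and of its inverse circuit supply all integer multiples of the angle. The
inverse is recognized as the rotation through the opposite angle by uniqueness of inverses. -/
theorem IsMaxOverlap.stationary_axis (hφ : IsMaxOverlap m l φ) (hm : 1 ≤ m) :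
    Stationary m l φ (cellOp axisMatrix 1) := by
  intro U hU V hV hUV _
  have hr : (1 : ℤ) ≤ 1 ∧ (1 : ℤ) ≤ m := ⟨le_rfl, by exact_mod_cast hm⟩
  set A := cellOp axisMatrix 1
  have hA : A * A = 1 := by rw [cellOp_mul, axisMatrix_mul_self, cellOp_one]
  have h8 : eighthRoot * eighthRoot ^ 7 = 1 := by rw [← pow_succ', eighthRoot_pow_eight]
  have hnorm : ‖eighthRoot‖ = 1 := by
    have := congrArg norm eighthRoot_pow_eight
    rw [norm_pow, norm_one] at this
    exact (pow_eq_one_iff_of_nonneg (norm_nonneg _) (by norm_num)).1 this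
  have hWeq : cellOp (piEighthMatrix * hadamardMatrix * (piEighthMatrix * hadamardMatrix)) 1 =
      eighthRoot • ((Real.cos rotAngle : ℂ) • (1 : Module.End ℂ (Label → ℂ)) +
        (Complex.I * (Real.sin rotAngle : ℂ)) • A) := by
    rw [← cellOp_one 1, ← cellOp_smul, ← cellOp_smul, ← cellOp_add, ← cellOp_smul,
      ← rotMatrix_eq_axis, rotMatrix, smul_smul, h8, one_smul]
  have hT : cellOp piEighthMatrix 1 ∈ circuits m := gateOp_mem_circuits (g := .piEighth) hr
  have hTH := Submonoid.mul_mem _ hT (hadamard_mem_circuits hr)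
  have hW := Submonoid.mul_mem _ hTH hTH
  simp only [cellOp_mul] at hW
  rw [hWeq] at hW
  obtain ⟨W', hW', h1, h2⟩ := exists_inverse hW
  have hW'eq : W' = eighthRoot ^ 7 • ((Real.cos (-rotAngle) : ℂ) • (1 : Module.End ℂ (Label → ℂ)) +
      (Complex.I * (Real.sin (-rotAngle) : ℂ)) • A) := by
    refine left_inv_eq_right_inv h2 ?_
    have hcs := Complex.cos_sq_add_sin_sq rotAngle
    rw [smul_mul_smul_comm, h8, one_smul]
    simp only [add_mul, mul_add, smul_mul_assoc, mul_smul_comm, hA, one_mul, mul_one,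
      Real.cos_neg, Real.sin_neg]
    push_cast
    match_scalars
    · linear_combination hcs - (Complex.sin rotAngle) ^ 2 * Complex.I_sq
    · ring
  rw [hW'eq] at hW'
  refine im_star_mul_eq_zero_of_forall_norm_le fun k => ?_
  rcases Int.eq_nat_or_neg k with ⟨k, rfl | rfl⟩
  · have := hφ.norm_le_of_mem_circuits hA hnorm hW hU hV hUV k
    simpa using this
  · have := hφ.norm_le_of_mem_circuits hA (by rw [norm_pow, hnorm, one_pow]) hW' hU hV hUV k
    simpa using this

theorem Stationary.add {B C : Module.End ℂ (Label → ℂ)} (hB : Stationary m l φ B)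
    (hC : Stationary m l φ C) : Stationary m l φ (B + C) := by
  intro U hU V hV h1 h2
  rw [LinearMap.add_apply, map_add, map_add, mul_add, Complex.add_im, hB U hU V hV h1 h2,
    hC U hU V hV h1 h2, add_zero]

/-- The scalar has to be real, because the condition concerns an imaginary part. -/
theorem Stationary.smul {B : Module.End ℂ (Label → ℂ)} (hB : Stationary m l φ B) (r : ℝ) :
    Stationary m l φ ((r : ℂ) • B) := by
  intro U hU V hV h1 h2
  rw [LinearMap.smul_apply, map_smul, map_smul, smul_eq_mul, mul_left_comm, Complex.im_ofReal_mul,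
    hB U hU V hV h1 h2, mul_zero]

/-- `Stationary` quantifies over all mutually inverse circuits precisely so that a conjugation can
be absorbed into them. -/
theorem Stationary.conj {B G G' : Module.End ℂ (Label → ℂ)} (hB : Stationary m l φ B)
    (hG : G ∈ circuits m) (hG' : G' ∈ circuits m) (h1 : G * G' = 1) (h2 : G' * G = 1) :
    Stationary m l φ (G * B * G') := by
  intro U hU V hV h3 h4
  refine hB (U * G) (Submonoid.mul_mem _ hU hG) (G' * V) (Submonoid.mul_mem _ hG' hV) ?_ ?_
  · calc U * G * (G' * V) = U * (G * G') * V := by simp only [mul_assoc]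
      _ = 1 := by rw [h1, mul_one, h3]
  · calc G' * V * (U * G) = G' * (V * U) * G := by simp only [mul_assoc]
      _ = 1 := by rw [h4, mul_one, h2]

/-- The number in question is then |l φ|². -/
theorem stationary_one : Stationary m l φ 1 := by
  intro U hU V hV h1 h2
  rw [Module.End.one_apply, ← Module.End.mul_apply, h1, Module.End.one_apply]
  simp
  ring

theorem IsMaxOverlap.stationary_pauliZ (hφ : IsMaxOverlap m l φ) (hm : 1 ≤ m) :
    Stationary m l φ (cellOp pauliZ 1) := by
  have hr : (1 : ℤ) ≤ 1 ∧ (1 : ℤ) ≤ m := ⟨le_rfl, by exact_mod_cast hm⟩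
  have h1 := hφ.stationary_axis hm
  have hZZ : cellOp pauliZ 1 * cellOp pauliZ 1 = 1 := by
    rw [cellOp_mul, pauliZ_mul_self, cellOp_one]
  have h2 := h1.add (h1.conj (pauliZ_mem_circuits hr) (pauliZ_mem_circuits hr) hZZ hZZ)
  rw [cellOp_mul, cellOp_mul, ← cellOp_add, axisMatrix_add_conj, cellOp_smul] at h2
  have h3 := h2.smul (-(Real.sqrt 2 / 2) / Real.sin rotAngle)⁻¹
  rw [smul_smul, ← Complex.ofReal_mul, inv_mul_cancel₀, Complex.ofReal_one, one_smul] at h3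
  · exact h3
  · exact div_ne_zero (neg_ne_zero.2 (by positivity)) sin_rotAngle_ne_zero

/-- The diagonal operator with diagonal `d`. -/
def diagOp (d : Label → ℂ) : Module.End ℂ (Label → ℂ) where
  toFun ψ e := d e * ψ e
  map_add' ψ φ := by funext e; simp [mul_add]
  map_smul' c ψ := by funext e; simp; ring

/-- The sign of a bit. -/
def bitSign (b : Fin 2) : ℂ := if b = 0 then 1 else -1

open Classical in
/-- The indicator function of the labels with bits `0` in the cells `1, …, k`. -/
def zerosUpTo (k : ℕ) (e : Label) : ℂ := if ∀ j : ℤ, 1 ≤ j → j ≤ k → e j = 0 then 1 else 0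

theorem zerosUpTo_succ (k : ℕ) (e : Label) :
    zerosUpTo (k + 1) e = (1 / 2) * (zerosUpTo k e + zerosUpTo k e * bitSign (e (k + 1))) := by
  have : (∀ j : ℤ, 1 ≤ j → j ≤ ((k + 1 : ℕ) : ℤ) → e j = 0) ↔
      (∀ j : ℤ, 1 ≤ j → j ≤ k → e j = 0) ∧ e (k + 1) = 0 := by
    constructor
    · intro h
      exact ⟨fun j h1 h2 => h j h1 (by push_cast; omega), h _ (by omega) (by push_cast; omega)⟩
    · rintro ⟨h1, h2⟩ j h3 h4
      push_cast at h4
      by_cases h5 : j = k + 1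
      · rw [h5, h2]
      · exact h1 j h3 (by omega)
  unfold zerosUpTo bitSign
  rw [if_congr this rfl rfl]
  by_cases h1 : ∀ j : ℤ, 1 ≤ j → j ≤ k → e j = 0
  · rw [if_pos h1]
    by_cases h2 : e (k + 1) = 0
    · rw [if_pos ⟨h1, h2⟩, if_pos h2]; norm_num
    · rw [if_neg fun h => h2 h.2, if_neg h2]; norm_num
  · rw [if_neg h1, if_neg fun h => h1 h.1]; norm_num

theorem zerosUpTo_setPair {k : ℕ} {h : ℤ} (hk : k < h) (e : Label) (p : Fin 2 × Fin 2) :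
    zerosUpTo k (setPair h e p) = zerosUpTo k e := by
  have : ∀ j : ℤ, j ≤ k → setPair h e p j = e j := fun j hj =>
    setPair_apply_of_ne _ _ (by omega) (by omega)
  unfold zerosUpTo
  congr 1
  refine propext (forall_congr' fun j => forall_congr' fun _ => forall_congr' fun hj => ?_)
  rw [this j hj]

/-- Write s(j) for the sign of the bit in cell j. From the projector onto k zeros times s(k + 1),
conjugation by a swap gives that projector times s(k + 2), and conjugation by a cnot gives it times
s(k + 1) s(k + 2). Half their sum contains (1 + s(k + 1))/2, the condition that one more bit is 0.
-/
theorem IsMaxOverlap.stationary_zerosUpTo_mul (hφ : IsMaxOverlap m l φ) {k : ℕ} (hk : k + 1 ≤ m) :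
    Stationary m l φ (diagOp fun e => zerosUpTo k e * bitSign (e (k + 1))) := by
  induction k with
  | zero =>
    have := hφ.stationary_pauliZ hk
    convert this using 1
    refine LinearMap.ext fun ψ => funext fun e => ?_
    have h0 : zerosUpTo 0 e = 1 := if_pos fun j h1 h2 => by push_cast at h2; omega
    rw [cellOp_apply]
    simp only [diagOp, LinearMap.coe_mk, AddHom.coe_mk, h0, one_mul, Fin.sum_univ_two]
    have : e 1 = 0 ∨ e 1 = 1 := by omega
    have hu : Function.update e 1 (e 1) = e := Function.update_eq_self _ _
    rcases this with h | h <;> rw [h] at hu <;> simp [pauliZ, bitSign, h, hu]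
  | succ k ih =>
    have ih := ih (by omega)
    set h : ℤ := (k : ℤ) + 1 with hh
    have hr : 1 ≤ h ∧ h + 1 ≤ m := by
      constructor
      · omega
      · have : ((k + 1 + 1 : ℕ) : ℤ) ≤ m := by exact_mod_cast hk
        push_cast at this; omega
    have hS : gateOp .swap h ∈ circuits m := gateOp_mem_circuits (g := .swap) hr
    have hC : gateOp .cnot h ∈ circuits m := gateOp_mem_circuits (g := .cnot) hr
    have hsp : ∀ (e : Label) (p : Fin 2 × Fin 2), setPair h e p h = p.1 ∧
        setPair h e p (h + 1) = p.2 := fun e p => by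
      have := pairAt_setPair h e p
      exact ⟨congrArg Prod.fst this, congrArg Prod.snd this⟩
    have hself : ∀ e : Label, setPair h e (e h, e (h + 1)) = e := setPair_pairAt h
    -- The cnot with its control in the cell `h + 1` and its target in `h`.
    set G := gateOp .swap h * gateOp .cnot h * gateOp .swap h
    have hG : G ∈ circuits m := Submonoid.mul_mem _ (Submonoid.mul_mem _ hS hC) hS
    have hGapp : ∀ ψ e, G ψ e = ψ (setPair h e (e (h + 1) + e h, e (h + 1))) := by
      intro ψ e
      simp only [G, Module.End.mul_apply]
      rw [gateOp_swap_apply, gateOp_cnot_apply, gateOp_swap_apply]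
      simp only [setPair_setPair, (hsp _ _).1, (hsp _ _).2]
    have hSS : gateOp .swap h * gateOp .swap h = 1 := by
      refine LinearMap.ext fun ψ => funext fun e => ?_
      rw [Module.End.mul_apply, gateOp_swap_apply, gateOp_swap_apply]
      simp only [setPair_setPair, (hsp _ _).1, (hsp _ _).2, hself]
      rfl
    have h2 : ∀ a b : Fin 2, a + (a + b) = b := by decide
    have hGG : G * G = 1 := by
      refine LinearMap.ext fun ψ => funext fun e => ?_
      rw [Module.End.mul_apply, hGapp, hGapp]
      simp only [setPair_setPair, (hsp _ _).1, (hsp _ _).2, h2, hself]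
      rfl
    have h3 := ((ih.conj hS hS hSS hSS).add (ih.conj hG hG hGG hGG)).smul (1 / 2)
    convert h3 using 1
    refine LinearMap.ext fun ψ => funext fun e => ?_
    simp only [LinearMap.smul_apply, LinearMap.add_apply, Module.End.mul_apply, Pi.add_apply,
      Pi.smul_apply, gateOp_swap_apply, hGapp]
    simp only [diagOp, LinearMap.coe_mk, AddHom.coe_mk, gateOp_swap_apply, hGapp,
      setPair_setPair, (hsp _ _).1, (hsp _ _).2, hself, h2,
      zerosUpTo_setPair (show (k : ℤ) < h by omega), zerosUpTo_succ]
    rw [show ((k + 1 : ℕ) : ℤ) + 1 = h + 1 by push_cast; rfl, ← hh]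
    have hb : bitSign (e (h + 1) + e h) = bitSign (e (h + 1)) * bitSign (e h) := by
      generalize e (h + 1) = a
      generalize e h = b
      fin_cases a <;> fin_cases b <;> simp [bitSign]
    rw [hb]
    push_cast
    simp only [smul_eq_mul]
    ring

/-- For `k = m` the operator acts on states in the window as the projector onto the vacuum. -/
theorem IsMaxOverlap.stationary_zerosUpTo (hφ : IsMaxOverlap m l φ) {k : ℕ} (hk : k ≤ m) :
    Stationary m l φ (diagOp (zerosUpTo k)) := by
  induction k with
  | zero =>
    convert stationary_one using 1
    refine LinearMap.ext fun ψ => funext fun e => ?_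
    have h0 : zerosUpTo 0 e = 1 := if_pos fun j h1 h2 => by push_cast at h2; omega
    simp [diagOp, h0]
  | succ k ih =>
    have h3 := ((ih (by omega)).add (hφ.stationary_zerosUpTo_mul hk)).smul (1 / 2)
    convert h3 using 1
    refine LinearMap.ext fun ψ => funext fun e => ?_
    simp only [LinearMap.smul_apply, LinearMap.add_apply, Pi.add_apply, Pi.smul_apply]
    simp only [diagOp, LinearMap.coe_mk, AddHom.coe_mk, zerosUpTo_succ, smul_eq_mul]
    push_cast
    ring

/-- This is stationarity along U |0⟩⟨0| V. Since V inverts U, the amplitude `V φ 0` plays the role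
of the inner product of the prepared state U |0⟩ with φ. -/
theorem IsMaxOverlap.im_eq_zero (hφ : IsMaxOverlap m l φ) {U V : Module.End ℂ (Label → ℂ)}
    (hU : U ∈ circuits m) (hV : V ∈ circuits m) (h1 : U * V = 1) (h2 : V * U = 1) :
    (star (l φ) * V φ 0 * l (U vacuum)).im = 0 := by
  have h := hφ.stationary_zerosUpTo le_rfl U hU V hV h1 h2
  have hVφ := (inWindow_and_norm_of_mem_closure (map_mem_closure_prepared hV hφ.1)).1
  have hP : diagOp (zerosUpTo m) (V φ) = V φ 0 • vacuum := by
    funext e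
    simp only [diagOp, LinearMap.coe_mk, AddHom.coe_mk, Pi.smul_apply, vacuum, ket, smul_eq_mul]
    by_cases he : e = 0
    · subst he
      simp [zerosUpTo]
    · rw [if_neg he, mul_zero]
      by_cases hz : ∀ j : ℤ, 1 ≤ j → j ≤ m → e j = 0
      · obtain ⟨j, hj⟩ := Function.ne_iff.1 he
        rw [hVφ e j (fun h => hj (hz j h.1 h.2)) hj, mul_zero]
      · rw [zerosUpTo, if_neg hz, zero_mul]
  rw [hP, map_smul, map_smul, smul_eq_mul, ← mul_assoc] at h
  exact h

end

end

/-! ### Density of the prepared states among all states -/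

noncomputable section

open Filter Topology

/-! ### Bit flips -/

/-- The operator that adds the label `x` to the argument. -/
def translateOp (x : Label) : Module.End ℂ (Label → ℂ) where
  toFun ψ e := ψ (e + x)
  map_add' _ _ := rfl
  map_smul' _ _ := rfl

@[simp] theorem translateOp_apply (x : Label) (ψ : Label → ℂ) (e : Label) :
    translateOp x ψ e = ψ (e + x) := rfl

theorem label_add_self (x : Label) : x + x = 0 := by
  have : ∀ a : Fin 2, a + a = 0 := by decide
  funext j; exact this (x j)

theorem translateOp_mul_self (x : Label) : translateOp x * translateOp x = 1 := by
  refine LinearMap.ext fun ψ => funext fun e => ?_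
  simp [add_assoc, label_add_self]

theorem translateOp_ket (x y : Label) : translateOp x (ket y) = ket (y + x) := by
  funext e
  have : e + x = y ↔ e = y + x := by
    constructor <;> rintro rfl <;> simp [add_assoc, label_add_self]
  by_cases h : e + x = y
  · rw [translateOp_apply, ket, ket, if_pos h, if_pos (this.1 h)]
  · rw [translateOp_apply, ket, ket, if_neg h, if_neg (mt this.2 h)]

/-- The bit flip is HZH, and Z is the square of the phase gate. -/
theorem translateOp_single_mem_circuits {m : ℕ} {j : ℤ} (hj : 1 ≤ j ∧ j ≤ m) (b : Fin 2) :
    translateOp (Pi.single j b) ∈ circuits m := by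
  have hb : b = 0 ∨ b = 1 := by omega
  rcases hb with rfl | rfl
  · convert Submonoid.one_mem (circuits m) using 1
    refine LinearMap.ext fun ψ => funext fun e => ?_
    simp
  · have h := Submonoid.mul_mem _ (Submonoid.mul_mem _ (hadamard_mem_circuits hj)
      (pauliZ_mem_circuits hj)) (hadamard_mem_circuits hj)
    have hflip : hadamardMatrix * pauliZ * hadamardMatrix = !![0, 1; 1, 0] := by
      have hs := invSqrtTwo_mul_self
      ext i k
      fin_cases i <;> fin_cases k <;>
        simp [hadamardMatrix, pauliZ, Matrix.mul_apply] <;> linear_combination 2 * hs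
    rw [cellOp_mul, cellOp_mul, hflip] at h
    convert h using 1
    refine LinearMap.ext fun ψ => funext fun e => ?_
    have hupd : e + Pi.single j 1 = Function.update e j (e j + 1) := by
      funext i
      by_cases hi : i = j
      · subst hi; simp
      · simp [hi]
    rw [translateOp_apply, hupd, cellOp_apply, Fin.sum_univ_two]
    have : e j = 0 ∨ e j = 1 := by omega
    rcases this with h | h <;> simp [h]

theorem sum_single_eq_windowLabel {m : ℕ} (x : Fin m → Fin 2) :
    ∑ i : Fin m, Pi.single ((i : ℤ) + 1) (x i) = windowLabel x := by
  funext j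
  rw [Finset.sum_apply]
  by_cases hj : 1 ≤ j ∧ j ≤ m
  · have hlt : (j - 1).toNat < m := by omega
    have hj' : (((⟨(j - 1).toNat, hlt⟩ : Fin m) : ℕ) : ℤ) + 1 = j := by simp; omega
    rw [Finset.sum_eq_single ⟨(j - 1).toNat, hlt⟩]
    · rw [hj', Pi.single_eq_same]
      conv_rhs => rw [← hj']
      rw [windowLabel_apply]
    · intro i _ hi
      refine Pi.single_eq_of_ne ?_ _
      intro h
      apply hi
      ext
      simp
      omega
    · simp
  · rw [windowLabel_apply_of_not _ hj]
    refine Finset.sum_eq_zero fun i _ => Pi.single_eq_of_ne ?_ _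
    intro h
    apply hj
    omega

/-- Labels in the window are reached from `0` by flipping bits in the window. -/
theorem windowLabel_induction {m : ℕ} {p : Label → Prop} (h0 : p 0)
    (hadd : ∀ x y, p x → p y → p (x + y))
    (hsingle : ∀ j : ℤ, 1 ≤ j ∧ j ≤ m → ∀ b : Fin 2, p (Pi.single j b)) (x : Fin m → Fin 2) :
    p (windowLabel x) := by
  rw [← sum_single_eq_windowLabel]
  refine Finset.sum_induction _ p hadd h0 fun i _ => hsingle _ (by omega) _

theorem translateOp_windowLabel_mem_circuits {m : ℕ} (x : Fin m → Fin 2) :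
    translateOp (windowLabel x) ∈ circuits m := by
  refine windowLabel_induction (p := fun x => translateOp x ∈ circuits m) ?_ ?_ ?_ x
  · convert Submonoid.one_mem (circuits m) using 1
    refine LinearMap.ext fun ψ => funext fun e => ?_
    simp
  · intro x y hx hy
    convert Submonoid.mul_mem _ hx hy using 1
    refine LinearMap.ext fun ψ => funext fun e => ?_
    simp [add_assoc]
  · exact fun j hj b => translateOp_single_mem_circuits hj b

/-! ### Overlap maxima are proportional to the target -/

/-- The first two conditions give u = r · conj v and u' = r' · conj v' with real r, r'. The other
two say that (r − r') times the imaginary and the real part of conj v · v' vanishes, and this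
product is nonzero. -/
theorem cross_eq_of_im_eq_zero {u v u' v' : ℂ} (hv : v ≠ 0) (hv' : v' ≠ 0)
    (h1 : (u * v).im = 0) (h2 : (u' * v').im = 0) (h3 : ((u + u') * (v + v')).im = 0)
    (h4 : ((u - Complex.I * u') * (v + Complex.I * v')).im = 0) :
    u / star v = u' / star v' := by
  have real : ∀ u v : ℂ, v ≠ 0 → (u * v).im = 0 → ∃ r : ℝ, u / star v = r ∧ u = r * star v := by
    intro u v hv h
    have hs : star v ≠ 0 := by simpa using hv
    have hn : v * star v = ((Complex.normSq v : ℝ) : ℂ) := Complex.mul_conj v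
    have hn0 : (Complex.normSq v : ℂ) ≠ 0 := by
      exact_mod_cast (Complex.normSq_pos.2 hv).ne'
    have huv : u * v = ((u * v).re : ℂ) := by
      refine Complex.ext (by simp) ?_
      rw [h, Complex.ofReal_im]
    refine ⟨(u * v).re / Complex.normSq v, ?_, ?_⟩
    · rw [div_eq_iff hs]
      push_cast
      rw [← huv, ← hn]
      field_simp
    · push_cast
      rw [← huv, ← hn]
      field_simp
  obtain ⟨r, hr, rfl⟩ := real u v hv h1
  obtain ⟨r', hr', rfl⟩ := real u' v' hv' h2
  rw [hr, hr']
  simp at h3 h4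
  have e1 : (r - r') * (v.re * v'.im - v.im * v'.re) = 0 := by linear_combination h3
  have e2 : (r - r') * (v.re * v'.re + v.im * v'.im) = 0 := by linear_combination h4
  by_contra hne
  have hne' : r - r' ≠ 0 := fun h => hne (by rw [sub_eq_zero.1 h])
  have e3 := (mul_eq_zero.1 e1).resolve_left hne'
  have e4 := (mul_eq_zero.1 e2).resolve_left hne'
  have e5 : (v.re ^ 2 + v.im ^ 2) * (v'.re ^ 2 + v'.im ^ 2) = 0 := by
    linear_combination (v.re * v'.im - v.im * v'.re) * e3 + (v.re * v'.re + v.im * v'.im) * e4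
  have pos : ∀ z : ℂ, z ≠ 0 → z.re ^ 2 + z.im ^ 2 ≠ 0 := by
    intro z hz h
    apply hz
    have h1 : z.re = 0 := by nlinarith [sq_nonneg z.re, sq_nonneg z.im]
    have h2 : z.im = 0 := by nlinarith [sq_nonneg z.re, sq_nonneg z.im]
    exact Complex.ext h1 h2
  exact (mul_ne_zero (pos v hv) (pos v' hv')) e5

/-- The inner product with the vector that has the amplitudes `Ψ` in the window. -/
def overlap {m : ℕ} (Ψ : (Fin m → Fin 2) → ℂ) : (Label → ℂ) →ₗ[ℂ] ℂ where
  toFun φ := ∑ x, star (Ψ x) * φ (windowLabel x)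
  map_add' φ ψ := by simp [mul_add, Finset.sum_add_distrib]
  map_smul' c φ := by
    simp only [Pi.smul_apply, smul_eq_mul, RingHom.id_apply, Finset.mul_sum]
    exact Finset.sum_congr rfl fun x _ => by ring

theorem overlap_apply {m : ℕ} (Ψ : (Fin m → Fin 2) → ℂ) (φ : Label → ℂ) :
    overlap Ψ φ = ∑ x, star (Ψ x) * φ (windowLabel x) := rfl

theorem overlap_ket {m : ℕ} (Ψ : (Fin m → Fin 2) → ℂ) (x : Fin m → Fin 2) :
    overlap Ψ (ket (windowLabel x)) = star (Ψ x) := by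
  rw [overlap_apply, Finset.sum_eq_single x]
  · simp [ket]
  · intro y _ hy
    simp [ket, (windowLabel_injective m).eq_iff, hy]
  · simp

theorem cellOp_ket {j : ℤ} {e : Label} (he : e j = 0) (A : Matrix (Fin 2) (Fin 2) ℂ) :
    cellOp A j (ket e) = A 0 0 • ket e + A 1 0 • ket (e + Pi.single j 1) := by
  funext f
  have hne : e ≠ e + Pi.single j 1 := by
    intro h
    have := congrFun h j
    simp [he] at this
  have h1 : e + Pi.single j 1 = Function.update e j 1 := by
    funext i
    by_cases hi : i = j
    · subst hi; simp [he]
    · simp [hi]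
  have k1 : Function.update f j 1 ≠ e := by
    rintro rfl; simp at he
  have hf : f j = 0 ∨ f j = 1 := by omega
  rw [cellOp_apply, Fin.sum_univ_two]
  simp only [ket, Pi.add_apply, Pi.smul_apply, smul_eq_mul, if_neg k1, mul_zero, add_zero, h1]
  rcases hf with h | h
  · have k2 : Function.update f j 0 = e ↔ f = e := by rw [← h, Function.update_eq_self]
    have k3 : f ≠ Function.update e j 1 := by rintro rfl; simp at h
    rw [if_neg k3, mul_zero, add_zero, h]
    by_cases hfe : f = e
    · rw [if_pos hfe, if_pos (k2.2 hfe)]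
    · rw [if_neg hfe, if_neg (mt k2.1 hfe)]
  · have k2 : Function.update f j 0 = e ↔ f = Function.update e j 1 := by
      constructor
      · rintro rfl; rw [Function.update_idem, ← h, Function.update_eq_self]
      · rintro rfl; rw [Function.update_idem, ← he, Function.update_eq_self]
    have k3 : f ≠ e := by rintro rfl; simp [he] at h
    rw [if_neg k3, mul_zero, zero_add, h]
    by_cases hfe : f = Function.update e j 1
    · rw [if_pos hfe, if_pos (k2.2 hfe)]
    · rw [if_neg hfe, if_neg (mt k2.1 hfe)]

/-- A maximizer φ of the overlap exists by compactness, and the maximum is positive because basis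
kets are prepared. `IsMaxOverlap.im_eq_zero` shows that the quotient of φ by Ψ does not change when
one bit is flipped, and flips connect all labels. Nonvanishing amplitudes keep every quotient
meaningful. -/
theorem exists_closure_prepared_proportional {m : ℕ} (Ψ : (Fin m → Fin 2) → ℂ)
    (hΨ : ∀ x, Ψ x ≠ 0) :
    ∃ φ ∈ closure (prepared m), ∃ c : ℂ, ∀ x, φ (windowLabel x) = c * Ψ x := by
  set l := overlap Ψ
  have hcont : Continuous fun φ => ‖l φ‖ := by
    simp only [l, overlap_apply]
    fun_prop
  have hprep : ∀ x : Fin m → Fin 2, ket (windowLabel x) ∈ closure (prepared m) := fun x =>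
    subset_closure ⟨translateOp (windowLabel x), translateOp_windowLabel_mem_circuits x, by
      rw [vacuum, translateOp_ket, zero_add]⟩
  obtain ⟨φ, hφK, hmax⟩ := (isCompact_closure_prepared m).exists_isMaxOn
    ⟨_, hprep 0⟩ hcont.continuousOn
  have hφ : IsMaxOverlap m l φ := ⟨hφK, fun ψ hψ => hmax hψ⟩
  set β := star (l φ)
  have hβ : β ≠ 0 := by
    intro h0
    have h1 := hφ.2 _ (hprep 0)
    have h2 : l φ = 0 := by simpa [β] using h0
    rw [h2, norm_zero] at h1
    have h3 : l (ket (windowLabel 0)) = 0 := norm_le_zero_iff.1 h1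
    rw [overlap_ket] at h3
    exact hΨ 0 (by simpa using h3)
  -- The reality condition for the state A|x⟩, prepared by flipping the vacuum to x and then
  -- applying A in the cell `j`.
  have cell : ∀ (A B : Matrix (Fin 2) (Fin 2) ℂ) (j : ℤ) (x : Fin m → Fin 2),
      cellOp A j ∈ circuits m → cellOp B j ∈ circuits m → A * B = 1 → B * A = 1 →
      windowLabel x j = 0 →
      (β * (B 0 0 * φ (windowLabel x) + B 0 1 * φ (windowLabel x + Pi.single j 1)) *
        (A 0 0 * l (ket (windowLabel x)) +
          A 1 0 * l (ket (windowLabel x + Pi.single j 1)))).im = 0 := by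
    intro A B j x hA hB hAB hBA hx
    have hT := translateOp_windowLabel_mem_circuits x
    have h := hφ.im_eq_zero (Submonoid.mul_mem _ hA hT) (Submonoid.mul_mem _ hT hB)
      (by
        calc cellOp A j * translateOp (windowLabel x) * (translateOp (windowLabel x) * cellOp B j)
            = cellOp A j * (translateOp (windowLabel x) * translateOp (windowLabel x)) *
              cellOp B j := by simp only [mul_assoc]
          _ = 1 := by rw [translateOp_mul_self, mul_one, cellOp_mul, hAB, cellOp_one])
      (by
        calc translateOp (windowLabel x) * cellOp B j * (cellOp A j * translateOp (windowLabel x))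
            = translateOp (windowLabel x) * (cellOp B j * cellOp A j) *
              translateOp (windowLabel x) := by simp only [mul_assoc]
          _ = 1 := by rw [cellOp_mul, hBA, cellOp_one, mul_one, translateOp_mul_self])
    have h0 : Function.update (windowLabel x) j 0 = windowLabel x := by
      rw [← hx, Function.update_eq_self]
    have h1 : Function.update (windowLabel x) j 1 = windowLabel x + Pi.single j 1 := by
      funext i
      by_cases hi : i = j
      · subst hi; simp [hx]
      · simp [hi]
    rw [Module.End.mul_apply, Module.End.mul_apply, translateOp_apply, zero_add, cellOp_apply,
      Fin.sum_univ_two, hx, h0, h1, vacuum, translateOp_ket, zero_add, cellOp_ket hx, map_add,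
      map_smul, map_smul] at h
    exact h
  have hreal : ∀ x : Fin m → Fin 2,
      (β * φ (windowLabel x) * l (ket (windowLabel x))).im = 0 := by
    intro x
    have hT := translateOp_windowLabel_mem_circuits x
    have h := hφ.im_eq_zero hT hT (translateOp_mul_self _) (translateOp_mul_self _)
    rwa [translateOp_apply, zero_add, vacuum, translateOp_ket, zero_add] at h
  have hflip : ∀ (x : Fin m → Fin 2) (j : ℤ), 1 ≤ j ∧ j ≤ m →
      ∃ y : Fin m → Fin 2, windowLabel x + Pi.single j 1 = windowLabel y := by
    intro x j hj
    refine ⟨_, eq_windowLabel fun i hi => ?_⟩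
    have : i ≠ j := by rintro rfl; exact hi hj
    simp [windowLabel_apply_of_not _ hi, this]
  -- On the window the denominator is the amplitude of Ψ, so constancy of `r` is the desired
  -- proportionality.
  set r : Label → ℂ := fun e => β * φ e / star (l (ket e)) with hrdef
  have hstep0 : ∀ (x : Fin m → Fin 2) (j : ℤ), 1 ≤ j ∧ j ≤ m → windowLabel x j = 0 →
      r (windowLabel x + Pi.single j 1) = r (windowLabel x) := by
    intro x j hj hx
    obtain ⟨y, hy⟩ := hflip x j hj
    have hne : ∀ z : Fin m → Fin 2, l (ket (windowLabel z)) ≠ 0 := by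
      intro z; rw [overlap_ket]; simpa using hΨ z
    have hs := invSqrtTwo_mul_self
    have hs2 : ∀ z : ℂ, (1 / 2 * z).im = 0 → z.im = 0 := by
      intro z hz
      have : (1 / 2 : ℂ) = ((1 / 2 : ℝ) : ℂ) := by push_cast; rfl
      rw [this, Complex.im_ofReal_mul] at hz
      linarith
    have hH := hadamard_mem_circuits hj
    have hP := phase_mem_circuits hj
    have h3 := cell _ _ j x hH hH hadamardMatrix_mul_self hadamardMatrix_mul_self hx
    -- This operator prepares |x⟩ + i|y⟩ up to normalization. Its inverse is H Z S, since Z S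
    -- inverts S.
    have hA : cellOp (phaseMatrix * hadamardMatrix) j ∈ circuits m := by
      rw [← cellOp_mul]; exact Submonoid.mul_mem _ hP hH
    have hB : cellOp (hadamardMatrix * (pauliZ * phaseMatrix)) j ∈ circuits m := by
      rw [← cellOp_mul, ← cellOp_mul]
      exact Submonoid.mul_mem _ hH (Submonoid.mul_mem _ (pauliZ_mem_circuits hj) hP)
    have hPZ : phaseMatrix * (pauliZ * phaseMatrix) = 1 := by
      ext i k
      fin_cases i <;> fin_cases k <;> simp [phaseMatrix, pauliZ]
    have hZP : pauliZ * phaseMatrix * phaseMatrix = 1 := by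
      rw [mul_assoc, phaseMatrix_pow_two]; exact pauliZ_mul_self
    have h4 := cell _ _ j x hA hB
      (by rw [mul_assoc, ← mul_assoc hadamardMatrix, hadamardMatrix_mul_self, one_mul, hPZ])
      (by rw [mul_assoc, ← mul_assoc (pauliZ * phaseMatrix), hZP, one_mul,
        hadamardMatrix_mul_self]) hx
    rw [hy] at h3 h4 ⊢
    refine (cross_eq_of_im_eq_zero (hne x) (hne y) (hreal x) (hreal y) (hs2 _ ?_)
      (hs2 _ ?_)).symm
    · rw [← h3, ← hs]
      congr 1
      simp [hadamardMatrix]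
      ring
    · rw [← h4, ← hs]
      congr 1
      simp [hadamardMatrix, phaseMatrix, pauliZ, Matrix.mul_apply]
      ring
  have hconst : ∀ x : Fin m → Fin 2, r (windowLabel x) = r 0 := by
    intro x
    have h0 : (0 : Label) = windowLabel (0 : Fin m → Fin 2) :=
      eq_windowLabel fun j _ => rfl
    have := windowLabel_induction (m := m) (p := fun x => (∃ y : Fin m → Fin 2, x = windowLabel y) ∧
      ∀ z : Fin m → Fin 2, r (windowLabel z + x) = r (windowLabel z)) ?_ ?_ ?_ x
    · have h2 := this.2 0
      rwa [← h0, zero_add] at h2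
    · exact ⟨⟨0, h0⟩, fun z => by rw [add_zero]⟩
    · rintro x y ⟨⟨x, rfl⟩, hx⟩ ⟨⟨y, rfl⟩, hy⟩
      refine ⟨⟨window m (windowLabel x + windowLabel y), eq_windowLabel fun j hj => ?_⟩,
        fun z => ?_⟩
      · simp [windowLabel_apply_of_not _ hj]
      · have hz : windowLabel z + windowLabel x =
            windowLabel (window m (windowLabel z + windowLabel x)) :=
          eq_windowLabel fun j hj => by simp [windowLabel_apply_of_not _ hj]
        rw [← add_assoc, hz, hy, ← hz, hx]
    · intro j hj b
      have hb : b = 0 ∨ b = 1 := by omega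
      rcases hb with rfl | rfl
      · rw [Pi.single_zero]
        exact ⟨⟨0, h0⟩, fun z => by rw [add_zero]⟩
      · refine ⟨?_, fun z => ?_⟩
        · obtain ⟨y, hy⟩ := hflip 0 j hj
          exact ⟨y, by rw [← hy, ← h0, zero_add]⟩
        · have hzj : windowLabel z j = 0 ∨ windowLabel z j = 1 := by omega
          rcases hzj with h | h
          · exact hstep0 z j hj h
          · obtain ⟨y, hy⟩ := hflip z j hj
            have hyj : windowLabel y j = 0 := by rw [← hy]; simp [h]
            have := hstep0 y j hj hyj
            rw [hy, ← this, ← hy, add_assoc, label_add_self, add_zero]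
  refine ⟨φ, hφK, r 0 / β, fun x => ?_⟩
  have h := hconst x
  have h2 : star (l (ket (windowLabel x))) = Ψ x := by rw [overlap_ket]; simp
  simp only [hrdef, h2] at h ⊢
  rw [← h]
  have := hΨ x
  field_simp

/-! ### Density of the states prepared by words -/

theorem overwrite_windowLabel_append {n k : ℕ} (a b : Fin n → Fin 2) (y : Fin k → Fin 2) :
    overwrite n a (windowLabel (Fin.append b y)) = windowLabel (Fin.append a y) := by
  funext j
  by_cases hj : 1 ≤ j ∧ j ≤ n
  · have hj' : 1 ≤ j ∧ j ≤ ((n + k : ℕ) : ℤ) := by push_cast; omega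
    rw [windowLabel, windowLabel, overwrite, overwrite, overwrite, dif_pos hj, dif_pos hj']
    have : (⟨(j - 1).toNat, by omega⟩ : Fin (n + k)) =
        Fin.castAdd k ⟨(j - 1).toNat, by omega⟩ := rfl
    rw [this, Fin.append_left]
  · by_cases hj' : 1 ≤ j ∧ j ≤ ((n + k : ℕ) : ℤ)
    · rw [windowLabel, windowLabel, overwrite, overwrite, overwrite, dif_neg hj,
        dif_pos hj', dif_pos hj']
      push_cast at hj'
      have : (⟨(j - 1).toNat, by omega⟩ : Fin (n + k)) =
          Fin.natAdd n ⟨(j - 1).toNat - n, by omega⟩ := by ext; simp; omega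
      rw [this, Fin.append_right, Fin.append_right]
    · rw [windowLabel, windowLabel, overwrite, overwrite, overwrite, dif_neg hj,
        dif_neg hj', dif_neg hj']

theorem reduced_pureTape_of_inWindow {n k : ℕ} {ψ : Label → ℂ} (hψ : InWindow (n + k) ψ)
    (a b : Fin n → Fin 2) : reduced n (pureTape ψ) a b = ∑ y : Fin k → Fin 2,
      ψ (windowLabel (Fin.append a y)) * star (ψ (windowLabel (Fin.append b y))) := by
  classical
  have hw : ∀ (c : Fin n → Fin 2) (y : Fin k → Fin 2),
      window n (windowLabel (Fin.append c y)) = c := by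
    intro c y
    rw [← overwrite_windowLabel_append c c y, window_overwrite]
  let E : (Fin k → Fin 2) ↪ {r : Label // window n r = 0} :=
    ⟨fun y => ⟨windowLabel (Fin.append 0 y), hw 0 y⟩, fun y y' h => by
      have h1 := windowLabel_injective _ (congrArg Subtype.val h)
      funext i
      have := congrFun h1 (Fin.natAdd n i)
      simpa using this⟩
  rw [reduced_pureTape, finsum_eq_sum_of_support_subset (s := Finset.univ.map E), Finset.sum_map]
  · refine Finset.sum_congr rfl fun y _ => ?_
    change ψ (overwrite n a (windowLabel (Fin.append 0 y))) *
      star (ψ (overwrite n b (windowLabel (Fin.append 0 y)))) = _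
    rw [overwrite_windowLabel_append, overwrite_windowLabel_append]
  · intro r hr
    have h0 : ψ (overwrite n a r.1) ≠ 0 := by
      intro h; exact hr (by simp [h])
    have hx : ∃ x : Fin (n + k) → Fin 2, overwrite n a r.1 = windowLabel x := by
      by_contra hne
      push Not at hne
      exact h0 (hψ.eq_zero hne)
    obtain ⟨x, hx⟩ := hx
    have hr2 := env_eq r hx
    have hx2 : x = Fin.append (fun i => x (Fin.castAdd k i)) (fun i => x (Fin.natAdd n i)) :=
      (Fin.append_castAdd_natAdd).symm
    simp only [Finset.coe_map, Finset.coe_univ, Set.image_univ, Set.mem_range]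
    refine ⟨fun i => x (Fin.natAdd n i), ?_⟩
    rw [hr2]
    ext1
    change windowLabel (Fin.append 0 _) = overwrite n 0 (windowLabel x)
    rw [hx2]
    simp only [Fin.append_right]
    exact (overwrite_windowLabel_append _ _ _).symm

open scoped MatrixOrder Matrix.Norms.L2Operator in
theorem _root_.Matrix.PosSemidef.exists_eq_star_mul_self {ι : Type*} [Fintype ι] [DecidableEq ι]
    {A : Matrix ι ι ℂ} (hA : A.PosSemidef) : ∃ B, A = star B * B :=
  CStarAlgebra.nonneg_iff_eq_star_mul_self.1 hA.nonneg

/-- A purification of ρ on 2n cells is approximated by vectors without zero amplitudes. Their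
normalized reduced matrices are limits of states of words, and so is the limit of these matrices. -/
theorem exists_word_near {n : ℕ} (ρ : QState n) {ε : ℝ} (hε : 0 < ε) :
    ∃ w, ∀ a b, ‖ρ.mat a b - (wordState n w).mat a b‖ < ε := by
  obtain ⟨B, hB⟩ := ρ.posSemidef.exists_eq_star_mul_self
  -- The first n bits index ρ and the last n bits are traced out. The conjugation makes the reduced
  -- matrix B† B itself and not its transpose.
  let Ψ : (Fin (n + n) → Fin 2) → ℂ := fun x =>
    star (B (fun i => x (Fin.natAdd n i)) (fun i => x (Fin.castAdd n i)))
  let R : ((Fin (n + n) → Fin 2) → ℂ) → (Fin n → Fin 2) → (Fin n → Fin 2) → ℂ := fun Φ a b =>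
    ∑ y : Fin n → Fin 2, Φ (Fin.append a y) * star (Φ (Fin.append b y))
  let S : ((Fin (n + n) → Fin 2) → ℂ) → ℂ := fun Φ => ∑ x, Φ x * star (Φ x)
  let P : (Fin n → Fin 2) → (Fin n → Fin 2) → ℂ := fun a b => ρ.mat a b
  have hR0 : R Ψ = P := by
    funext a b
    change _ = ρ.mat a b
    rw [hB]
    simp only [R, Ψ, Matrix.mul_apply, Matrix.star_apply, Fin.append_left, Fin.append_right,
      star_star]
  have hRS : ∀ Φ, S Φ = ∑ a, R Φ a a := by
    intro Φ
    simp only [S, R]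
    rw [← Fintype.sum_prod_type', ← Equiv.sum_comp (Fin.appendEquiv n n)]
    rfl
  have hS0 : S Ψ = 1 := by
    rw [hRS, hR0]
    exact ρ.trace_eq_one
  have hRc : Continuous R := by
    refine continuous_pi fun a => continuous_pi fun b => ?_
    simp only [R]
    fun_prop
  have hSc : Continuous S := by
    simp only [S]
    fun_prop
  let Q : Set ((Fin n → Fin 2) → (Fin n → Fin 2) → ℂ) :=
    {M | ∃ w, M = (wordState n w).mat}
  have hmem : ∀ Φ : (Fin (n + n) → Fin 2) → ℂ, (∀ x, Φ x ≠ 0) → (S Φ)⁻¹ • R Φ ∈ closure Q := by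
    intro Φ hΦ
    obtain ⟨φ, hφ, c, hc⟩ := exists_closure_prepared_proportional Φ hΦ
    have hnorm := (inWindow_and_norm_of_mem_closure hφ).2
    -- Normalization determines the modulus of the proportionality factor; its phase cancels in `R`.
    have hcc : c * star c * S Φ = 1 := by
      rw [← hnorm, Finset.mul_sum]
      refine Finset.sum_congr rfl fun x _ => ?_
      rw [hc, star_mul']
      ring
    have hRφ : (S Φ)⁻¹ • R Φ = R fun x => φ (windowLabel x) := by
      funext a b
      simp only [Pi.smul_apply, smul_eq_mul, R, hc]
      rw [Finset.mul_sum, eq_inv_of_mul_eq_one_left hcc |>.symm]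
      refine Finset.sum_congr rfl fun y _ => ?_
      rw [star_mul']
      ring
    rw [hRφ]
    have hcont : Continuous fun ψ : Label → ℂ => R fun x => ψ (windowLabel x) :=
      hRc.comp (f := fun ψ : Label → ℂ => fun x => ψ (windowLabel x))
        (continuous_pi fun x => continuous_apply (windowLabel x))
    refine map_mem_closure (f := fun ψ : Label → ℂ => R fun x => ψ (windowLabel x)) hcont hφ ?_
    intro ψ hψ
    obtain ⟨w, rfl⟩ := exists_runWord_of_mem_prepared hψ
    refine ⟨w, ?_⟩
    funext a b
    simp only [wordState, reducedState]
    rw [reduced_pureTape_of_inWindow (inWindow_and_norm_of_mem_prepared hψ).1]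
  -- Adding one small δ ≠ 0 to all amplitudes removes the zeros of Ψ. The sum of squares `S` stays
  -- near 1, so the normalization is continuous there.
  have hlim : Tendsto (fun δ : ℂ => (S fun x => Ψ x + δ)⁻¹ • R fun x => Ψ x + δ) (𝓝[≠] 0)
      (𝓝 P) := by
    have h1 : Continuous fun δ : ℂ => fun x => Ψ x + δ := by fun_prop
    have hS1 := (hSc.comp h1).tendsto 0
    have hR1 := (hRc.comp h1).tendsto 0
    simp only [Function.comp_def, add_zero] at hS1 hR1
    have hS2 : S (fun x => Ψ x) = 1 := hS0
    have hR2 : R (fun x => Ψ x) = P := hR0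
    rw [hS2] at hS1
    rw [hR2] at hR1
    have := (hS1.inv₀ one_ne_zero).smul hR1
    rw [inv_one, one_smul] at this
    exact this.mono_left nhdsWithin_le_nhds
  have hev : ∀ᶠ δ : ℂ in 𝓝[≠] 0, (S fun x => Ψ x + δ)⁻¹ • (R fun x => Ψ x + δ) ∈ closure Q := by
    have : ∀ᶠ δ : ℂ in 𝓝[≠] 0, ∀ x, Ψ x + δ ≠ 0 := by
      refine eventually_all.2 fun x => ?_
      by_cases hx : Ψ x = 0
      · filter_upwards [self_mem_nhdsWithin] with δ hδ
        rw [hx, zero_add]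
        exact hδ
      · have hc : Tendsto (fun δ : ℂ => Ψ x + δ) (𝓝 0) (𝓝 (Ψ x)) := by
          have : Continuous fun δ : ℂ => Ψ x + δ := by fun_prop
          simpa using this.tendsto 0
        exact (hc.eventually_ne hx).filter_mono nhdsWithin_le_nhds
    filter_upwards [this] with δ hδ
    exact hmem _ hδ
  have hcl := isClosed_closure.mem_of_tendsto hlim hev
  obtain ⟨M, ⟨w, rfl⟩, hw⟩ := Metric.mem_closure_iff.1 hcl ε hε
  refine ⟨w, fun a b => ?_⟩
  rw [← dist_eq_norm]
  have h1 := dist_le_pi_dist (f := P) (g := fun a b => (wordState n w).mat a b) a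
  have h2 := dist_le_pi_dist (f := P a) (g := fun b => (wordState n w).mat a b) b
  exact (h2.trans h1).trans_lt hw

end

/-! ### Simulation of machines, and the inclusion of `COMPq` in `COMPc` -/

noncomputable section

/-! ### Unbounded search and binary strings -/

theorem computable_find {α : Type*} [Primcodable α] {p : α → ℕ → Bool} (hp : Computable₂ p)
    (h : ∀ a, ∃ t, p a t = true) : Computable fun a => Nat.find (h a) := by
  have hr := Partrec.rfind (p := fun a t => (p a t : Part Bool)) hp.partrec₂
  refine hr.of_eq fun a => ?_
  refine Part.eq_some_iff.2 (Nat.mem_rfind.2 ⟨?_, fun {t} ht => ?_⟩)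
  · exact Part.mem_some_iff.2 (Nat.find_spec (h a)).symm
  · have := Nat.find_min (h a) ht
    exact Part.mem_some_iff.2 (by simpa using this)

def bitsStep (s : ℕ × List Bool) : ℕ × List Bool :=
  if s.1 = 0 then s else (s.1.div2, s.2 ++ [s.1.bodd])

/-- Halving lowers a positive number by at least one and the step fixes 0, so n iterations always
suffice. The bound lets `primrec_bits` use primitive iteration. -/
theorem iterate_bitsStep (t n : ℕ) (acc : List Bool) (h : n ≤ t) :
    bitsStep^[t] (n, acc) = (0, acc ++ Nat.bits n) := by
  induction t generalizing n acc with
  | zero => obtain rfl : n = 0 := by omega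
            simp
  | succ t ih =>
    rw [Function.iterate_succ_apply]
    by_cases hn : n = 0
    · subst hn
      have : bitsStep (0, acc) = (0, acc) := rfl
      rw [this, ih 0 acc (Nat.zero_le _)]
    · have h1 : bitsStep (n, acc) = (n.div2, acc ++ [n.bodd]) := by simp [bitsStep, hn]
      have h2 : n.div2 ≤ t := by rw [Nat.div2_val]; omega
      rw [h1, ih _ _ h2]
      conv_rhs => rw [← Nat.bit_bodd_div2 n]
      rw [Nat.bits_append_bit, List.append_assoc]
      · rfl
      · intro h0
        have := Nat.bodd_add_div2 n
        rw [h0] at this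
        cases hb : n.bodd
        · rw [hb] at this; simp at this; omega
        · rfl

theorem primrec_bits : Primrec Nat.bits := by
  have hstep : Primrec bitsStep :=
    Primrec.ite (Primrec.eq.comp Primrec.fst (Primrec.const 0)) Primrec.id
      (Primrec.pair (Primrec.nat_div2.comp Primrec.fst)
        (Primrec.list_concat.comp Primrec.snd (Primrec.nat_bodd.comp Primrec.fst)))
  have h := Primrec.snd.comp (Primrec.nat_iterate (f := fun n : ℕ => n)
    (g := fun n : ℕ => (n, ([] : List Bool))) (h := fun _ s => bitsStep s) Primrec.id
    (Primrec.pair Primrec.id (Primrec.const [])) (hstep.comp Primrec.snd))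
  refine h.of_eq fun n => ?_
  rw [iterate_bitsStep n n [] le_rfl, List.nil_append]

/-! ### Simulation of a machine by a primitive recursive function -/

/-- The displacement as a code: `0` for none, `1` for right, `2` for left. -/
def dispCode : Disp → ℕ
  | .stay => 0
  | .right => 1
  | .left => 2

/-- A configuration of the simulation: control state, the classical tape to the left of the head
(nearest cell first), the classical tape from the head on, and the word applied to the quantum
tape. -/
abbrev Sim (N : ℕ) := Fin N × (List Sym × List Sym) × List ℕ

/-- One step of the simulation, given the outcome of the transition function. -/
def simMove {N : ℕ} (s : Sim N) (o : Fin N × ℕ × Sym × ℕ) : Sim N :=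
  (o.1,
    (if o.2.2.2 = 0 then (s.2.1.1, o.2.2.1 :: s.2.1.2.tail)
      else if o.2.2.2 = 1 then (o.2.2.1 :: s.2.1.1, s.2.1.2.tail)
      else (s.2.1.1.tail, s.2.1.1.headI :: o.2.2.1 :: s.2.1.2.tail)),
    s.2.2 ++ [o.2.1])

def simStep {N : ℕ} (qh : Fin N) (τ : Fin N × Sym → Fin N × ℕ × Sym × ℕ) (s : Sim N) : Sim N :=
  if s.1 = qh then s else simMove s (τ (s.1, s.2.1.2.headI))

theorem primrec_simMove {N : ℕ} :
    Primrec fun x : Sim N × (Fin N × ℕ × Sym × ℕ) => simMove x.1 x.2 := by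
  have hs : Primrec fun x : Sim N × (Fin N × ℕ × Sym × ℕ) => x.1.2 :=
    Primrec.snd.comp Primrec.fst
  have hl := Primrec.fst.comp (Primrec.fst.comp hs)
  have hr := Primrec.list_tail.comp (Primrec.snd.comp (Primrec.fst.comp hs))
  have hw := Primrec.snd.comp hs
  have ho : Primrec fun x : Sim N × (Fin N × ℕ × Sym × ℕ) => x.2 := Primrec.snd
  have ho1 := Primrec.fst.comp ho
  have ho2 := Primrec.fst.comp (Primrec.snd.comp ho)
  have ho3 := Primrec.fst.comp (Primrec.snd.comp (Primrec.snd.comp ho))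
  have ho4 := Primrec.snd.comp (Primrec.snd.comp (Primrec.snd.comp ho))
  have har := Primrec.list_cons.comp ho3 hr
  have h0 := Primrec.pair hl har
  have h1 := Primrec.pair (Primrec.list_cons.comp ho3 hl) hr
  have h2 := Primrec.pair (Primrec.list_tail.comp hl)
    (Primrec.list_cons.comp (Primrec.list_headI.comp hl) har)
  have hite := Primrec.ite (Primrec.eq.comp ho4 (Primrec.const 0)) h0
    (Primrec.ite (Primrec.eq.comp ho4 (Primrec.const 1)) h1 h2)
  have h := Primrec.pair ho1 (Primrec.pair hite (Primrec.list_concat.comp hw ho2))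
  exact h

theorem primrec_simStep {N : ℕ} (qh : Fin N) (τ : Fin N × Sym → Fin N × ℕ × Sym × ℕ) :
    Primrec (simStep qh τ) := by
  have hτ : Primrec τ := Primrec.dom_finite τ
  have hr : Primrec fun s : Sim N => s.2.1.2 :=
    Primrec.snd.comp (Primrec.fst.comp Primrec.snd)
  have h := Primrec.ite (Primrec.eq.comp Primrec.fst (Primrec.const qh)) Primrec.id
    (primrec_simMove.comp (Primrec.pair Primrec.id
      (hτ.comp (Primrec.pair Primrec.fst (Primrec.list_headI.comp hr)))))
  exact h

/-- The simulation state `s` describes the configuration `c`. -/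
structure Simulates {M : DcqTM} {N : ℕ} (e : M.Q ≃ Fin N) (s : Sim N) (c : Config M) : Prop where
  state : s.1 = e c.state
  right : ∀ i : ℕ, c.ctape (c.chead + i) = s.2.1.2.getD i none
  left : ∀ i : ℕ, c.ctape (c.chead - 1 - i) = s.2.1.1.getD i none
  qtape : c.qtape = pureTape (runWord s.2.2).1
  qhead : c.qhead = (runWord s.2.2).2

/-- The transition function of `M` in terms of codes. -/
def codedTransition (M : DcqTM) {N : ℕ} (e : M.Q ≃ Fin N) (x : Fin N × Sym) :
    Fin N × ℕ × Sym × ℕ :=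
  match M.δ (e.symm x.1) x.2 with
  | (g, dq, a, dc, q) => (e q, letter g dq, a, dispCode dc)

theorem headI_eq_getD (l : List Sym) : l.headI = l.getD 0 none := by
  cases l <;> rfl

theorem getD_tail (l : List Sym) (i : ℕ) : l.tail.getD i none = l.getD (i + 1) none := by
  cases l <;> simp

/-- The transition never reads the quantum tape. Classically this is the usual simulation of a tape
by two stacks, and the quantum side is followed by appending one letter to the word. -/
theorem Simulates.step {M : DcqTM} {N : ℕ} {e : M.Q ≃ Fin N} {s : Sim N} {c : Config M}
    (h : Simulates e s c) :
    Simulates e (simStep (e M.halt) (codedTransition M e) s) (M.step c) := by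
  obtain ⟨q, ⟨l, r⟩, w⟩ := s
  have hq := h.state
  simp only at hq
  by_cases hh : c.state = M.halt
  · have h1 : M.step c = c := by simp [DcqTM.step, hh]
    have h2 : simStep (e M.halt) (codedTransition M e) (q, (l, r), w) = (q, (l, r), w) := by
      simp [simStep, hq, hh]
    rw [h1, h2]; exact h
  · have ha : c.ctape c.chead = r.headI := by
      have := h.right 0
      rw [headI_eq_getD]
      simpa using this
    obtain ⟨⟨g, dq, a, dc, q'⟩, hδ⟩ : ∃ x, M.δ c.state (c.ctape c.chead) = x := ⟨_, rfl⟩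
    have h1 : M.step c =
      { state := q'
        ctape := Function.update c.ctape c.chead a
        chead := c.chead + dc.toInt
        qtape := applyGate g c.qhead c.qtape
        qhead := c.qhead + dq.toInt } := by
      simp only [DcqTM.step, if_neg hh, hδ]
    have h2 : simStep (e M.halt) (codedTransition M e) (q, (l, r), w) =
        simMove (q, (l, r), w) (e q', letter g dq, a, dispCode dc) := by
      have : q ≠ e M.halt := by rw [hq]; simpa using hh
      have hδ' : M.δ (e.symm q) r.headI = (g, dq, a, dc, q') := by
        rw [hq, Equiv.symm_apply_apply, ← ha, hδ]
      rw [simStep, if_neg this]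
      simp only [codedTransition, hδ']
    have hcell : ∀ i : ℕ, Function.update c.ctape c.chead a (c.chead + i) =
        (a :: r.tail).getD i none := by
      intro i
      cases i with
      | zero => simp
      | succ i =>
        have hne : c.chead + ((i + 1 : ℕ) : ℤ) ≠ c.chead := by push_cast; omega
        rw [Function.update_of_ne hne, h.right, List.getD_cons_succ, getD_tail]
    have hleft : ∀ i : ℕ, Function.update c.ctape c.chead a (c.chead - 1 - i) =
        l.getD i none := by
      intro i
      have hne : c.chead - 1 - (i : ℤ) ≠ c.chead := by omega
      rw [Function.update_of_ne hne, h.left]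
    have hrun : runWord (w ++ [letter g dq]) =
        (gateOp g (runWord w).2 (runWord w).1, (runWord w).2 + dq.toInt) := by
      rw [runWord, List.foldl_append]
      simp only [List.foldl_cons, List.foldl_nil, letterStep, letterGate_letter, letterDisp_letter]
      rfl
    rw [h1, h2]
    refine ⟨rfl, ?_, ?_, ?_, ?_⟩
    · intro i
      cases dc with
      | stay => simpa [simMove, dispCode, Disp.toInt] using hcell i
      | right =>
        have := hcell (i + 1)
        rw [List.getD_cons_succ] at this
        change Function.update c.ctape c.chead a (c.chead + 1 + i) = r.tail.getD i none
        rw [← this]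
        congr 1; push_cast; ring
      | left =>
        change Function.update c.ctape c.chead a (c.chead + -1 + i) =
          (l.headI :: a :: r.tail).getD i none
        cases i with
        | zero =>
          have := hleft 0
          rw [List.getD_cons_zero, headI_eq_getD, ← this]
          congr 1
        | succ i =>
          rw [List.getD_cons_succ, ← hcell]
          congr 1; push_cast; ring
    · intro i
      cases dc with
      | stay => simpa [simMove, dispCode, Disp.toInt] using hleft i
      | right =>
        change Function.update c.ctape c.chead a (c.chead + 1 - 1 - i) = (a :: l).getD i none
        cases i with
        | zero =>
          have := hcell 0
          rw [List.getD_cons_zero] at this ⊢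
          rw [← this]
          congr 1; push_cast; ring
        | succ i =>
          rw [List.getD_cons_succ, ← hleft]
          congr 1; push_cast; ring
      | left =>
        change Function.update c.ctape c.chead a (c.chead + -1 - 1 - i) = l.tail.getD i none
        rw [getD_tail, ← hleft]
        congr 1; push_cast; ring
    · simp only [simMove]
      rw [hrun, h.qtape, h.qhead, applyGate_pureTape]
    · simp only [simMove]
      rw [hrun, h.qhead]

theorem simulates_init (M : DcqTM) {N : ℕ} (e : M.Q ≃ Fin N) (x : List Bool) :
    Simulates e (e M.start, ([], none :: x.map some), []) (M.init x emptyState) where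
  state := rfl
  right i := by
    have h0 : natString 0 = [] := Nat.zero_bits
    simp only [DcqTM.init, h0, zero_add, tapeOfWord]
    cases i with
    | zero => simp
    | succ i =>
      have : (1 : ℤ) ≤ ((i + 1 : ℕ) : ℤ) := by push_cast; omega
      rw [if_pos this, List.getD_cons_succ]
      have h1 : (((i + 1 : ℕ) : ℤ) - 1).toNat = i := by simp
      rw [h1]
      rcases lt_or_ge i (x.map (some : Bool → Sym)).length with hi | hi
      · rw [List.getD_append _ _ _ _ hi]
      · rw [List.getD_append_right _ _ _ _ hi, List.getD_eq_default _ _ hi]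
        cases i - (x.map (some : Bool → Sym)).length <;> rfl
  left i := by
    simp only [DcqTM.init, tapeOfWord]
    rw [if_neg (by omega)]
    simp
  qtape := initQTape_emptyState
  qhead := rfl

theorem DcqTM.step_iterate_of_halt {M : DcqTM} {c : Config M} (h : c.state = M.halt) (t : ℕ) :
    M.step^[t] c = c :=
  Function.iterate_fixed (by simp [DcqTM.step, h]) t

theorem DcqTM.step_iterate_eq_of_halt {M : DcqTM} {c : Config M} {t u : ℕ}
    (ht : (M.step^[t] c).state = M.halt) (hu : (M.step^[u] c).state = M.halt) :
    M.step^[t] c = M.step^[u] c := by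
  rcases le_total t u with h | h
  · obtain ⟨v, rfl⟩ := Nat.exists_eq_add_of_le h
    rw [add_comm, Function.iterate_add_apply, step_iterate_of_halt ht]
  · obtain ⟨v, rfl⟩ := Nat.exists_eq_add_of_le h
    rw [add_comm, Function.iterate_add_apply, step_iterate_of_halt hu]

/-- The first halting time is found by search. A halted configuration no longer changes, so the word
recorded then prepares the output promised by `Outputs`. -/
theorem exists_computable_word {n : ℕ} {M : DcqTM} {σ : ℕ → QState n}
    (h : ∀ k, 1 ≤ k → M.Outputs (natString k) emptyState [] (σ k)) :
    ∃ f : ℕ → List ℕ, Computable f ∧ ∀ k, (σ (k + 1)).mat = (wordState n (f k)).mat := by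
  have := M.fintypeQ
  let e : M.Q ≃ Fin (Fintype.card M.Q) := Fintype.equivFin M.Q
  let s : ℕ → Sim (Fintype.card M.Q) := fun k =>
    (e M.start, ([], none :: (natString (k + 1)).map some), [])
  let run : ℕ × ℕ → Sim (Fintype.card M.Q) := fun x =>
    (simStep (e M.halt) (codedTransition M e))^[x.2] (s x.1)
  have hs : Primrec s := by
    have h1 : Primrec fun k : ℕ => (natString (k + 1)).map (some : Bool → Sym) :=
      Primrec.list_map (primrec_bits.comp Primrec.succ) (Primrec.option_some.comp Primrec.snd)
    have h2 := Primrec.list_cons.comp (Primrec.const (none : Sym)) h1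
    exact Primrec.pair (Primrec.const _)
      (Primrec.pair (Primrec.pair (Primrec.const _) h2) (Primrec.const _))
  have hrun : Primrec run := by
    have h := Primrec.nat_iterate (f := fun x : ℕ × ℕ => x.2) (g := fun x : ℕ × ℕ => s x.1)
      (h := fun _ y => simStep (e M.halt) (codedTransition M e) y) Primrec.snd
      (hs.comp Primrec.fst) ((primrec_simStep _ _).comp Primrec.snd)
    exact h
  have hsim : ∀ k t, Simulates e (run (k, t))
      (M.step^[t] (M.init (natString (k + 1)) emptyState)) := by
    intro k t
    induction t with
    | zero => exact simulates_init M e _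
    | succ t ih =>
      simp only [run, Function.iterate_succ_apply'] at ih ⊢
      exact ih.step
  let p : ℕ → ℕ → Bool := fun k t => decide ((run (k, t)).1 = e M.halt)
  have hp : Computable₂ p := by
    have h1 : PrimrecPred fun x : ℕ × ℕ => (run x).1 = e M.halt :=
      Primrec.eq.comp (Primrec.fst.comp hrun) (Primrec.const _)
    exact h1.decide.to_comp
  have hex : ∀ k, ∃ t, p k t = true := by
    intro k
    obtain ⟨t, c, hc, hhalt, -⟩ := h (k + 1) (by omega)
    refine ⟨t, ?_⟩
    have := (hsim k t).state
    rw [hc, hhalt] at this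
    simp only [p, this, decide_true]
  refine ⟨fun k => (run (k, Nat.find (hex k))).2.2, ?_, fun k => ?_⟩
  · have h1 := (computable_find hp hex)
    have h2 := hrun.to_comp.comp (Computable.pair Computable.id h1)
    exact (Primrec.snd.comp Primrec.snd).to_comp.comp h2
  · obtain ⟨t, c, hc, hhalt, -, -, hred⟩ := h (k + 1) (by omega)
    have hk := hsim k (Nat.find (hex k))
    have hfin : (M.step^[Nat.find (hex k)] (M.init (natString (k + 1)) emptyState)).state =
        M.halt := by
      have h1 : (run (k, Nat.find (hex k))).1 = e M.halt :=
        of_decide_eq_true (Nat.find_spec (hex k))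
      rw [hk.state] at h1
      exact e.injective h1
    have heq := DcqTM.step_iterate_eq_of_halt hfin (hc ▸ hhalt)
    rw [hc] at heq
    rw [← hred, ← heq, hk.qtape]
    rfl

/-! ### Limits of computable sequences of words have computable entries -/

/-- The rational number `(p - q) / d` as sign, numerator and denominator. -/
def tripleOfFrac (x : ℕ × ℕ × ℕ) : Bool × ℕ × ℕ :=
  (decide (x.1 < x.2.1), (x.1 - x.2.1) + (x.2.1 - x.1), x.2.2)

theorem primrec_tripleOfFrac : Primrec tripleOfFrac := by
  have h2 : Primrec fun x : ℕ × ℕ × ℕ => x.2.1 := Primrec.fst.comp Primrec.snd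
  have hlt : PrimrecPred fun x : ℕ × ℕ × ℕ => x.1 < x.2.1 := Primrec.nat_lt.comp Primrec.fst h2
  have h := Primrec.pair hlt.decide (Primrec.pair
    (Primrec.nat_add.comp (Primrec.nat_sub.comp Primrec.fst h2)
      (Primrec.nat_sub.comp h2 Primrec.fst)) (Primrec.snd.comp Primrec.snd))
  exact h

theorem ratOfTriple_tripleOfFrac (x : ℕ × ℕ × ℕ) :
    (ratOfTriple (tripleOfFrac x) : ℝ) = fracVal x := by
  obtain ⟨p, q, d⟩ := x
  simp only [tripleOfFrac, ratOfTriple, fracVal]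
  by_cases h : p < q
  · have h1 : p - q = 0 := by omega
    simp only [h, decide_true, if_true, h1, zero_add]
    push_cast [Nat.cast_sub h.le]
    ring
  · have h1 : q - p = 0 := by omega
    simp only [h, decide_false, h1, add_zero]
    push_cast [Nat.cast_sub (not_lt.1 h)]
    simp

theorem eighthRoot_pow_six_mul_re (z : ℂ) : (eighthRoot ^ 6 * z).re = z.im := by
  have : eighthRoot ^ 6 = -Complex.I := by
    rw [show 6 = 4 + 2 from rfl, pow_add, eighthRoot_pow_four, eighthRoot_sq]; ring
  rw [this]; simp

/-- The index `3 * k` absorbs two errors: at most 2/(3k + 1) from the trace distance and at most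
1/(3k + 1) from the rational approximation. Multiplication by a power of the eighth root selects
which real part is taken. -/
theorem isComputableReal_of_words {n : ℕ} {ρ : QState n} {f : ℕ → List ℕ} (hf : Computable f)
    (h : ∀ k : ℕ, traceDist ρ (wordState n (f k)) ≤ 1 / ((k : ℝ) + 1)) (sh : ℕ)
    (a b : Fin n → Fin 2) : IsComputableReal (eighthRoot ^ sh * ρ.mat a b).re := by
  refine ⟨fun k => tripleOfFrac (entryApprox n (stringMask a) (stringMask b) sh
    (f (3 * k), 3 * k)), ?_, fun k hk => ⟨?_, ?_⟩⟩
  · have h3 : Computable fun k : ℕ => 3 * k :=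
      (Primrec.nat_mul.comp (Primrec.const 3) Primrec.id).to_comp
    have h1 := Computable.pair (hf.comp h3) h3
    have h2 := (primrec_entryApprox n (stringMask a) (stringMask b) sh).to_comp.comp h1
    exact primrec_tripleOfFrac.to_comp.comp h2
  · exact (entryApprox_den_pos n (stringMask a) (stringMask b) sh (f (3 * k), 3 * k)).ne'
  · rw [ratOfTriple_tripleOfFrac]
    have h1 := abs_entry_sub_entryApprox n a b sh (f (3 * k)) (3 * k)
    have h2 := (norm_sub_apply_le_traceDist ρ (wordState n (f (3 * k))) a b).trans
      (mul_le_mul_of_nonneg_left (h (3 * k)) two_pos.le)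
    have hnorm : ‖eighthRoot ^ sh‖ = 1 := by
      have h8 : ‖eighthRoot‖ ^ 8 = 1 := by rw [← norm_pow, eighthRoot_pow_eight, norm_one]
      rw [norm_pow, (pow_eq_one_iff_of_nonneg (norm_nonneg _) (by norm_num)).1 h8, one_pow]
    have h3 : |(eighthRoot ^ sh * ρ.mat a b).re -
        (eighthRoot ^ sh * (wordState n (f (3 * k))).mat a b).re| ≤
        ‖ρ.mat a b - (wordState n (f (3 * k))).mat a b‖ := by
      rw [← Complex.sub_re, ← mul_sub]
      refine (Complex.abs_re_le_norm _).trans ?_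
      rw [norm_mul, hnorm, one_mul]
    have hk' : (1 : ℝ) ≤ k := by exact_mod_cast hk
    push_cast at h1 h2
    have h4 : 3 * (1 / (3 * (k : ℝ) + 1)) ≤ 1 / k := by
      rw [mul_one_div, div_le_div_iff₀ (by positivity) (by positivity)]
      linarith
    refine (abs_sub_le _ _ _).trans ((add_le_add (h3.trans h2) h1).trans ?_)
    linarith

theorem COMPq_subset_COMPc : COMPq ⊆ COMPc := by
  rintro ⟨n, ρ⟩ ⟨M, σ, h⟩
  obtain ⟨f, hf, hσ⟩ := exists_computable_word fun k hk => (h k hk).2.1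
  have hd : ∀ k : ℕ, traceDist ρ (wordState n (f k)) ≤ 1 / ((k : ℝ) + 1) := by
    intro k
    have h1 := (h (k + 1) (by omega)).2.2
    have h2 : σ (k + 1) = wordState n (f k) := QState.ext (hσ k)
    simp only [h2] at h1
    exact_mod_cast h1
  intro a b
  have h0 := isComputableReal_of_words hf hd 0 a b
  -- The sixth power of the eighth root is −i, which brings the imaginary part into the real part.
  have h6 := isComputableReal_of_words hf hd 6 a b
  rw [pow_zero, one_mul] at h0
  rw [eighthRoot_pow_six_mul_re] at h6
  exact ⟨h0, h6⟩

end

/-! ### Compilation of bit-stack programs to quantum Turing machines -/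

noncomputable section

open Turing.PartrecToTM2 (K' Γ')

/-! ### Machines with several stacks of bits -/

/-- An instruction of a machine with an input stack `none` and four work stacks of bits, and with
a quantum tape on which letters act. -/
inductive BitInstr (L : Type)
  | push (j : Option K') (b : Bool) (l : L)
  | pop (j : Option K') (f : Option Bool → L)
  | act (i : ℕ) (l : L)
  | halt

/-- A configuration of a stack machine: the label of the next instruction, the stacks, and the
amplitudes and head position of the quantum tape. -/
structure BitCfg (L : Type) where
  label : L
  stk : Option K' → List Bool
  quantum : (Label → ℂ) × ℤ

def bitStep {L : Type} (prog : L → BitInstr L) (c : BitCfg L) : Option (BitCfg L) :=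
  match prog c.label with
  | .push j b l => some ⟨l, Function.update c.stk j (b :: c.stk j), c.quantum⟩
  | .pop j f => some ⟨f (c.stk j).head?, Function.update c.stk j (c.stk j).tail, c.quantum⟩
  | .act i l => some ⟨l, c.stk, letterStep c.quantum i⟩
  | .halt => none

/-! ### The stacks on the tape -/

/-- The work stacks share the nonpositive cells: row i of track r is the cell −(r + 4i). The input
stack has the positive cells to itself. -/
def trackNum : K' → ℕ
  | .main => 0
  | .rev => 1
  | .aux => 2
  | .stack => 3

theorem trackNum_lt (k : K') : trackNum k < 4 := by cases k <;> decide

def trackBase : Option K' → ℕ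
  | none => 0
  | some k => trackNum k

def trackStride : Option K' → ℕ
  | none => 1
  | some _ => 4

/-- Whether a stack grows to the right. -/
def trackRight : Option K' → Bool
  | none => true
  | some _ => false

/-- The unit vector in a direction (`true` for right). -/
def unitOf (d : Bool) : ℤ := if d then 1 else -1

/-- The cell of the `i`-th element of a stack, counted from the bottom and from `1`. -/
def cell (j : Option K') (i : ℕ) : ℤ :=
  unitOf (trackRight j) * (trackBase j + trackStride j * i)

def trackOfNat : ℕ → K'
  | 0 => .main
  | 1 => .rev
  | 2 => .aux
  | _ => .stack

theorem trackOfNat_trackNum (k : K') : trackOfNat (trackNum k) = k := by cases k <;> rfl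

theorem trackNum_trackOfNat {r : ℕ} (h : r < 4) : trackNum (trackOfNat r) = r := by
  interval_cases r <;> rfl

/-- A two-sided inverse of `cell` only for rows from 1 on; the cell 0 lies in row 0 both of the
input and of `main`. -/
def locate (p : ℤ) : Option K' × ℕ :=
  if 0 < p then (none, p.toNat) else (some (trackOfNat ((-p).toNat % 4)), (-p).toNat / 4)

theorem cell_locate (p : ℤ) : cell (locate p).1 (locate p).2 = p := by
  unfold locate
  split_ifs with h
  · simp [cell, unitOf, trackRight, trackBase, trackStride]; omega
  · have h1 : (-p).toNat % 4 < 4 := Nat.mod_lt _ (by norm_num)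
    simp only [cell, unitOf, trackRight, trackBase, trackStride, trackNum_trackOfNat h1]
    have := Nat.mod_add_div (-p).toNat 4
    simp only [Bool.false_eq_true, if_false]
    omega

theorem locate_cell (j : Option K') {i : ℕ} (hi : 1 ≤ i) : locate (cell j i) = (j, i) := by
  cases j with
  | none =>
    simp only [locate, cell, unitOf, trackRight, trackBase, trackStride, if_true]
    rw [if_pos (by push_cast; omega)]
    simp
  | some k =>
    have hk := trackNum_lt k
    have h1 : cell (some k) i = -((trackNum k + 4 * i : ℕ) : ℤ) := by
      simp only [cell, unitOf, trackRight, trackBase, trackStride]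
      push_cast; simp
    rw [h1, locate, if_neg (by omega)]
    have h2 : (- -((trackNum k + 4 * i : ℕ) : ℤ)).toNat = trackNum k + 4 * i := by omega
    rw [h2]
    have h3 : (trackNum k + 4 * i) % 4 = trackNum k := by omega
    have h4 : (trackNum k + 4 * i) / 4 = i := by omega
    rw [h3, h4, trackOfNat_trackNum]

/-- The contents of row `i` of the track of a stack. -/
def slot (l : List Bool) (i : ℕ) : Sym := if i = 0 then none else l.reverse[i - 1]?

@[simp] theorem slot_zero (l : List Bool) : slot l 0 = none := rfl

theorem slot_cons (b : Bool) (l : List Bool) (i : ℕ) :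
    slot (b :: l) i = if i = l.length + 1 then some b else slot l i := by
  cases i with
  | zero => simp
  | succ i =>
    simp only [slot, Nat.succ_ne_zero, if_false, Nat.add_sub_cancel, List.reverse_cons,
      List.getElem?_append, List.length_reverse]
    split_ifs with h1 h2 h2
    · omega
    · rfl
    · have : i = l.length := by omega
      subst this; simp
    · rw [List.getElem?_eq_none (by simp; omega), List.getElem?_eq_none (by simp; omega)]

theorem slot_of_length_lt {l : List Bool} {i : ℕ} (h : l.length < i) : slot l i = none := by
  rw [slot, if_neg (by omega), List.getElem?_eq_none (by simp; omega)]

theorem slot_ne_none {l : List Bool} {i : ℕ} (h1 : 1 ≤ i) (h2 : i ≤ l.length) :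
    slot l i ≠ none := by
  rw [slot, if_neg (by omega), List.getElem?_eq_getElem (by simp; omega)]
  simp

/-- The classical tape that holds the given stacks. -/
def tapeOfStacks (stk : Option K' → List Bool) : ℤ → Sym := fun p =>
  slot (stk (locate p).1) (locate p).2

/-- The ambiguity of the cell 0 is harmless, because row 0 of every track is kept blank. This blank
also marks the bottom of a stack. -/
theorem tapeOfStacks_cell (stk : Option K' → List Bool) (j : Option K') (i : ℕ) :
    tapeOfStacks stk (cell j i) = slot (stk j) i := by
  rcases Nat.eq_zero_or_pos i with rfl | hi
  · have : (locate (cell j 0)).2 = 0 := by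
      cases j with
      | none => rfl
      | some k => cases k <;> rfl
    rw [tapeOfStacks, this, slot_zero, slot_zero]
  · rw [tapeOfStacks, locate_cell j hi]

theorem update_tapeOfStacks {stk : Option K' → List Bool} {j : Option K'} {i : ℕ} {a : Sym}
    {l : List Bool} (hi : 1 ≤ i)
    (h : ∀ i', slot l i' = if i' = i then a else slot (stk j) i') :
    Function.update (tapeOfStacks stk) (cell j i) a =
      tapeOfStacks (Function.update stk j l) := by
  funext p
  obtain ⟨j', i', hp⟩ : ∃ j' i', p = cell j' i' := ⟨_, _, (cell_locate p).symm⟩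
  by_cases hpc : p = cell j i
  · subst hpc
    rw [Function.update_self, tapeOfStacks_cell, Function.update_self, h, if_pos rfl]
  · rw [Function.update_of_ne hpc, hp, tapeOfStacks_cell, tapeOfStacks_cell]
    by_cases hj : j' = j
    · subst hj
      rw [Function.update_self, h, if_neg]
      rintro rfl; exact hpc hp
    · rw [Function.update_of_ne hj]

theorem update_tapeOfStacks_push (stk : Option K' → List Bool) (j : Option K') (b : Bool) :
    Function.update (tapeOfStacks stk) (cell j ((stk j).length + 1)) (some b) =
      tapeOfStacks (Function.update stk j (b :: stk j)) :=
  update_tapeOfStacks (by omega) fun i' => slot_cons b (stk j) i'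

theorem update_tapeOfStacks_pop {stk : Option K' → List Bool} {j : Option K'} {b : Bool}
    {l : List Bool} (h : stk j = b :: l) :
    Function.update (tapeOfStacks stk) (cell j (stk j).length) none =
      tapeOfStacks (Function.update stk j (stk j).tail) := by
  refine update_tapeOfStacks (by rw [h]; simp) fun i' => ?_
  rw [h, List.tail_cons, slot_cons, List.length_cons]
  split_ifs with h1
  · exact slot_of_length_lt (by omega)
  · rfl

/-! ### Compilation to a quantum Turing machine -/

/-- The phases of the execution of an instruction. -/
inductive Tag
  | start
  | seek
  | pull
  | back (r : Option Bool)

instance : Finite Tag :=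
  Finite.of_injective (β := Option (Option (Option (Option Bool))))
    (fun | .start => none | .seek => some none | .pull => some (some none)
         | .back r => some (some (some r)))
    (by rintro (_ | _ | _ | r) (_ | _ | _ | r') h <;> simp_all)

/-- The control states: the halting state `none`, or a direction and the number of cells to move
before the next phase, and the next phase, which belongs to an instruction or to the output of a
digit of the number of qubits. -/
abbrev CtlState (L : Type) (N : ℕ) := Option ((Bool × Fin 9) × ((L × Tag) ⊕ Fin (N + 1)))

abbrev Action (L : Type) (N : ℕ) := Gate × Disp × Sym × Disp × CtlState L N

/-- The longest move between phases has 3 + 4 = 7 cells, so the cutoff at 8 is never felt. -/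
def counter (n : ℕ) : Fin 9 := ⟨min n 8, by omega⟩

theorem counter_zero : ((counter 0 : Fin 9) : ℕ) = 0 := rfl

def dispOf (d : Bool) : Disp := if d then .right else .left

theorem dispOf_toInt (d : Bool) : (dispOf d).toInt = unitOf d := by cases d <;> rfl

/-- Write `a`, and set out to move `n` cells in direction `d` before the phase `ph`. -/
def setOut {L : Type} {N : ℕ} (a : Sym) (d : Bool) (n : ℕ) (ph : (L × Tag) ⊕ Fin (N + 1)) :
    Action L N :=
  (.idle, .stay, a, .stay, some ((d, counter n), ph))

/-- Every stack instruction starts and ends at the cell 0: go to row 1 of the track, climb to the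
first blank, write there or step back and erase, descend to the blank row 0, and return. The last
clause serves combinations of instruction and phase that no run enters. -/
def instrAction {L : Type} (N : ℕ) (l : L) : BitInstr L → Tag → Sym → Action L N
  | .act i l', .start, a => (letterGate i, letterDisp i, a, .stay,
      some ((true, counter 0), .inl (l', .start)))
  | .halt, .start, a => setOut a true 2 (.inr 0)
  | .push j _ _, .start, a => setOut a (trackRight j) (trackBase j + trackStride j)
      (.inl (l, .seek))
  | .pop j _, .start, a => setOut a (trackRight j) (trackBase j + trackStride j) (.inl (l, .seek))
  | .push j b _, .seek, none => setOut (some b) (!trackRight j) (trackStride j)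
      (.inl (l, .back none))
  | .pop j _, .seek, none => setOut none (!trackRight j) (trackStride j) (.inl (l, .pull))
  | .push j _ _, .seek, some b => setOut (some b) (trackRight j) (trackStride j) (.inl (l, .seek))
  | .pop j _, .seek, some b => setOut (some b) (trackRight j) (trackStride j) (.inl (l, .seek))
  | .pop j f, .pull, none => setOut none (!trackRight j) (trackBase j) (.inl (f none, .start))
  | .pop j _, .pull, some b => setOut none (!trackRight j) (trackStride j)
      (.inl (l, .back (some b)))
  | .push j _ l', .back _, none => setOut none (!trackRight j) (trackBase j) (.inl (l', .start))
  | .pop j f, .back r, none => setOut none (!trackRight j) (trackBase j) (.inl (f r, .start))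
  | .push j _ _, .back r, some b => setOut (some b) (!trackRight j) (trackStride j)
      (.inl (l, .back r))
  | .pop j _, .back r, some b => setOut (some b) (!trackRight j) (trackStride j)
      (.inl (l, .back r))
  | _, _, a => (.idle, .stay, a, .stay, none)

def outputAction {L : Type} (bits : List Bool) (i : Fin (bits.length + 1)) (a : Sym) :
    Action L bits.length :=
  if h : (i : ℕ) < bits.length then
    (.idle, .stay, some bits[(i : ℕ)], .right,
      some ((true, counter 0), .inr ⟨i + 1, Nat.succ_lt_succ h⟩))
  else (.idle, .stay, a, .stay, none)

def control {L : Type} (prog : L → BitInstr L) (bits : List Bool) :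
    CtlState L bits.length → Sym → Action L bits.length
  | none, a => (.idle, .stay, a, .stay, none)
  | some ((d, n), ph), a =>
    if (n : ℕ) = 0 then
      match ph with
      | .inl (l, tag) => instrAction _ l (prog l) tag a
      | .inr i => outputAction bits i a
    else (.idle, .stay, a, dispOf d, some ((d, counter (n - 1)), ph))

/-- The quantum Turing machine that runs a program with bit stacks, and then specifies the number
of output qubits. -/
def compile {L : Type} [Finite L] (prog : L → BitInstr L) (l₀ : L) (bits : List Bool) : DcqTM where
  Q := CtlState L bits.length
  fintypeQ := Fintype.ofFinite _
  start := some ((true, counter 0), .inl (l₀, .start))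
  halt := none
  start_ne_halt := by simp
  δ := control prog bits

namespace DcqTM

/-- Some number of steps leads from one configuration to the other. -/
def Leads (M : DcqTM) (c c' : Config M) : Prop := ∃ t, M.step^[t] c = c'

theorem Leads.refl {M : DcqTM} (c : Config M) : M.Leads c c := ⟨0, rfl⟩

theorem Leads.trans {M : DcqTM} {c c' c'' : Config M} (h : M.Leads c c') (h' : M.Leads c' c'') :
    M.Leads c c'' := by
  obtain ⟨t, rfl⟩ := h
  obtain ⟨u, rfl⟩ := h'
  exact ⟨u + t, Function.iterate_add_apply _ _ _ _⟩

end DcqTM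

theorem letterStep_zero (s : (Label → ℂ) × ℤ) : letterStep s 0 = s := by
  have h1 : letterGate 0 = .idle := rfl
  have h2 : letterDisp 0 = .stay := rfl
  rw [letterStep, h1, h2, gateOp_idle]
  simp [Disp.toInt]

variable {L : Type} [Finite L] {prog : L → BitInstr L} {l₀ : L} {bits : List Bool}

/-- A configuration of the compiled machine. -/
def conf (prog : L → BitInstr L) (l₀ : L) (bits : List Bool) (q : CtlState L bits.length)
    (tape : ℤ → Sym) (p : ℤ) (s : (Label → ℂ) × ℤ) : Config (compile prog l₀ bits) :=
  { state := q, ctape := tape, chead := p, qtape := pureTape s.1, qhead := s.2 }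

theorem leads_of_control {q : (Bool × Fin 9) × ((L × Tag) ⊕ Fin (bits.length + 1))}
    {q' : CtlState L bits.length}
    {tape : ℤ → Sym} {p : ℤ} {s : (Label → ℂ) × ℤ} {g : Gate} {d d' : Disp} {a : Sym}
    (h : control prog bits (some q) (tape p) = (g, d, a, d', q')) :
    (compile prog l₀ bits).Leads (conf prog l₀ bits (some q) tape p s)
      (conf prog l₀ bits q' (Function.update tape p a) (p + d'.toInt)
        (gateOp g s.2 s.1, s.2 + d.toInt)) := by
  refine ⟨1, ?_⟩
  have hne : ¬ (conf prog l₀ bits (some q) tape p s).state = (compile prog l₀ bits).halt := by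
    simp [conf, compile]
  have h' : (compile prog l₀ bits).δ (conf prog l₀ bits (some q) tape p s).state
      ((conf prog l₀ bits (some q) tape p s).ctape (conf prog l₀ bits (some q) tape p s).chead) =
      (g, d, a, d', q') := h
  rw [Function.iterate_one, DcqTM.step, if_neg hne]
  simp only [h']
  simp only [conf, applyGate_pureTape]

theorem leads_of_control_idle {q : (Bool × Fin 9) × ((L × Tag) ⊕ Fin (bits.length + 1))}
    {q' : CtlState L bits.length}
    {tape : ℤ → Sym} {p : ℤ} (s : (Label → ℂ) × ℤ) {d' : Disp} {a : Sym}
    (h : control prog bits (some q) (tape p) = (.idle, .stay, a, d', q')) :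
    (compile prog l₀ bits).Leads (conf prog l₀ bits (some q) tape p s)
      (conf prog l₀ bits q' (Function.update tape p a) (p + d'.toInt) s) := by
  have := leads_of_control (l₀ := l₀) (s := s) h
  rw [gateOp_idle] at this
  simpa [Disp.toInt] using this

theorem leads_move (n : ℕ) (hn : n ≤ 8) (d : Bool) (ph : (L × Tag) ⊕ Fin (bits.length + 1))
    (tape : ℤ → Sym) (p : ℤ) (s : (Label → ℂ) × ℤ) :
    (compile prog l₀ bits).Leads (conf prog l₀ bits (some ((d, counter n), ph)) tape p s)
      (conf prog l₀ bits (some ((d, counter 0), ph)) tape (p + unitOf d * n) s) := by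
  induction n generalizing p with
  | zero => simpa using DcqTM.Leads.refl _
  | succ n ih =>
    have hc : ((counter (n + 1) : Fin 9) : ℕ) = n + 1 := by simp [counter]; omega
    have h : control prog bits (some ((d, counter (n + 1)), ph)) (tape p) =
        (.idle, .stay, tape p, dispOf d, some ((d, counter n), ph)) := by
      simp only [control, hc, Nat.succ_ne_zero, if_false, Nat.add_sub_cancel]
    have h1 := leads_of_control_idle (l₀ := l₀) s h
    rw [Function.update_eq_self, dispOf_toInt] at h1
    refine h1.trans ?_
    have h2 := ih (by omega) (p + unitOf d)
    have h3 : p + unitOf d * ((n + 1 : ℕ) : ℤ) = p + unitOf d + unitOf d * n := by push_cast; ring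
    rw [h3]
    exact h2

theorem leads_setOut {l : L} {tag : Tag} {d d' : Bool} {n : ℕ} (hn : n ≤ 8) {a : Sym}
    {ph : (L × Tag) ⊕ Fin (bits.length + 1)} {tape : ℤ → Sym} {p : ℤ} (s : (Label → ℂ) × ℤ)
    (h : instrAction bits.length l (prog l) tag (tape p) = setOut a d' n ph) :
    (compile prog l₀ bits).Leads (conf prog l₀ bits (some ((d, counter 0), .inl (l, tag))) tape p s)
      (conf prog l₀ bits (some ((d', counter 0), ph)) (Function.update tape p a)
        (p + unitOf d' * n) s) := by
  have h1 : control prog bits (some ((d, counter 0), .inl (l, tag))) (tape p) =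
      (.idle, .stay, a, .stay, some ((d', counter n), ph)) := by
    rw [control, if_pos counter_zero]; exact h
  have h2 := leads_of_control_idle (l₀ := l₀) s h1
  have h3 : p + Disp.stay.toInt = p := add_zero p
  rw [h3] at h2
  exact h2.trans (leads_move n hn d' ph _ p s)

theorem trackStride_le (j : Option K') : trackStride j ≤ 8 := by
  cases j <;> simp [trackStride]

theorem trackBase_le (j : Option K') : trackBase j ≤ 8 := by
  rcases j with _ | k
  · decide
  · cases k <;> decide

theorem trackBase_add_trackStride_le (j : Option K') : trackBase j + trackStride j ≤ 8 := by
  rcases j with _ | k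
  · decide
  · cases k <;> decide

theorem unitOf_not (d : Bool) : unitOf (!d) = -unitOf d := by cases d <;> rfl

theorem cell_succ (j : Option K') (i : ℕ) :
    cell j i + unitOf (trackRight j) * trackStride j = cell j (i + 1) := by
  simp only [cell]; push_cast; ring

theorem cell_pred (j : Option K') (i : ℕ) :
    cell j (i + 1) + unitOf (!trackRight j) * trackStride j = cell j i := by
  rw [unitOf_not, ← cell_succ]; ring

theorem cell_zero (j : Option K') : cell j 0 + unitOf (!trackRight j) * trackBase j = 0 := by
  rw [unitOf_not]; simp only [cell]; push_cast; ring

theorem zero_add_cell_one (j : Option K') :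
    0 + unitOf (trackRight j) * ((trackBase j + trackStride j : ℕ) : ℤ) = cell j 1 := by
  simp only [cell]; push_cast; ring

/-- The direction stored along with a phase of an instruction does not matter. -/
def AtPhase (prog : L → BitInstr L) (l₀ : L) (bits : List Bool) (l : L) (tag : Tag)
    (stk : Option K' → List Bool) (p : ℤ) (s : (Label → ℂ) × ℤ)
    (c : Config (compile prog l₀ bits)) : Prop :=
  ∃ d, c = conf prog l₀ bits (some ((d, counter 0), .inl (l, tag))) (tapeOfStacks stk) p s

theorem AtPhase.leads {l l' : L} {tag tag' : Tag} {d' : Bool} {n : ℕ} {a : Sym}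
    {stk stk' : Option K' → List Bool} {p p' : ℤ} {s : (Label → ℂ) × ℤ}
    {c : Config (compile prog l₀ bits)} (hc : AtPhase prog l₀ bits l tag stk p s c) (hn : n ≤ 8)
    (h : instrAction bits.length l (prog l) tag (tapeOfStacks stk p) =
      setOut a d' n (.inl (l', tag')))
    (hstk : Function.update (tapeOfStacks stk) p a = tapeOfStacks stk')
    (hp : p + unitOf d' * n = p') :
    ∃ c', (compile prog l₀ bits).Leads c c' ∧ AtPhase prog l₀ bits l' tag' stk' p' s c' := by
  obtain ⟨d, rfl⟩ := hc
  refine ⟨_, leads_setOut hn s h, d', ?_⟩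
  rw [hstk, hp]

theorem update_tapeOfStacks_self {stk : Option K' → List Bool} {p : ℤ} {a : Sym}
    (h : tapeOfStacks stk p = a) : Function.update (tapeOfStacks stk) p a = tapeOfStacks stk := by
  rw [← h, Function.update_eq_self]

/-- The instruction `I` works on the stack `j`. -/
def BitInstr.UsesStack (I : BitInstr L) (j : Option K') : Prop :=
  (∃ b l, I = .push j b l) ∨ ∃ f, I = .pop j f

/-- Rows 1 up to the length of the stack are not blank, so the climb stops exactly one row above the
top; `m` is the remaining distance. -/
theorem AtPhase.seek {l : L} {j : Option K'} (hI : (prog l).UsesStack j)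
    {stk : Option K' → List Bool} {s : (Label → ℂ) × ℤ} (m : ℕ) {i : ℕ} (hi : 1 ≤ i)
    (him : i + m = (stk j).length + 1)
    {c : Config (compile prog l₀ bits)} (hc : AtPhase prog l₀ bits l .seek stk (cell j i) s c) :
    ∃ c', (compile prog l₀ bits).Leads c c' ∧
      AtPhase prog l₀ bits l .seek stk (cell j ((stk j).length + 1)) s c' := by
  induction m generalizing i c with
  | zero =>
    refine ⟨c, .refl c, ?_⟩
    rw [← him]; exact hc
  | succ m ih =>
    obtain ⟨b, hb⟩ := Option.ne_none_iff_exists'.1 (slot_ne_none (l := stk j) hi (by omega))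
    rw [← tapeOfStacks_cell] at hb
    obtain ⟨c', hcc, hc'⟩ := hc.leads (trackStride_le j) (l' := l) (tag' := .seek)
      (by rcases hI with ⟨b', l', h⟩ | ⟨f, h⟩ <;> (rw [h, hb]; rfl))
      (update_tapeOfStacks_self hb) (cell_succ j i)
    obtain ⟨c'', hcc', hc''⟩ := ih (by omega) (by omega) hc'
    exact ⟨c'', hcc.trans hcc', hc''⟩

theorem AtPhase.start_seek {l : L} {j : Option K'} (hI : (prog l).UsesStack j)
    {stk : Option K' → List Bool} {s : (Label → ℂ) × ℤ}
    {c : Config (compile prog l₀ bits)} (hc : AtPhase prog l₀ bits l .start stk 0 s c) :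
    ∃ c', (compile prog l₀ bits).Leads c c' ∧
      AtPhase prog l₀ bits l .seek stk (cell j ((stk j).length + 1)) s c' := by
  obtain ⟨c', hcc, hc'⟩ := hc.leads (trackBase_add_trackStride_le j) (l' := l) (tag' := .seek)
    (by rcases hI with ⟨b', l', h⟩ | ⟨f, h⟩ <;> (rw [h]; rfl))
    (update_tapeOfStacks_self rfl) (zero_add_cell_one j)
  obtain ⟨c'', hcc', hc''⟩ := hc'.seek hI (stk j).length le_rfl (by omega)
  exact ⟨c'', hcc.trans hcc', hc''⟩

/-- The first blank on the way down is row 0. Meanwhile the control state carries the popped bit `r`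
on which the next instruction depends. -/
theorem AtPhase.back {l : L} {j : Option K'} {l' : L} {r : Option Bool}
    (hI : (∃ b, prog l = .push j b l') ∨ ∃ f, prog l = .pop j f ∧ f r = l')
    {stk : Option K' → List Bool} {s : (Label → ℂ) × ℤ} {i : ℕ} (hi : i ≤ (stk j).length)
    {c : Config (compile prog l₀ bits)} (hc : AtPhase prog l₀ bits l (.back r) stk (cell j i) s c) :
    ∃ c', (compile prog l₀ bits).Leads c c' ∧ AtPhase prog l₀ bits l' .start stk 0 s c' := by
  induction i generalizing c with
  | zero =>
    have hb : tapeOfStacks stk (cell j 0) = none := by rw [tapeOfStacks_cell, slot_zero]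
    exact hc.leads (trackBase_le j)
      (by rcases hI with ⟨b', h⟩ | ⟨f, h, rfl⟩ <;> (rw [h, hb]; rfl))
      (update_tapeOfStacks_self hb) (cell_zero j)
  | succ i ih =>
    obtain ⟨b, hb⟩ := Option.ne_none_iff_exists'.1 (slot_ne_none (l := stk j) (i := i + 1)
      (by omega) hi)
    rw [← tapeOfStacks_cell] at hb
    obtain ⟨c', hcc, hc'⟩ := hc.leads (trackStride_le j) (l' := l) (tag' := .back r)
      (by rcases hI with ⟨b', h⟩ | ⟨f, h, rfl⟩ <;> (rw [h, hb]; rfl))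
      (update_tapeOfStacks_self hb) (cell_pred j i)
    obtain ⟨c'', hcc', hc''⟩ := ih (by omega) hc'
    exact ⟨c'', hcc.trans hcc', hc''⟩

theorem AtPhase.bitStep {c₁ c₂ : BitCfg L} (h : c₂ ∈ bitStep prog c₁)
    {c : Config (compile prog l₀ bits)}
    (hc : AtPhase prog l₀ bits c₁.label .start c₁.stk 0 c₁.quantum c) :
    ∃ c', (compile prog l₀ bits).Leads c c' ∧
      AtPhase prog l₀ bits c₂.label .start c₂.stk 0 c₂.quantum c' := by
  obtain ⟨l, stk, s⟩ := c₁
  rw [DCQ.bitStep, Option.mem_def] at h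
  simp only at hc h
  cases hI : prog l with
  | act i l' =>
    rw [hI] at h
    obtain rfl := (Option.some.inj h).symm
    obtain ⟨d, rfl⟩ := hc
    refine ⟨_, leads_of_control (g := letterGate i) (d := letterDisp i) (d' := .stay)
      (a := tapeOfStacks stk 0) (q' := some ((true, counter 0), .inl (l', .start))) ?_, true, ?_⟩
    · rw [control, if_pos counter_zero]
      simp only [hI]
      rfl
    · rw [Function.update_eq_self]
      rfl
  | halt => rw [hI] at h; cases h
  | push j b l' =>
    rw [hI] at h
    obtain rfl := (Option.some.inj h).symm
    obtain ⟨c', hcc, hc'⟩ := hc.start_seek (j := j) (Or.inl ⟨b, l', hI⟩)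
    have hb : tapeOfStacks stk (cell j ((stk j).length + 1)) = none := by
      rw [tapeOfStacks_cell, slot_of_length_lt (by omega)]
    obtain ⟨c'', hcc', hc''⟩ := hc'.leads (trackStride_le j) (l' := l) (tag' := .back none)
      (by rw [hI, hb]; rfl) (update_tapeOfStacks_push stk j b) (cell_pred j _)
    obtain ⟨c₃, hcc'', h₃⟩ := hc''.back (Or.inl ⟨b, hI⟩) (by simp)
    exact ⟨c₃, (hcc.trans hcc').trans hcc'', h₃⟩
  | pop j f =>
    rw [hI] at h
    obtain rfl := (Option.some.inj h).symm
    obtain ⟨c', hcc, hc'⟩ := hc.start_seek (j := j) (Or.inr ⟨f, hI⟩)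
    have hb : tapeOfStacks stk (cell j ((stk j).length + 1)) = none := by
      rw [tapeOfStacks_cell, slot_of_length_lt (by omega)]
    obtain ⟨c'', hcc', hc''⟩ := hc'.leads (trackStride_le j) (l' := l) (tag' := .pull)
      (by rw [hI, hb]; rfl) (update_tapeOfStacks_self hb) (cell_pred j _)
    cases hs : stk j with
    -- The retreat from row 1 ends in row 0, and the blank found there reveals that the stack is
    -- empty.
    | nil =>
      rw [hs] at hc''
      have hb0 : tapeOfStacks stk (cell j 0) = none := by rw [tapeOfStacks_cell, slot_zero]
      obtain ⟨c₃, hcc'', h₃⟩ := hc''.leads (trackBase_le j) (l' := f none) (tag' := .start)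
        (by rw [hI, List.length_nil, hb0]; rfl)
        (update_tapeOfStacks_self hb0) (cell_zero j)
      refine ⟨c₃, (hcc.trans hcc').trans hcc'', ?_⟩
      have : Function.update stk j [] = stk := by rw [← hs, Function.update_eq_self]
      simpa [this] using h₃
    | cons b t =>
      have hb1 : tapeOfStacks stk (cell j (stk j).length) = some b := by
        rw [tapeOfStacks_cell, hs, slot_cons, List.length_cons, if_pos rfl]
      obtain ⟨m, hm⟩ : ∃ m, (stk j).length = m + 1 := ⟨t.length, by rw [hs]; rfl⟩
      obtain ⟨c₃, hcc'', h₃⟩ := hc''.leads (trackStride_le j) (l' := l) (tag' := .back (some b))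
        (by rw [hI, hb1]; rfl) (update_tapeOfStacks_pop hs)
        (by rw [hm]; exact cell_pred j m) (p' := cell j m)
      obtain ⟨c₄, hcc₃, h₄⟩ := h₃.back (j := j) (l' := f (some b)) (Or.inr ⟨f, hI, rfl⟩)
        (by rw [Function.update_self, List.length_tail, hm]; simp)
      refine ⟨c₄, ((hcc.trans hcc').trans hcc'').trans hcc₃, ?_⟩
      simpa [hs] using h₄

theorem AtPhase.reaches {c₁ c₂ : BitCfg L}
    (h : Relation.ReflTransGen (fun a b => b ∈ DCQ.bitStep prog a) c₁ c₂)
    {c : Config (compile prog l₀ bits)}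
    (hc : AtPhase prog l₀ bits c₁.label .start c₁.stk 0 c₁.quantum c) :
    ∃ c', (compile prog l₀ bits).Leads c c' ∧
      AtPhase prog l₀ bits c₂.label .start c₂.stk 0 c₂.quantum c' := by
  induction h with
  | refl => exact ⟨c, .refl c, hc⟩
  | tail _ h ih =>
    obtain ⟨c', hcc, hc'⟩ := ih
    obtain ⟨c'', hcc', hc''⟩ := hc'.bitStep h
    exact ⟨c'', hcc.trans hcc', hc''⟩

/-- Here `m` digits remain to be written. That all other cells keep their contents later supplies
the blanks on both sides of the number. -/
theorem leads_output (tape : ℤ → Sym) (s : (Label → ℂ) × ℤ)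
    (m i : ℕ) (him : i + m = bits.length) :
    ∃ tape' p, (compile prog l₀ bits).Leads
      (conf prog l₀ bits (some ((true, counter 0), .inr ⟨i, by omega⟩)) tape (2 + i) s)
      (conf prog l₀ bits none tape' p s) ∧
      (∀ j : ℤ, j < 2 + i ∨ 2 + bits.length ≤ j → tape' j = tape j) ∧
      ∀ (j : ℕ) (hj : j < bits.length), i ≤ j → tape' (2 + j) = some bits[j] := by
  induction m generalizing i tape with
  | zero =>
    have h : control prog bits (some ((true, counter 0), .inr ⟨i, by omega⟩)) (tape (2 + i)) =
        (.idle, .stay, tape (2 + i), .stay, none) := by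
      rw [control, if_pos counter_zero]
      simp only [outputAction]
      rw [dif_neg (by omega)]
    have h1 := leads_of_control_idle (l₀ := l₀) s h
    rw [Function.update_eq_self] at h1
    exact ⟨_, _, h1, fun _ _ => rfl, fun j hj hij => by omega⟩
  | succ m ih =>
    have hi : i < bits.length := by omega
    have h : control prog bits (some ((true, counter 0), .inr ⟨i, by omega⟩)) (tape (2 + i)) =
        (.idle, .stay, some bits[i], .right,
          some ((true, counter 0), .inr ⟨i + 1, by omega⟩)) := by
      rw [control, if_pos counter_zero]
      simp only [outputAction]
      rw [dif_pos hi]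
    have h1 := leads_of_control_idle (l₀ := l₀) s h
    obtain ⟨tape', p, h2, h3, h4⟩ := ih (Function.update tape (2 + i) (some bits[i])) (i + 1)
      (by omega)
    have hp : (2 + (i : ℤ)) + Disp.right.toInt = 2 + ((i + 1 : ℕ) : ℤ) := by
      simp only [Disp.toInt]; push_cast; ring
    rw [hp] at h1
    refine ⟨tape', p, h1.trans h2, fun j hj => ?_, fun j hj hij => ?_⟩
    · rw [h3 j (by omega), Function.update_of_ne (by omega)]
    · rcases Nat.eq_or_lt_of_le hij with rfl | hlt
      · rw [h3 _ (by omega), Function.update_self]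
      · exact h4 j hj hlt

theorem stringNat_natString (n : ℕ) : stringNat (natString n) = n := by
  induction n using Nat.binaryRec' with
  | zero => simp [natString, stringNat]
  | bit b n h ih =>
    rw [natString, Nat.bits_append_bit _ _ h]
    rw [stringNat, List.foldr_cons]
    change Nat.bit b (stringNat (natString n)) = _
    rw [ih]

/-- Rows are counted from the bottom, so the reversed list places `x` on the tape in reading order,
with its last digit on top of the stack. -/
theorem tapeOfStacks_input (x : List Bool) :
    tapeOfStacks (Function.update (fun _ => []) none x.reverse) = tapeOfWord (x.map some) := by
  funext p
  unfold tapeOfStacks tapeOfWord locate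
  by_cases hp : 0 < p
  · rw [if_pos hp, if_pos (by omega)]
    simp only [Function.update_self]
    rw [slot, if_neg (by omega), List.reverse_reverse]
    have : p.toNat - 1 = (p - 1).toNat := by omega
    rw [this, List.getD_eq_getElem?_getD, List.getElem?_map]
    cases x[(p - 1).toNat]? <;> rfl
  · rw [if_neg hp, if_neg (by omega), Function.update_of_ne (by simp)]
    simp [slot]

/-- With the input stack empty all positive cells are blank. The cell 1 then delimits the empty
output string, and the digits of `n`, written from the cell 2 on, are followed by a blank. -/
theorem outputs_compile {n : ℕ} {x : List Bool} {l₁ : L} {stk : Option K' → List Bool}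
    {w : List ℕ}
    (h : Relation.ReflTransGen (fun a b => b ∈ DCQ.bitStep prog a)
      ⟨l₀, Function.update (fun _ => []) none x.reverse, (vacuum, 0)⟩ ⟨l₁, stk, runWord w⟩)
    (hl : prog l₁ = .halt) (hstk : stk none = []) :
    (compile prog l₀ (natString n)).Outputs x emptyState [] (wordState n w) := by
  have hinit : AtPhase prog l₀ (natString n) l₀ .start
      (Function.update (fun _ => []) none x.reverse) 0 (vacuum, 0)
      ((compile prog l₀ (natString n)).init x emptyState) := by
    refine ⟨true, ?_⟩
    have h0 : natString 0 = [] := Nat.zero_bits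
    have ht : tapeOfWord (x.map some ++ none :: (natString 0).map some) =
        tapeOfWord (x.map some) := by
      funext p
      simp only [tapeOfWord, h0, List.map_nil]
      split_ifs
      · rcases lt_or_ge (p - 1).toNat (x.map (some : Bool → Sym)).length with hi | hi
        · rw [List.getD_append _ _ _ _ hi]
        · rw [List.getD_append_right _ _ _ _ hi, List.getD_eq_default _ _ hi]
          cases (p - 1).toNat - (x.map (some : Bool → Sym)).length <;> rfl
      · rfl
    rw [DcqTM.init, ht, initQTape_emptyState, ← tapeOfStacks_input]
    rfl
  obtain ⟨c, hc, d, rfl⟩ := hinit.reaches h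
  simp only at hc
  have h2 := leads_setOut (l₀ := l₀) (bits := natString n) (prog := prog) (l := l₁)
    (tag := .start) (d := d) (d' := true) (n := 2) (by norm_num) (a := tapeOfStacks stk 0)
    (ph := .inr 0) (tape := tapeOfStacks stk) (p := 0) (runWord w) (by rw [hl]; rfl)
  rw [Function.update_eq_self] at h2
  obtain ⟨tape', p, h3, h4, h5⟩ := leads_output (prog := prog) (l₀ := l₀) (bits := natString n)
    (tapeOfStacks stk) (runWord w) (natString n).length 0 (by omega)
  have hp : (0 : ℤ) + unitOf true * ((2 : ℕ) : ℤ) = 2 + ((0 : ℕ) : ℤ) := by simp [unitOf]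
  rw [hp] at h2
  obtain ⟨t, ht⟩ := (hc.trans h2).trans h3
  have hblank : ∀ j : ℤ, 1 ≤ j → tapeOfStacks stk j = none := by
    intro j hj
    have : j = cell none j.toNat := by
      simp [cell, unitOf, trackRight, trackBase, trackStride]; omega
    rw [this, tapeOfStacks_cell, hstk]
    exact slot_of_length_lt (by simp; omega)
  refine ⟨t, _, ht, rfl, ⟨fun i hi => by simp at hi, ?_⟩, ⟨natString n, ⟨fun i hi => ?_, ?_⟩,
    stringNat_natString n⟩, rfl⟩
  · change tape' _ = none
    rw [h4 _ (by simp), hblank _ (by simp)]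
  · change tape' _ = _
    have := h5 i hi (Nat.zero_le _)
    simpa using this
  · change tape' _ = none
    rw [h4 _ (by simp), hblank _ (by simp; omega)]

end

/-! ### Programs with stacks of symbols -/

noncomputable section

open Turing Turing.PartrecToTM2
open Relation (ReflTransGen)

/-! ### Machines with stacks of symbols -/

/-- An instruction of a machine with a read-only input stack of bits, four stacks over a
four-letter alphabet, and a quantum tape on which letters act. -/
inductive SymInstr (L : Type)
  | push (k : K') (γ : Γ') (l : L)
  | pop (k : K') (f : Option Γ' → L)
  | read (f : Option Bool → L)
  | act (i : ℕ) (l : L)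
  | halt

structure SymCfg (L : Type) where
  label : L
  stk : K' → List Γ'
  input : List Bool
  quantum : (Label → ℂ) × ℤ

def symStep {L : Type} (prog : L → SymInstr L) (c : SymCfg L) : Option (SymCfg L) :=
  match prog c.label with
  | .push k γ l => some { c with label := l, stk := Function.update c.stk k (γ :: c.stk k) }
  | .pop k f =>
    some { c with label := f (c.stk k).head?, stk := Function.update c.stk k (c.stk k).tail }
  | .read f => some { c with label := f c.input.head?, input := c.input.tail }
  | .act i l => some { c with label := l, quantum := letterStep c.quantum i }
  | .halt => none

abbrev SymReaches {L : Type} (prog : L → SymInstr L) : SymCfg L → SymCfg L → Prop :=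
  ReflTransGen fun a b => b ∈ symStep prog a

/-- All labels that an instruction may jump to are in `F`. -/
def SymInstr.Targets {L : Type} (F : Set L) : SymInstr L → Prop
  | .push _ _ l => l ∈ F
  | .pop _ f => ∀ o, f o ∈ F
  | .read f => ∀ o, f o ∈ F
  | .act _ l => l ∈ F
  | .halt => True

def upperBit : Γ' → Bool
  | .consₗ => true
  | .cons => true
  | .bit0 => false
  | .bit1 => false

def lowerBit : Γ' → Bool
  | .consₗ => true
  | .cons => false
  | .bit0 => false
  | .bit1 => true

def symOfBits : Bool → Bool → Γ'
  | true, true => .consₗ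
  | true, false => .cons
  | false, false => .bit0
  | false, true => .bit1

theorem symOfBits_upperBit_lowerBit (γ : Γ') : symOfBits (upperBit γ) (lowerBit γ) = γ := by
  cases γ <;> rfl

/-- The upper bit lies nearer to the top: a push writes the lower bit first, and a pop meets the
upper bit first. -/
def bitsOfSyms : List Γ' → List Bool
  | [] => []
  | γ :: s => upperBit γ :: lowerBit γ :: bitsOfSyms s

def bitStacks (stk : K' → List Γ') (input : List Bool) : Option K' → List Bool
  | none => input
  | some k => bitsOfSyms (stk k)

open Classical in
/-- The label `l` as an element of `F`, or `l₀` if it is none. -/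
def restrictLabel {L : Type} {F : Set L} (l₀ : F) (l : L) : F := if h : l ∈ F then ⟨l, h⟩ else l₀

theorem restrictLabel_of_mem {L : Type} {F : Set L} (l₀ : F) {l : L} (h : l ∈ F) :
    restrictLabel l₀ l = ⟨l, h⟩ := dif_pos h

/-- The program for bit stacks; the second component of a label is the bit that has been read or
the progress of writing two bits. -/
def bitProgram {L : Type} (prog : L → SymInstr L) (F : Set L) (l₀ : F) (s : F × Option Bool) :
    BitInstr (F × Option Bool) :=
  match prog s.1, s.2 with
  | .push k γ _, none => .push (some k) (lowerBit γ) (s.1, some true)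
  | .push k γ l, some _ => .push (some k) (upperBit γ) (restrictLabel l₀ l, none)
  | .pop k f, none => .pop (some k) fun
      | none => (restrictLabel l₀ (f none), none)
      | some b => (s.1, some b)
  | .pop k f, some b => .pop (some k) fun o =>
      (restrictLabel l₀ (f (o.map fun b' => symOfBits b b')), none)
  | .read f, _ => .pop none fun o => (restrictLabel l₀ (f o), none)
  | .act i l, _ => .act i (restrictLabel l₀ l, none)
  | .halt, _ => .halt

theorem update_bitStacks (stk : K' → List Γ') (input : List Bool) (k : K') (s : List Γ') :
    Function.update (bitStacks stk input) (some k) (bitsOfSyms s) =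
      bitStacks (Function.update stk k s) input := by
  funext j
  rcases j with _ | k'
  · rfl
  · by_cases h : k' = k
    · subst h; simp [bitStacks]
    · simp [bitStacks, h]

theorem update_bitStacks_none (stk : K' → List Γ') (input input' : List Bool) :
    Function.update (bitStacks stk input) none input' = bitStacks stk input' := by
  funext j
  rcases j with _ | k'
  · simp [bitStacks]
  · simp [bitStacks]

/-- A push, or a pop from a nonempty stack, takes two bit instructions with an intermediate label;
everything else takes one. `Targets` guarantees that `restrictLabel` never falls back on `l₀` along
a run. -/
theorem reaches_of_symStep {L : Type} {prog : L → SymInstr L} {F : Set L} {l₀ : F}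
    {c₁ c₂ : SymCfg L} (h : c₂ ∈ symStep prog c₁) (h₁ : c₁.label ∈ F)
    (hF : (prog c₁.label).Targets F) :
    ∃ h₂ : c₂.label ∈ F, ReflTransGen (fun a b => b ∈ bitStep (bitProgram prog F l₀) a)
      ⟨(⟨c₁.label, h₁⟩, none), bitStacks c₁.stk c₁.input, c₁.quantum⟩
      ⟨(⟨c₂.label, h₂⟩, none), bitStacks c₂.stk c₂.input, c₂.quantum⟩ := by
  obtain ⟨l, stk, input, q⟩ := c₁
  rw [symStep, Option.mem_def] at h
  simp only at h hF h₁
  cases hI : prog l with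
  | push k γ l' =>
    rw [hI] at h hF
    obtain rfl := (Option.some.inj h).symm
    refine ⟨hF, ?_⟩
    refine (ReflTransGen.single (b := ⟨(⟨l, h₁⟩, some true),
      Function.update (bitStacks stk input) (some k) (lowerBit γ :: bitsOfSyms (stk k)),
      q⟩) ?_).tail ?_
    · rw [bitStep, bitProgram]
      simp only [hI]
      rfl
    · rw [bitStep, bitProgram]
      simp only [hI]
      rw [restrictLabel_of_mem l₀ (show l' ∈ F from hF), Function.update_idem, Function.update_self]
      rw [← update_bitStacks]
      rfl
  | pop k f =>
    rw [hI] at h hF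
    obtain rfl := (Option.some.inj h).symm
    refine ⟨hF _, ?_⟩
    simp only
    cases hs : stk k with
    | nil =>
      refine ReflTransGen.single ?_
      rw [bitStep, bitProgram]
      simp only [hI]
      have h1 : bitStacks stk input (some k) = [] := by rw [bitStacks, hs]; rfl
      simp only [h1, List.head?_nil, List.tail_nil]
      rw [restrictLabel_of_mem l₀ (hF none), ← update_bitStacks]
      rfl
    | cons γ s =>
      have h1 : bitStacks stk input (some k) = upperBit γ :: lowerBit γ :: bitsOfSyms s := by
        rw [bitStacks, hs]; rfl
      refine (ReflTransGen.single (b := ⟨(⟨l, h₁⟩, some (upperBit γ)),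
        Function.update (bitStacks stk input) (some k) (lowerBit γ :: bitsOfSyms s), q⟩) ?_).tail ?_
      · rw [bitStep, bitProgram]
        simp only [hI, h1]
        rfl
      · rw [bitStep, bitProgram]
        simp only [hI]
        rw [Function.update_idem, Function.update_self]
        simp only [List.head?_cons, List.tail_cons, Option.map_some, symOfBits_upperBit_lowerBit]
        rw [restrictLabel_of_mem l₀ (hF (some γ)), update_bitStacks]
        rfl
  | read f =>
    rw [hI] at h hF
    obtain rfl := (Option.some.inj h).symm
    refine ⟨hF _, ReflTransGen.single ?_⟩
    rw [bitStep, bitProgram]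
    simp only [hI]
    have h1 : bitStacks stk input none = input := rfl
    rw [h1, restrictLabel_of_mem l₀ (hF _), update_bitStacks_none]
    rfl
  | act i l' =>
    rw [hI] at h hF
    obtain rfl := (Option.some.inj h).symm
    refine ⟨hF, ReflTransGen.single ?_⟩
    rw [bitStep, bitProgram]
    simp only [hI]
    rw [restrictLabel_of_mem l₀ (show l' ∈ F from hF)]
    rfl
  | halt => rw [hI] at h; cases h

theorem reaches_of_symReaches {L : Type} {prog : L → SymInstr L} {F : Set L} {l₀ : F}
    (hF : ∀ l ∈ F, (prog l).Targets F) {c₁ c₂ : SymCfg L} (h : SymReaches prog c₁ c₂)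
    (h₁ : c₁.label ∈ F) :
    ∃ h₂ : c₂.label ∈ F, ReflTransGen (fun a b => b ∈ bitStep (bitProgram prog F l₀) a)
      ⟨(⟨c₁.label, h₁⟩, none), bitStacks c₁.stk c₁.input, c₁.quantum⟩
      ⟨(⟨c₂.label, h₂⟩, none), bitStacks c₂.stk c₂.input, c₂.quantum⟩ := by
  induction h with
  | refl => exact ⟨h₁, .refl⟩
  | tail _ h ih =>
    obtain ⟨h₂, hr⟩ := ih
    obtain ⟨h₃, hr'⟩ := reaches_of_symStep (l₀ := l₀) h h₂ (hF _ h₂)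
    exact ⟨h₃, hr.trans hr'⟩

/-- For every program for symbol stacks with finitely many labels there is a quantum Turing machine
that outputs the states prepared by the words which the program applies. -/
theorem exists_machine_of_program {L : Type} (prog : L → SymInstr L) {F : Set L} (hfin : F.Finite)
    (hF : ∀ l ∈ F, (prog l).Targets F) {l₀ : L} (h₀ : l₀ ∈ F) (n : ℕ) :
    ∃ M : DcqTM, ∀ (x : List Bool) (w : List ℕ) (l₁ : L) (stk : K' → List Γ'),
      SymReaches prog ⟨l₀, fun _ => [], x.reverse, (vacuum, 0)⟩ ⟨l₁, stk, [], runWord w⟩ →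
      prog l₁ = .halt → M.Outputs x emptyState [] (wordState n w) := by
  have : Finite F := hfin
  refine ⟨compile (bitProgram prog F ⟨l₀, h₀⟩) (⟨l₀, h₀⟩, none) (natString n),
    fun x w l₁ stk h hl => ?_⟩
  obtain ⟨h₁, hr⟩ := reaches_of_symReaches (l₀ := ⟨l₀, h₀⟩) hF h h₀
  have hinit : bitStacks (fun _ => []) x.reverse =
      Function.update (fun _ => []) none x.reverse := by
    funext j
    rcases j with _ | k
    · simp [bitStacks]
    · simp [bitStacks, bitsOfSyms]
  simp only [hinit] at hr
  refine outputs_compile hr ?_ rfl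
  simp only [bitProgram, hl]

/-! ### States prepared by words are directly computable -/

theorem symReaches_foldl_letterStep (w : List ℕ) (s : (Label → ℂ) × ℤ) :
    SymReaches (fun i : ℕ => if h : i < w.length then SymInstr.act w[i] (i + 1) else .halt)
      ⟨0, fun _ => [], [], s⟩ ⟨w.length, fun _ => [], [], w.foldl letterStep s⟩ := by
  have : ∀ i ≤ w.length,
      SymReaches (fun i : ℕ => if h : i < w.length then SymInstr.act w[i] (i + 1) else .halt)
      ⟨0, fun _ => [], [], s⟩ ⟨i, fun _ => [], [], (w.take i).foldl letterStep s⟩ := by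
    intro i hi
    induction i with
    | zero => exact .refl
    | succ i ih =>
      refine (ih (by omega)).tail ?_
      rw [symStep]
      simp only [dif_pos (show i < w.length by omega)]
      rw [List.take_add_one, List.foldl_append, List.getElem?_eq_getElem (by omega)]
      rfl
  simpa using this w.length le_rfl

/-- A fixed word is a straight-line program with one label for each position, and needs no input. -/
theorem wordState_mem_DCOMPq (n : ℕ) (w : List ℕ) :
    (⟨n, wordState n w⟩ : Σ n, QState n) ∈ DCOMPq := by
  obtain ⟨M, hM⟩ := exists_machine_of_program
    (fun i : ℕ => if h : i < w.length then SymInstr.act w[i] (i + 1) else .halt)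
    (Set.finite_Iic w.length)
    (by
      intro i _
      split_ifs with h
      · exact h
      · trivial) (l₀ := 0) (Nat.zero_le _) n
  exact ⟨M, hM [] w _ _ (symReaches_foldl_letterStep w _) (by simp)⟩

end

/-! ### Machines for computable sequences of words -/

noncomputable section

open Turing Turing.PartrecToTM2
open Relation (ReflTransGen)

/-! ### Words as natural numbers -/

/-- The number whose binary digits spell the letters of a word in unary, each followed by `0`, and
a final `1`. -/
def encodeWord (w : List ℕ) : ℕ := w.foldr (fun i m => 2 ^ i * (2 * m) + (2 ^ i - 1)) 1

theorem encodeWord_pos (w : List ℕ) : 0 < encodeWord w := by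
  induction w with
  | nil => decide
  | cons i w ih =>
    have : 0 < 2 ^ i * (2 * encodeWord w) := by positivity
    exact Nat.add_pos_left this _

theorem primrec_encodeWord : Primrec encodeWord := by
  have hp : Primrec fun x : List ℕ × ℕ × ℕ => 2 ^ x.2.1 :=
    primrec_two_pow.comp (Primrec.fst.comp Primrec.snd)
  have hm : Primrec fun x : List ℕ × ℕ × ℕ => 2 * x.2.2 :=
    Primrec.nat_mul.comp (Primrec.const 2) (Primrec.snd.comp Primrec.snd)
  have h := Primrec.nat_add.comp (Primrec.nat_mul.comp hp hm)
    (Primrec.nat_sub.comp hp (Primrec.const 1))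
  have h2 := Primrec.list_foldr (f := fun w : List ℕ => w) (g := fun _ => 1)
    (h := fun _ (p : ℕ × ℕ) => 2 ^ p.1 * (2 * p.2) + (2 ^ p.1 - 1)) Primrec.id (Primrec.const 1) h
  exact h2

/-- The term 2 ^ i − 1 fills the lowest i places with ones below a zero and the digits of m.
Positivity of m keeps this zero from being a leading digit, which `Nat.bits` would drop; the final 1
of `encodeWord` serves this purpose. -/
theorem bits_two_pow_mul_add {m : ℕ} (hm : 0 < m) (i : ℕ) :
    Nat.bits (2 ^ i * (2 * m) + (2 ^ i - 1)) = List.replicate i true ++ false :: Nat.bits m := by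
  induction i with
  | zero =>
    have : 2 ^ 0 * (2 * m) + (2 ^ 0 - 1) = Nat.bit false m := by simp [Nat.bit]
    rw [this, Nat.bits_append_bit _ _ (by omega)]
    rfl
  | succ i ih =>
    have hp : 0 < 2 ^ i := by positivity
    have : 2 ^ (i + 1) * (2 * m) + (2 ^ (i + 1) - 1) =
        Nat.bit true (2 ^ i * (2 * m) + (2 ^ i - 1)) := by
      rw [Nat.bit_val, pow_succ]
      have h1 : 2 ^ i * 2 * (2 * m) = 2 * (2 ^ i * (2 * m)) := by ring
      rw [h1, Bool.toNat_true]
      omega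
    rw [this, Nat.bits_append_bit _ _ (fun _ => rfl), ih, List.replicate_succ]
    rfl

theorem bits_encodeWord_cons (i : ℕ) (w : List ℕ) :
    Nat.bits (encodeWord (i :: w)) = List.replicate i true ++ false :: Nat.bits (encodeWord w) :=
  bits_two_pow_mul_add (encodeWord_pos w) i

def digitSym (b : Bool) : Γ' := bif b then .bit1 else .bit0

theorem trNum_bit1 (m : Num) : trNum m.bit1 = .bit1 :: trNum m := by cases m <;> rfl

theorem trNum_bit0 {m : Num} (hm : m ≠ 0) : trNum m.bit0 = .bit0 :: trNum m := by
  cases m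
  · exact absurd rfl hm
  · rfl

/-- The stack machine of Mathlib and the tape format agree: both list binary digits, least
significant first. Input and result can thus be handled digit by digit. -/
theorem trNat_eq_map_bits (n : ℕ) : trNat n = (Nat.bits n).map digitSym := by
  induction n using Nat.binaryRec' with
  | zero => simp
  | bit b n h ih =>
    rw [Nat.bits_append_bit _ _ h, List.map_cons, ← ih, trNat, trNat, ← Num.ofNat'_eq,
      ← Num.ofNat'_eq, Num.ofNat'_bit]
    cases b with
    | true => exact trNum_bit1 _
    | false =>
      refine trNum_bit0 ?_
      rw [Num.ofNat'_eq]
      have : n ≠ 0 := fun h0 => by simpa using h h0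
      exact_mod_cast this

/-! ### A program that computes a word and applies it -/

/-- The statements of the stack machine for partial recursive functions. -/
abbrev PStmt := TM2.Stmt (fun _ : K' => Γ') Λ' (Option Γ')

/-- The labels of a program that loads its input, runs a stack machine, and applies the word that
is encoded by the result. -/
inductive EvalLabel
  | start
  | load
  | put (b : Bool)
  | run (s : PStmt) (v : Option Γ')
  | restore (k : K') (γ : Γ') (s : PStmt) (v : Option Γ')
  | count (c : Fin 18)
  | emit (c : Fin 18)
  | done

open EvalLabel

/-- A peek becomes a pop followed by a push of the same symbol. Statements that touch no stack are
rendered by the letter 0, which acts as the identity. -/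
def runInstr : PStmt → Option Γ' → SymInstr EvalLabel
  | .push k f s, v => .push k (f v) (run s v)
  | .peek k f s, v => .pop k fun
      | none => run s (f v none)
      | some γ => restore k γ s (f v (some γ))
  | .pop k f s, v => .pop k fun o => run s (f v o)
  | .load f s, v => .act 0 (run s (f v))
  | .branch p s₁ s₂, v => .act 0 (run (cond (p v) s₁ s₂) v)
  | .goto f, v => .act 0 (run (tr (f v)) v)
  | .halt, _ => .act 0 (count 0)

/-- `count` tallies ones modulo 18, and a zero emits the letter reached. The tally begun by the
final one of the code meets the terminator and is discarded. -/
def evalProgram (c : ToPartrec.Code) : EvalLabel → SymInstr EvalLabel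
  | start => .push .main .cons load
  | load => .read fun
      | none => run (tr (trNormal c .halt)) none
      | some b => put b
  | put b => .push .main (digitSym b) load
  | run s v => runInstr s v
  | restore k γ s v => .push k γ (run s v)
  | count i => .pop .main fun
      | some .bit1 => count (i + 1)
      | some .bit0 => emit i
      | _ => done
  | emit i => .act i (count 0)
  | done => .halt

/-- The label with which the execution goes on in a configuration of the stack machine. -/
def resume : Option Λ' → Option Γ' → EvalLabel
  | some l, v => run (tr l) v
  | none, _ => count 0

/-- One step of the `TM2` machine executes a whole statement, which is unfolded here into one or two
instructions for each constructor. -/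
theorem reaches_stepAux (c : ToPartrec.Code) (s : PStmt) (v : Option Γ') (S : K' → List Γ')
    (q : (Label → ℂ) × ℤ) :
    SymReaches (evalProgram c) ⟨run s v, S, [], q⟩
      ⟨resume (TM2.stepAux s v S).l (TM2.stepAux s v S).var, (TM2.stepAux s v S).stk, [], q⟩ := by
  induction s generalizing v S with
  | push k f s ih => exact (ih v _).head rfl
  | peek k f s ih =>
    rw [TM2.stepAux]
    cases hS : S k with
    | nil =>
      refine (ih _ _).head ?_
      rw [symStep]
      simp only [evalProgram, runInstr, hS, List.head?_nil, List.tail_nil]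
      rw [← hS, Function.update_eq_self]
      rfl
    | cons γ t =>
      refine ((ih (f v (some γ)) S).head (a := ⟨restore k γ s (f v (some γ)),
        Function.update S k t, [], q⟩) ?_).head ?_
      · rw [symStep]
        simp only [evalProgram]
        rw [Function.update_idem, Function.update_self, ← hS, Function.update_eq_self]
        rfl
      · rw [symStep]
        simp only [evalProgram, runInstr, hS, List.head?_cons, List.tail_cons]
        rfl
  | pop k f s ih => exact (ih _ _).head rfl
  | load f s ih =>
    refine (ih _ _).head ?_
    rw [symStep]
    simp only [evalProgram, runInstr, letterStep_zero]
    rfl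
  | branch p s₁ s₂ ih₁ ih₂ =>
    have h : (⟨run (cond (p v) s₁ s₂) v, S, [], q⟩ : SymCfg EvalLabel) ∈
        symStep (evalProgram c) ⟨run (.branch p s₁ s₂) v, S, [], q⟩ := by
      rw [symStep]
      simp only [evalProgram, runInstr, letterStep_zero]
      rfl
    rw [TM2.stepAux]
    cases hp : p v with
    | true => rw [hp] at h; exact (ih₁ v S).head h
    | false => rw [hp] at h; exact (ih₂ v S).head h
  | goto f =>
    refine ReflTransGen.single ?_
    rw [symStep]
    simp only [evalProgram, runInstr, letterStep_zero]
    rfl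
  | halt =>
    refine ReflTransGen.single ?_
    rw [symStep]
    simp only [evalProgram, runInstr, letterStep_zero]
    rfl

theorem reaches_of_tm2Reaches (c : ToPartrec.Code) (q : (Label → ℂ) × ℤ)
    {a b : TM2.Cfg (fun _ : K' => Γ') Λ' (Option Γ')}
    (h : StateTransition.Reaches (TM2.step tr) a b) :
    SymReaches (evalProgram c) ⟨resume a.l a.var, a.stk, [], q⟩
      ⟨resume b.l b.var, b.stk, [], q⟩ := by
  induction h with
  | refl => exact .refl
  | @tail b b' _ h ih =>
    obtain ⟨_ | l, v, S⟩ := b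
    · cases h
    · obtain rfl := (Option.some.inj h).symm
      exact ih.trans (reaches_stepAux c (tr l) v S q)

theorem K'.update_elim_main (a b c d a' : List Γ') :
    Function.update (K'.elim a b c d) .main a' = K'.elim a' b c d := K'.elim_update_main

/-- The input is popped from its last digit on, so pushing it to `main` leaves the least significant
digit on top. -/
theorem reaches_load (c : ToPartrec.Code) (q : (Label → ℂ) × ℤ) (x : List Bool) (s : List Γ') :
    SymReaches (evalProgram c) ⟨load, K'.elim s [] [] [], x.reverse, q⟩
      ⟨load, K'.elim (x.map digitSym ++ s) [] [] [], [], q⟩ := by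
  induction x using List.reverseRecOn generalizing s with
  | nil => exact .refl
  | append_singleton x b ih =>
    rw [List.reverse_append, List.reverse_singleton, List.map_append, List.append_assoc]
    refine ((ih (digitSym b :: s)).head (a := ⟨put b, K'.elim s [] [] [], x.reverse, q⟩) ?_).head
      rfl
    rw [symStep]
    simp only [evalProgram]
    rw [K'.elim_main, K'.update_elim_main]
    rfl

theorem reaches_count_replicate (c : ToPartrec.Code) (q : (Label → ℂ) × ℤ) (i : ℕ) (a : Fin 18)
    (s : List Γ') :
    SymReaches (evalProgram c)
      ⟨count a, K'.elim ((List.replicate i true).map digitSym ++ s) [] [] [], [], q⟩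
      ⟨count (a + Fin.ofNat 18 i), K'.elim s [] [] [], [], q⟩ := by
  induction i generalizing a with
  | zero =>
    have : a + Fin.ofNat 18 0 = a := add_zero a
    rw [this]
    exact .refl
  | succ i ih =>
    have : a + Fin.ofNat 18 (i + 1) = a + 1 + Fin.ofNat 18 i := by
      ext; simp [Fin.val_add]; omega
    rw [this]
    refine (ih (a + 1)).head ?_
    rw [symStep]
    simp only [evalProgram]
    rw [K'.elim_main, K'.update_elim_main]
    rfl

theorem letterStep_mod (q : (Label → ℂ) × ℤ) (i : ℕ) : letterStep q (i % 18) = letterStep q i := by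
  rw [letterStep, letterStep, letterGate_mod, letterDisp_mod]

/-- A letter may exceed 17, but the emitted residue modulo 18 has the same effect, so finitely many
labels suffice for all words. -/
theorem reaches_count (c : ToPartrec.Code) (q : (Label → ℂ) × ℤ) (w : List ℕ) :
    SymReaches (evalProgram c)
      ⟨count 0, K'.elim (trList [encodeWord w]) [] [] [], [], q⟩
      ⟨done, fun _ => [], [], w.foldl letterStep q⟩ := by
  have hnil : K'.elim [] [] [] [] = fun _ => [] := by funext k; cases k <;> rfl
  rw [trList, trList, trNat_eq_map_bits]
  induction w generalizing q with
  | nil =>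
    have h1 : Nat.bits (encodeWord []) = [true] := by simp [encodeWord]
    rw [h1]
    refine (reaches_count_replicate c q 1 0 [.cons]).tail ?_
    rw [symStep]
    simp only [evalProgram]
    rw [K'.elim_main, K'.update_elim_main, List.tail_cons, hnil]
    rfl
  | cons i w ih =>
    rw [bits_encodeWord_cons, List.map_append, List.append_assoc]
    refine (reaches_count_replicate c q i 0 _).trans ?_
    rw [zero_add]
    refine ((ih (letterStep q i)).head (a := ⟨emit (Fin.ofNat 18 i), K'.elim
      ((Nat.bits (encodeWord w)).map digitSym ++ [.cons]) [] [] [], [], q⟩) ?_).head ?_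
    · rw [symStep]
      simp only [evalProgram]
      have : ((Fin.ofNat 18 i : Fin 18) : ℕ) = i % 18 := rfl
      rw [this, letterStep_mod]
      rfl
    · rw [symStep]
      simp only [evalProgram]
      rw [K'.elim_main, K'.update_elim_main]
      rfl

/-- The labels that occur in a run of `evalProgram c`. -/
def EvalLabel.Occurs (c : ToPartrec.Code) : EvalLabel → Prop
  | run s _ => some s ∈ TM2.stmts tr (codeSupp c .halt)
  | restore _ _ s _ => some s ∈ TM2.stmts tr (codeSupp c .halt)
  | _ => True

instance : Finite K' :=
  Finite.of_injective (β := Fin 4) (fun k => ⟨trackNum k, trackNum_lt k⟩)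
    (by intro a b h; rw [← trackOfNat_trackNum a, ← trackOfNat_trackNum b, Fin.mk.inj h])

/-- The stack machine has infinitely many labels in total, but a fixed code is supported on the
finite set `codeSupp`, whose statements have finitely many substatements. -/
theorem finite_occurs (c : ToPartrec.Code) : {l | EvalLabel.Occurs c l}.Finite := by
  have hS : {s : PStmt | some s ∈ TM2.stmts tr (codeSupp c .halt)}.Finite :=
    (Finset.finite_toSet (TM2.stmts tr (codeSupp c .halt))).preimage
      (Option.some_injective _).injOn
  have h1 := Set.Finite.image2 run hS (Set.finite_univ (α := Option Γ'))
  have h2 := Set.Finite.image2 (fun (x : K' × Γ' × Option Γ') s => restore x.1 x.2.1 s x.2.2)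
    Set.finite_univ hS
  refine ((((h1.union h2).union (Set.finite_range put)).union ((Set.finite_range count).union
    (Set.finite_range emit))).union (Set.toFinite {start, load, done})).subset ?_
  rintro (_ | _ | b | ⟨s, v⟩ | ⟨k, γ, s, v⟩ | i | i | _) h
  · simp
  · simp
  · simp
  · exact .inl (.inl (.inl (.inl ⟨s, h, v, trivial, rfl⟩)))
  · exact .inl (.inl (.inl (.inr ⟨(k, γ, v), trivial, s, h, rfl⟩)))
  · simp
  · simp
  · simp

theorem tr_mem_stmts {c : ToPartrec.Code} {l : Λ'} (h : l ∈ codeSupp c .halt) :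
    some (tr l) ∈ TM2.stmts tr (codeSupp c .halt) := by
  classical
  exact Finset.some_mem_insertNone.2 (Finset.mem_biUnion.2 ⟨l, h, TM2.stmts₁_self⟩)

/-- Passing to a substatement stays within `TM2.stmts`, and jumps stay within the support by
`tr_supports`. -/
theorem targets_occurs (c : ToPartrec.Code) :
    ∀ l ∈ {l | EvalLabel.Occurs c l}, (evalProgram c l).Targets {l | EvalLabel.Occurs c l} := by
  have hsupp := tr_supports c .halt
  have sub : ∀ {s s' : PStmt}, some s ∈ TM2.stmts tr (codeSupp c .halt) → s' ∈ TM2.stmts₁ s →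
      some s' ∈ TM2.stmts tr (codeSupp c .halt) := fun h h' => TM2.stmts_trans h' h
  rintro (_ | _ | b | ⟨s, v⟩ | ⟨k, γ, s, v⟩ | i | i | _) h
  · trivial
  · intro o
    cases o with
    | none => exact tr_mem_stmts (codeSupp_self c .halt (trStmts₁_self _))
    | some b => trivial
  · trivial
  · cases s with
    | push k f s => exact sub h (by simp [TM2.stmts₁, TM2.stmts₁_self])
    | peek k f s =>
      intro o
      cases o <;> exact sub h (by simp [TM2.stmts₁, TM2.stmts₁_self])
    | pop k f s => exact fun o => sub h (by simp [TM2.stmts₁, TM2.stmts₁_self])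
    | load f s => exact sub h (by simp [TM2.stmts₁, TM2.stmts₁_self])
    | branch p s₁ s₂ =>
      refine sub (s' := cond (p v) s₁ s₂) h ?_
      cases p v <;> simp [TM2.stmts₁, TM2.stmts₁_self]
    | goto f =>
      let _ : Inhabited Λ' := ⟨trNormal c .halt⟩
      have h1 : TM2.SupportsStmt (codeSupp c .halt) (.goto f : PStmt) :=
        TM2.stmts_supportsStmt hsupp h
      exact tr_mem_stmts (h1 v)
    | halt => trivial
  · exact h
  · intro o
    rcases o with _ | (_ | _ | _ | _) <;> trivial
  · trivial
  · trivial

/-- For every computable sequence of words, a machine computes the sequence of the states that they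
prepare. -/
theorem exists_machine_of_computable {f : ℕ → List ℕ} (hf : Computable f) (n : ℕ) :
    ∃ M : DcqTM, ∀ k, M.Outputs (natString k) emptyState [] (wordState n (f k)) := by
  have hg : Computable fun k => encodeWord (f k) := primrec_encodeWord.to_comp.comp hf
  obtain ⟨c, hc⟩ := ToPartrec.Code.exists_code (Nat.Partrec'.part_iff₁.2 hg.partrec)
  obtain ⟨M, hM⟩ := exists_machine_of_program (evalProgram c) (finite_occurs c) (targets_occurs c)
    (l₀ := start) trivial n
  refine ⟨M, fun k => hM (natString k) (f k) done (fun _ => []) ?_ rfl⟩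
  have hnil : K'.elim [] [] [] [] = fun _ => [] := by funext k; cases k <;> rfl
  have h1 : SymReaches (evalProgram c) ⟨start, fun _ => [], (natString k).reverse, (vacuum, 0)⟩
      ⟨load, K'.elim (trList [k]) [] [] [], [], (vacuum, 0)⟩ := by
    rw [trList, trList, trNat_eq_map_bits]
    refine (reaches_load c (vacuum, 0) (natString k) [.cons]).head ?_
    rw [← hnil, symStep]
    simp only [evalProgram]
    rw [K'.elim_main, K'.update_elim_main]
    rfl
  have h2 : StateTransition.Reaches (TM2.step tr) (init c [k]) (halt [encodeWord (f k)]) := by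
    have h3 := hc ⟨[k], rfl⟩
    have h4 : halt [encodeWord (f k)] ∈ StateTransition.eval (TM2.step tr) (init c [k]) := by
      rw [tr_eval, h3]
      simp only [PFun.coe_val, Part.map_eq_map, Part.map_some]
      exact Part.mem_some _
    exact (StateTransition.mem_eval.1 h4).1
  have h5 := reaches_of_tm2Reaches c (vacuum, 0) h2
  have h6 := reaches_count c (vacuum, 0) (f k)
  exact ((h1.tail rfl).trans h5).trans h6

end

/-! ### Search for words, and the inclusion of `COMPc` in `COMPq` -/

noncomputable section

/-! ### Comparison of fractions -/

/-- The fractions `x` and `y` differ by at most `c / K`. -/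
def FracClose (c K : ℕ) (x y : ℕ × ℕ × ℕ) : Prop :=
  K * (x.1 * y.2.2 + y.2.1 * x.2.2) ≤
    c * (x.2.2 * y.2.2) + K * (x.2.1 * y.2.2 + y.1 * x.2.2) ∧
  K * (x.2.1 * y.2.2 + y.1 * x.2.2) ≤
    c * (x.2.2 * y.2.2) + K * (x.1 * y.2.2 + y.2.1 * x.2.2)

instance (c K : ℕ) (x y : ℕ × ℕ × ℕ) : Decidable (FracClose c K x y) :=
  inferInstanceAs (Decidable (_ ∧ _))

/-- Denominators are cleared and negative terms moved across, so that the test uses only sums and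
products of natural numbers. -/
theorem fracClose_iff {c K : ℕ} {x y : ℕ × ℕ × ℕ} (hK : 0 < K) (hx : 0 < x.2.2)
    (hy : 0 < y.2.2) : FracClose c K x y ↔ |fracVal x - fracVal y| ≤ c / K := by
  obtain ⟨p, q, d⟩ := x
  obtain ⟨p', q', d'⟩ := y
  simp only at hx hy
  have hK' : (0 : ℝ) < K := by exact_mod_cast hK
  have hd : (0 : ℝ) < d := by exact_mod_cast hx
  have hd' : (0 : ℝ) < d' := by exact_mod_cast hy
  have hsub : fracVal (p, q, d) - fracVal (p', q', d') =
      (((p : ℝ) - q) * d' - (p' - q') * d) / (d * d') := by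
    simp only [fracVal]; field_simp
  rw [hsub, abs_div, abs_of_pos (mul_pos hd hd'), div_le_div_iff₀ (mul_pos hd hd') hK',
    ← abs_of_pos hK',
    ← abs_mul, abs_le, FracClose]
  rw [← Nat.cast_le (α := ℝ), ← Nat.cast_le (α := ℝ)]
  push_cast
  constructor
  · rintro ⟨h1, h2⟩
    constructor <;> nlinarith
  · rintro ⟨h1, h2⟩
    constructor <;> nlinarith

theorem primrec_fracClose (c : ℕ) :
    Primrec fun z : ℕ × (ℕ × ℕ × ℕ) × (ℕ × ℕ × ℕ) => decide (FracClose c z.1 z.2.1 z.2.2) := by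
  have hK : Primrec fun z : ℕ × (ℕ × ℕ × ℕ) × (ℕ × ℕ × ℕ) => z.1 := Primrec.fst
  have hx : Primrec fun z : ℕ × (ℕ × ℕ × ℕ) × (ℕ × ℕ × ℕ) => z.2.1 :=
    Primrec.fst.comp Primrec.snd
  have hy : Primrec fun z : ℕ × (ℕ × ℕ × ℕ) × (ℕ × ℕ × ℕ) => z.2.2 :=
    Primrec.snd.comp Primrec.snd
  have hx1 := Primrec.fst.comp hx
  have hx2 := Primrec.fst.comp (Primrec.snd.comp hx)
  have hx3 := Primrec.snd.comp (Primrec.snd.comp hx)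
  have hy1 := Primrec.fst.comp hy
  have hy2 := Primrec.fst.comp (Primrec.snd.comp hy)
  have hy3 := Primrec.snd.comp (Primrec.snd.comp hy)
  have hl := Primrec.nat_mul.comp hK (Primrec.nat_add.comp (Primrec.nat_mul.comp hx1 hy3)
    (Primrec.nat_mul.comp hy2 hx3))
  have hr := Primrec.nat_mul.comp hK (Primrec.nat_add.comp (Primrec.nat_mul.comp hx2 hy3)
    (Primrec.nat_mul.comp hy1 hx3))
  have hc := Primrec.nat_mul.comp (Primrec.const c) (Primrec.nat_mul.comp hx3 hy3)
  have h := (Primrec.nat_le.comp hl (Primrec.nat_add.comp hc hr)).and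
    (Primrec.nat_le.comp hr (Primrec.nat_add.comp hc hl))
  exact h.decide

/-- A rational number, given by sign, numerator and denominator, as a difference over a
denominator. -/
def fracOfTriple (x : Bool × ℕ × ℕ) : ℕ × ℕ × ℕ :=
  (bif x.1 then 0 else x.2.1, bif x.1 then x.2.1 else 0, x.2.2)

theorem primrec_fracOfTriple : Primrec fracOfTriple := by
  have hu : Primrec fun x : Bool × ℕ × ℕ => x.2.1 := Primrec.fst.comp Primrec.snd
  have h := Primrec.pair (Primrec.cond Primrec.fst (Primrec.const 0) hu)
    (Primrec.pair (Primrec.cond Primrec.fst hu (Primrec.const 0))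
      (Primrec.snd.comp Primrec.snd))
  exact h

theorem fracVal_fracOfTriple (x : Bool × ℕ × ℕ) : fracVal (fracOfTriple x) = ratOfTriple x := by
  obtain ⟨_ | _, u, v⟩ := x <;> simp [fracOfTriple, fracVal, ratOfTriple]

/-- The list is fixed and each test is computable on its own. No uniformity in the index is needed,
so the approximating functions of the entries may be chosen independently. -/
theorem computable_list_all {α ι : Type*} [Primcodable α] {g : ι → α → Bool}
    (hg : ∀ i, Computable (g i)) (l : List ι) : Computable fun x => l.all fun i => g i x := by
  induction l with
  | nil => exact Computable.const true
  | cons i l ih => exact Primrec.and.to_comp.comp (hg i) ih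

theorem computable_fracClose_entryApprox (n A B sh c : ℕ) {F : ℕ → Bool × ℕ × ℕ}
    (hF : Computable F) {prec : ℕ → ℕ} (hprec : Computable prec) {word : ℕ → List ℕ}
    (hword : Computable word) :
    Computable fun x : ℕ × ℕ => decide (FracClose c (prec x.1)
      (entryApprox n A B sh (word x.2, prec x.1)) (fracOfTriple (F (prec x.1)))) := by
  have hK : Computable fun x : ℕ × ℕ => prec x.1 := hprec.comp Computable.fst
  have hw : Computable fun x : ℕ × ℕ => word x.2 := hword.comp Computable.snd
  have h1 := (primrec_entryApprox n A B sh).to_comp.comp (Computable.pair hw hK)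
  have h2 := primrec_fracOfTriple.to_comp.comp (hF.comp hK)
  have h3 := (primrec_fracClose c).to_comp.comp (Computable.pair hK (Computable.pair h1 h2))
  exact h3

/-! ### Computable entries allow a search for words -/

/-- All words are tried in order until the rational approximations of all entries agree up to a
tolerance. Density makes the search end, and the tolerance makes any accepted word good. -/
theorem exists_computable_words {n : ℕ} (ρ : QState n)
    (h : ∀ a b, IsComputableReal (ρ.mat a b).re ∧ IsComputableReal (ρ.mat a b).im) :
    ∃ f : ℕ → List ℕ, Computable f ∧
      ∀ k : ℕ, traceDist ρ (wordState n (f k)) ≤ 1 / ((k : ℝ) + 1) := by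
  have h' : ∀ i : (Fin n → Fin 2) × (Fin n → Fin 2) × Bool,
      IsComputableReal (eighthRoot ^ (bif i.2.2 then 6 else 0) * ρ.mat i.1 i.2.1).re := by
    rintro ⟨a, b, _ | _⟩
    · simpa using (h a b).1
    · simpa only [cond_true, eighthRoot_pow_six_mul_re] using (h a b).2
  choose F hF hFapprox using h'
  -- An accepted word will have entries within 10/`prec k` of those of ρ, and `traceDist_le` costs a
  -- factor `4 ^ n`.
  let prec : ℕ → ℕ := fun k => 10 * 4 ^ n * (k + 1)
  have hprec : Computable prec :=
    (Primrec.nat_mul.comp (Primrec.const (10 * 4 ^ n)) Primrec.succ).to_comp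
  have hprec_pos : ∀ k, 0 < prec k := fun k => by positivity
  let word : ℕ → List ℕ := fun t => ((Encodable.decode t : Option (List ℕ)).getD [])
  have hword : Computable word :=
    (Primrec.option_getD.comp Primrec.decode (Primrec.const [])).to_comp
  let approx : (Fin n → Fin 2) × (Fin n → Fin 2) × Bool → List ℕ × ℕ → ℕ × ℕ × ℕ := fun i =>
    entryApprox n (stringMask i.1) (stringMask i.2.1) (bif i.2.2 then 6 else 0)
  -- The tolerance 3 allows one unit of 1/`prec` each for the distance of some word from ρ, for
  -- `entryApprox` and for `F`. An accepted word is then within 1 + 1 + 3 = 5 units in each real and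
  -- imaginary part, hence within 10 in modulus.
  let g : (Fin n → Fin 2) × (Fin n → Fin 2) × Bool → ℕ × ℕ → Bool := fun i x =>
    decide (FracClose 3 (prec x.1) (approx i (word x.2, prec x.1))
      (fracOfTriple (F i (prec x.1))))
  have hg : ∀ i, Computable (g i) := by
    intro i
    exact computable_fracClose_entryApprox n _ _ _ 3 (hF i) hprec hword
  let p : ℕ → ℕ → Bool := fun k t => (Finset.univ.toList).all fun i => g i (k, t)
  have hp : Computable₂ p := computable_list_all hg _
  have hp_iff : ∀ k t, p k t = true ↔ ∀ i,
      |fracVal (approx i (word t, prec k)) - (ratOfTriple (F i (prec k)) : ℝ)| ≤ 3 / prec k := by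
    intro k t
    simp only [p, g, List.all_eq_true, Finset.mem_toList, Finset.mem_univ, true_implies,
      decide_eq_true_eq]
    refine forall_congr' fun i => ?_
    rw [fracClose_iff (hprec_pos k) (entryApprox_den_pos _ _ _ _ _)
      (Nat.pos_of_ne_zero (hFapprox i (prec k) (hprec_pos k)).1), fracVal_fracOfTriple]
    rfl
  have hnorm : ∀ i : Bool, ‖eighthRoot ^ (bif i then 6 else 0)‖ = 1 := by
    intro i
    have h8 : ‖eighthRoot‖ ^ 8 = 1 := by rw [← norm_pow, eighthRoot_pow_eight, norm_one]
    rw [norm_pow, (pow_eq_one_iff_of_nonneg (norm_nonneg _) (by norm_num)).1 h8, one_pow]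
  have happrox : ∀ k w i, |(eighthRoot ^ (bif i.2.2 then 6 else 0) *
      (wordState n w).mat i.1 i.2.1).re - fracVal (approx i (w, prec k))| ≤ 1 / prec k := by
    intro k w i
    refine (abs_entry_sub_entryApprox n i.1 i.2.1 _ w (prec k)).trans ?_
    have : (0 : ℝ) < prec k := by exact_mod_cast hprec_pos k
    exact one_div_le_one_div_of_le this (by linarith)
  have hex : ∀ k, ∃ t, p k t = true := by
    intro k
    have hpos : (0 : ℝ) < prec k := by exact_mod_cast hprec_pos k
    obtain ⟨w, hw⟩ := exists_word_near ρ (one_div_pos.2 hpos)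
    refine ⟨Encodable.encode w, (hp_iff _ _).2 fun i => ?_⟩
    have hwd : word (Encodable.encode w) = w := by simp [word]
    rw [hwd]
    have h1 := happrox k w i
    have h2 := (hFapprox i (prec k) (hprec_pos k)).2
    have h3 : |(eighthRoot ^ (bif i.2.2 then 6 else 0) * ρ.mat i.1 i.2.1).re -
        (eighthRoot ^ (bif i.2.2 then 6 else 0) * (wordState n w).mat i.1 i.2.1).re| ≤
        1 / prec k := by
      rw [← Complex.sub_re, ← mul_sub]
      refine (Complex.abs_re_le_norm _).trans ?_
      rw [norm_mul, hnorm, one_mul]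
      exact (hw _ _).le
    have h4 : (3 : ℝ) / prec k = 1 / prec k + 1 / prec k + 1 / prec k := by ring
    rw [abs_le] at h1 h2 h3 ⊢
    rw [h4]
    constructor <;> linarith [h1.1, h1.2, h2.1, h2.2, h3.1, h3.2]
  refine ⟨fun k => word (Nat.find (hex k)), hword.comp (computable_find hp hex), fun k => ?_⟩
  have hk := (hp_iff _ _).1 (Nat.find_spec (hex k))
  set w := word (Nat.find (hex k))
  have hpos : (0 : ℝ) < prec k := by exact_mod_cast hprec_pos k
  have hentry : ∀ i : (Fin n → Fin 2) × (Fin n → Fin 2) × Bool,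
      |(eighthRoot ^ (bif i.2.2 then 6 else 0) * (ρ.mat i.1 i.2.1 -
        (wordState n w).mat i.1 i.2.1)).re| ≤ 5 / prec k := by
    intro i
    have h1 := happrox k w i
    have h2 := (hFapprox i (prec k) (hprec_pos k)).2
    have h3 := hk i
    rw [mul_sub, Complex.sub_re]
    have h4 : (5 : ℝ) / prec k = 1 / prec k + 1 / prec k + 3 / prec k := by ring
    rw [abs_le] at h1 h2 h3 ⊢
    rw [h4]
    constructor <;> linarith [h1.1, h1.2, h2.1, h2.2, h3.1, h3.2]
  have hdist : ∀ a b, ‖ρ.mat a b - (wordState n w).mat a b‖ ≤ 10 / prec k := by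
    intro a b
    have h1 := hentry (a, b, false)
    have h2 := hentry (a, b, true)
    simp only [cond_true, cond_false, pow_zero, one_mul, eighthRoot_pow_six_mul_re] at h1 h2
    refine (Complex.norm_le_abs_re_add_abs_im _).trans ((add_le_add h1 h2).trans (le_of_eq ?_))
    ring
  refine (traceDist_le _ _ hdist).trans (le_of_eq ?_)
  simp only [prec]
  push_cast
  have : (4 : ℝ) ^ n ≠ 0 := by positivity
  field_simp

theorem COMPc_subset_COMPq : COMPc ⊆ COMPq := by
  rintro ⟨n, ρ⟩ h
  obtain ⟨f, hf, hd⟩ := exists_computable_words ρ h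
  obtain ⟨M, hM⟩ := exists_machine_of_computable hf n
  refine ⟨M, fun k => wordState n (f k), fun k hk => ⟨wordState_mem_DCOMPq n _, hM k, ?_⟩⟩
  have hk' : (0 : ℝ) < k := by exact_mod_cast hk
  exact (hd k).trans (one_div_le_one_div_of_le hk' (by linarith))

end

end DCQ

theorem theorem1 : DCQ.COMPq = DCQ.COMPc :=
  Set.Subset.antisymm DCQ.COMPq_subset_COMPc DCQ.COMPc_subset_COMPq
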